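/- Let $\Delta>-1$ and $v_0\in\mathbb{Z}$, and let $(X_n)_{n\ge 0}$ be the (linearly) vertex-reinforced random walk on $\mathbb{Z}$ with initial point $v_0$: $X_0=v_0$ almost surely and, for all $n\ge 0$ and $j\in\mathbb{Z}$, almost surely $$\mathbb{P}(X_{n+1}=j\mid X_0,\dots,X_n)=\mathbf{1}_{\{|j-X_n|=1\}}\,\frac{Z_n(j)+\Delta}{Z_n(X_n-1)+Z_n(X_n+1)+2\Delta},$$ where $Z_n(v)=1+\sum_{k=0}^n\mathbf{1}_{\{X_k=v\}}$ for $v\in\mathbb{Z}$. Put $Z_\infty(v)=\lim_{n\to\infty}Z_n(v)\in\mathbb{N}\cup\{\infty\}$, let $R=\{v\in\mathbb{Z}: Z_\infty(v)\neq 1\}$ be the range of the walk and $R'=\{v\in\mathbb{Z}: Z_\infty(v)=\infty\}$ its asymptotic range, and for $x\in\mathbb{Z}$ put $$\alpha_n^-(x)=\frac{Z_n(x-1)}{Z_n(x-1)+Z_n(x+1)},\qquad \alpha_\infty^-(x)=\lim_{n\to\infty}\alpha_n^-(x)\ \text{ when this limit exists.}$$ (a) For all $x\in\mathbb{Z}$,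 $\alpha\in(0,1)$ and $\varepsilon>0$, $$\mathbb{P}\bigl(R'=\{x-2,x-1,x,x+1,x+2\},\ \alpha_\infty^-(x)\text{ exists and }\alpha_\infty^-(x)\in(\alpha-\varepsilon,\alpha+\varepsilon)\bigr)>0.$$ (b) Almost surely $|R|<\infty$, and hence almost surely $|R'|<\infty$. -/

import Mathlib

open MeasureTheory Filter Topology

/-- `Z_n(v)`: one plus the number of visits of the path `p` to `v` up to time `n`. -/
def visits {V : Type*} [DecidableEq V] (p : ℕ → V) (n : ℕ) (v : V) : ℕ :=
  (∑ k ∈ Finset.range (n + 1), if p k = v then 1 else 0) + 1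

/-- `Z_∞(v)`: one plus the total number of visits of the path `p` to `v`. -/
noncomputable def totalVisits {V : Type*} (p : ℕ → V) (v : V) : ℕ∞ :=
  {k : ℕ | p k = v}.encard + 1

/-- The range `R` of a path: the vertices that are visited. -/
def visitedRange {V : Type*} (p : ℕ → V) : Set V :=
  {v | totalVisits p v ≠ 1}

/-- The asymptotic range `R'` of a path: the vertices that are visited infinitely often. -/
def asymptoticRange {V : Type*} (p : ℕ → V) : Set V :=
  {v | totalVisits p v = ⊤}

/-- The σ-algebra `σ(X_0, …, X_n)` of the past of a process up to time `n`. -/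
abbrev pastSigma {Ω V : Type*} [MeasurableSpace V] (X : ℕ → Ω → V) (n : ℕ) : MeasurableSpace Ω :=
  ⨆ k ≤ n, MeasurableSpace.comap (X k) inferInstance

open Classical in
/-- The probability that a vertex self-interacting walk with past path `p` up to time `n`
steps from `p n` to `j` at time `n + 1`. -/
noncomputable def vsirwStep {V : Type*} [DecidableEq V] (G : SimpleGraph V) [G.LocallyFinite]
    (a : V → V → ℝ) (W : ℕ → ℝ) (p : ℕ → V) (n : ℕ) (j : V) : ℝ :=
  if G.Adj (p n) j then
    a (p n) j * W (visits p n j) /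
      ∑ k ∈ G.neighborFinset (p n), a (p n) k * W (visits p n k)
  else 0

/-- `X` is a vertex self-interacting random walk on `G` started at `v₀`, with propensity matrix
`a` and weight function `W`: `X_0 = v₀` almost surely, and the conditional law of `X_{n+1}` given
`σ(X_0, …, X_n)` is the one given by `vsirwStep`. -/
structure IsVSIRW {Ω V : Type*} [MeasurableSpace Ω] [MeasurableSpace V] [DecidableEq V]
    (G : SimpleGraph V) [G.LocallyFinite] (a : V → V → ℝ) (W : ℕ → ℝ) (v₀ : V)
    (X : ℕ → Ω → V) (μ : Measure Ω) : Prop where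
  measurable : ∀ n, Measurable (X n)
  start : ∀ᵐ ω ∂μ, X 0 ω = v₀
  step : ∀ (n : ℕ) (j : V),
    μ[{ω | X (n + 1) ω = j}.indicator (fun _ => (1 : ℝ)) | pastSigma X n]
      =ᵐ[μ] fun ω => vsirwStep G a W (fun k => X k ω) n j

/-- The nearest-neighbour graph on `ℤ`. -/
def intGraph : SimpleGraph ℤ where
  Adj i j := j = i - 1 ∨ j = i + 1
  symm := ⟨fun i j h => by omega⟩
  loopless := ⟨fun i h => by omega⟩

instance intGraphLocallyFinite : intGraph.LocallyFinite := fun i =>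
  Fintype.ofFinset {i - 1, i + 1} (fun j => by
    simp [SimpleGraph.mem_neighborSet, intGraph])

/-- The vertex-reinforced random walk on `ℤ` started at `v₀`: all propensities between neighbours
are `1`, and the weight function is `W(n) = n + Δ`. -/
def IsVRRW {Ω : Type*} [MeasurableSpace Ω] (Δ : ℝ) (v₀ : ℤ) (X : ℕ → Ω → ℤ)
    (μ : Measure Ω) : Prop :=
  IsVSIRW intGraph (fun i j => if j = i - 1 ∨ j = i + 1 then 1 else 0)
    (fun n => (n : ℝ) + Δ) v₀ X μ

/-- `α_n^-(x) = Z_n(x-1) / (Z_n(x-1) + Z_n(x+1))`. -/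
noncomputable def alphaMinus (p : ℕ → ℤ) (x : ℤ) (n : ℕ) : ℝ :=
  (visits p n (x - 1) : ℝ) / ((visits p n (x - 1) : ℝ) + (visits p n (x + 1) : ℝ))

/-! Write Z for the weights, Δ included. Each neighbour of v is chosen with probability proportional
to its weight. Hence the sum of 1/Z(v+1) over the steps v → v+1, minus the sum of 1/Z(v-1) over the
steps v → v-1, is a martingale M(v). Its squared increments 1/z² are dominated by telescoping
differences of 1/z, so M(v) is bounded in L², and it fluctuates little after a time at which both
neighbours of v are heavy. Sums of 1/Z over arrivals at a site are logarithms of its weight up to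
bounded errors, so bounds on M(v) compare weights.

The heart is a deterministic estimate, `RightTrapped.jumpSum_far_le`. Let a path at x not exceed
x+2. A bound on M(x) keeps Z(x+1) below a multiple of Z(x-1); since x is left towards both sides,
Z(x) ≥ θ Z(x+1) for some θ > 1. A bound on M(x+1) then gives log Z(x+2) ≤ (1/θ) log Z(x+1) + const.
So the sum of 1/Z(x+1) over the returns from x+2 is at most a multiple of a convergent series of
j^(-θ). At x+2 the chance of escaping is κ/(κ + Z(x+1)), where κ is the frozen weight of x+3, so
never escaping has positive probability. Confinement and control of the martingales are assumed in
this argument, so the walk is killed when either fails. The exponential of κ times the sum,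
multiplied by one minus the energies of the martingales, is a submartingale up to the killing
(`Trap.potential_le_avg`). It is bounded on surviving paths by the deterministic estimate, and
`survival` concludes.

For (b): when x is hit for the first time from the left, all sites beyond it are fresh. Forcing the
first departures from x to the left, each at cost at most 2, creates the required imbalance, so the
walk never passes x+2 with probability at least c₀, uniformly in x and in the hitting time
(`exists_confine_prob`). Reaching three sites further thus costs a factor 1 - c₀ each time, and
reflection treats the other side.

For (a): bring the walk to x and let it bounce about αN times to x-1 and (1-α)N times to x+1. For
large N all error terms are small, so with positive probability the walk is `Confined` and log
Z(x+1)/Z(x-1) stays near log((1-α)/α). This quantity converges because M(x) does, and the martingale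
bounds force all five sites to be visited infinitely often. -/

/-! ### Weights and transition probabilities -/

/-- The weight `Z_n(v) + Δ` of the vertex `v` at time `n`. -/
noncomputable def wt (Δ : ℝ) (p : ℕ → ℤ) (n : ℕ) (v : ℤ) : ℝ := (visits p n v : ℝ) + Δ

/-- The probability of a step to the right. -/
noncomputable def stepRight (Δ : ℝ) (p : ℕ → ℤ) (n : ℕ) : ℝ :=
  wt Δ p n (p n + 1) / (wt Δ p n (p n - 1) + wt Δ p n (p n + 1))

/-- The probability of a step to the left. -/
noncomputable def stepLeft (Δ : ℝ) (p : ℕ → ℤ) (n : ℕ) : ℝ :=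
  wt Δ p n (p n - 1) / (wt Δ p n (p n - 1) + wt Δ p n (p n + 1))

lemma visits_succ {V : Type*} [DecidableEq V] (p : ℕ → V) (n : ℕ) (v : V) :
    visits p (n + 1) v = visits p n v + if p (n + 1) = v then 1 else 0 := by
  unfold visits
  rw [Finset.sum_range_succ _ (n + 1)]; omega

lemma one_le_visits {V : Type*} [DecidableEq V] (p : ℕ → V) (n : ℕ) (v : V) :
    1 ≤ visits p n v := by unfold visits; omega

lemma visits_mono {V : Type*} [DecidableEq V] (p : ℕ → V) (v : V) :
    Monotone fun n => visits p n v := by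
  refine monotone_nat_of_le_succ fun n => ?_
  simp only [visits_succ]; omega

lemma visits_congr {V : Type*} [DecidableEq V] {p q : ℕ → V} {n : ℕ}
    (h : ∀ i ≤ n, p i = q i) (v : V) : visits p n v = visits q n v := by
  unfold visits
  congr 1
  refine Finset.sum_congr rfl fun i hi => ?_
  rw [h i (by have := Finset.mem_range.1 hi; omega)]

lemma wt_congr {Δ : ℝ} {p q : ℕ → ℤ} {n : ℕ} (h : ∀ i ≤ n, p i = q i) (v : ℤ) :
    wt Δ p n v = wt Δ q n v := by
  unfold wt; rw [visits_congr h]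

lemma wt_succ (Δ : ℝ) (p : ℕ → ℤ) (n : ℕ) (v : ℤ) :
    wt Δ p (n + 1) v = wt Δ p n v + if p (n + 1) = v then 1 else 0 := by
  unfold wt; rw [visits_succ]; push_cast; ring

lemma wt_mono (Δ : ℝ) (p : ℕ → ℤ) (v : ℤ) : Monotone fun n => wt Δ p n v := by
  intro a b h
  have := visits_mono p v h
  simp only [wt]
  have h2 : (visits p a v : ℝ) ≤ visits p b v := by exact_mod_cast this
  linarith

lemma one_add_le_wt (Δ : ℝ) (p : ℕ → ℤ) (n : ℕ) (v : ℤ) : 1 + Δ ≤ wt Δ p n v := by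
  have h : (1 : ℝ) ≤ visits p n v := by exact_mod_cast one_le_visits p n v
  unfold wt; linarith

lemma wt_pos {Δ : ℝ} (hΔ : -1 < Δ) (p : ℕ → ℤ) (n : ℕ) (v : ℤ) : 0 < wt Δ p n v := by
  have := one_add_le_wt Δ p n v; linarith

lemma stepRight_pos {Δ : ℝ} (hΔ : -1 < Δ) (p : ℕ → ℤ) (n : ℕ) : 0 < stepRight Δ p n :=
  div_pos (wt_pos hΔ _ _ _) (add_pos (wt_pos hΔ _ _ _) (wt_pos hΔ _ _ _))

lemma stepLeft_pos {Δ : ℝ} (hΔ : -1 < Δ) (p : ℕ → ℤ) (n : ℕ) : 0 < stepLeft Δ p n :=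
  div_pos (wt_pos hΔ _ _ _) (add_pos (wt_pos hΔ _ _ _) (wt_pos hΔ _ _ _))

lemma stepLeft_add_stepRight {Δ : ℝ} (hΔ : -1 < Δ) (p : ℕ → ℤ) (n : ℕ) :
    stepLeft Δ p n + stepRight Δ p n = 1 := by
  unfold stepLeft stepRight
  have := add_pos (wt_pos hΔ p n (p n - 1)) (wt_pos hΔ p n (p n + 1))
  rw [← add_div, div_self this.ne']

lemma stepRight_congr {Δ : ℝ} {p q : ℕ → ℤ} {n : ℕ} (h : ∀ i ≤ n, p i = q i) :
    stepRight Δ p n = stepRight Δ q n := by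
  unfold stepRight; simp only [wt_congr h, h n le_rfl]

lemma stepLeft_congr {Δ : ℝ} {p q : ℕ → ℤ} {n : ℕ} (h : ∀ i ≤ n, p i = q i) :
    stepLeft Δ p n = stepLeft Δ q n := by
  unfold stepLeft; simp only [wt_congr h, h n le_rfl]

lemma intGraph_neighborFinset (i : ℤ) : intGraph.neighborFinset i = {i - 1, i + 1} := by
  ext j
  rw [SimpleGraph.mem_neighborFinset]
  simp [intGraph]

/-- The transition probabilities of the vertex-reinforced random walk. -/
noncomputable abbrev vrrwStep (Δ : ℝ) (p : ℕ → ℤ) (n : ℕ) (j : ℤ) : ℝ :=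
  vsirwStep intGraph (fun i j => if j = i - 1 ∨ j = i + 1 then 1 else 0)
    (fun n => (n : ℝ) + Δ) p n j

lemma vrrwStep_eq (Δ : ℝ) (p : ℕ → ℤ) (n : ℕ) (j : ℤ) :
    vrrwStep Δ p n j = if j = p n + 1 then stepRight Δ p n else
      if j = p n - 1 then stepLeft Δ p n else 0 := by
  have h1 : p n - 1 ≠ p n + 1 := by omega
  unfold vrrwStep vsirwStep
  rw [intGraph_neighborFinset, Finset.sum_pair h1]
  simp only [intGraph, true_or, or_true, if_true, one_mul]
  by_cases h : j = p n + 1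
  · subst h; simp [stepRight, wt]
  · by_cases h' : j = p n - 1
    · subst h'; simp [stepLeft, wt, h1]
    · simp [h, h']

/-! ### One-step conditional expectations of the walk -/

section Measure

variable {Ω : Type*} [MeasurableSpace Ω] {μ : Measure Ω} [IsProbabilityMeasure μ]
  {Δ : ℝ} {v₀ : ℤ} {X : ℕ → Ω → ℤ}

/-- The trajectory of a process. -/
def traj (X : ℕ → Ω → ℤ) (ω : Ω) : ℕ → ℤ := fun k => X k ω

lemma measurable_pastSigma {Ω : Type*} {X : ℕ → Ω → ℤ} {n k : ℕ} (h : k ≤ n) : Measurable[pastSigma X n] (X k) := by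
  have : MeasurableSpace.comap (X k) inferInstance ≤ pastSigma X n :=
    le_iSup₂_of_le (f := fun k (_ : k ≤ n) => MeasurableSpace.comap (X k) inferInstance) k h le_rfl
  exact measurable_iff_comap_le.2 this

lemma pastSigma_le (hX : ∀ n, Measurable (X n)) (n : ℕ) :
    pastSigma X n ≤ (inferInstance : MeasurableSpace Ω) :=
  iSup₂_le fun k _ => (hX k).comap_le

/-- The function factors through the countable discrete space of the first `n + 1` positions, on
which every map is measurable. Adaptedness is reduced to this dependence throughout. -/
lemma measurable_of_dependsOn {Ω : Type*} {X : ℕ → Ω → ℤ} {β : Type*} [MeasurableSpace β] {n : ℕ} {f : (ℕ → ℤ) → β}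
    (hf : ∀ p q : ℕ → ℤ, (∀ i ≤ n, p i = q i) → f p = f q) :
    Measurable[pastSigma X n] (fun ω => f (traj X ω)) := by
  have h1 : Measurable[pastSigma X n] (fun ω => fun i : Fin (n + 1) => X i ω) := by
    refine @measurable_pi_lambda _ _ _ (pastSigma X n) _ _ fun i => ?_
    exact measurable_pastSigma (by omega)
  let g : (Fin (n + 1) → ℤ) → β := fun q => f fun k => if h : k < n + 1 then q ⟨k, h⟩ else 0
  have h2 : (fun ω => f (traj X ω)) = g ∘ fun ω => fun i : Fin (n + 1) => X i ω := by
    funext ω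
    refine hf _ _ fun i hi => ?_
    simp [traj, Nat.lt_succ_of_le hi]
  rw [h2]
  exact (Measurable.of_discrete (f := g)).comp h1

lemma integral_mul_step (hX : IsVRRW Δ v₀ X μ) (n : ℕ) (j : ℤ) {g : Ω → ℝ}
    (hg : Measurable[pastSigma X n] g) {C : ℝ} (hC : ∀ ω, |g ω| ≤ C) :
    ∫ ω, g ω * {ω | X (n + 1) ω = j}.indicator (fun _ => (1 : ℝ)) ω ∂μ
      = ∫ ω, g ω * vrrwStep Δ (traj X ω) n j ∂μ := by
  have hm := pastSigma_le hX.measurable n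
  have hs : MeasurableSet {ω | X (n + 1) ω = j} :=
    hX.measurable (n + 1) (measurableSet_singleton j)
  have hi : Integrable ({ω | X (n + 1) ω = j}.indicator (fun _ => (1 : ℝ))) μ :=
    (integrable_const 1).indicator hs
  have h1 := condExp_stronglyMeasurable_mul_of_bound hm hg.stronglyMeasurable hi C
    (ae_of_all _ hC)
  have h2 := integral_condExp hm (μ := μ)
    (f := g * {ω | X (n + 1) ω = j}.indicator (fun _ => (1 : ℝ)))
  refine h2.symm.trans (integral_congr_ae ?_)
  filter_upwards [h1, hX.step n j] with ω e1 e2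
  rw [e1, Pi.mul_apply, e2]
  rfl

lemma ae_step (hX : IsVRRW Δ v₀ X μ) :
    ∀ᵐ ω ∂μ, ∀ n, X (n + 1) ω = X n ω + 1 ∨ X (n + 1) ω = X n ω - 1 := by
  rw [ae_all_iff]
  intro n
  -- For fixed values the forbidden transition has conditional probability 0. There are countably
  -- many pairs, so the null sets can be united.
  have key : ∀ y j : ℤ, j ≠ y + 1 → j ≠ y - 1 → ∀ᵐ ω ∂μ, ¬ (X n ω = y ∧ X (n + 1) ω = j) := by
    intro y j h1 h2
    have hg : Measurable[pastSigma X n] ({ω | X n ω = y}.indicator (fun _ => (1 : ℝ))) :=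
      Measurable.indicator (@measurable_const _ _ _ (pastSigma X n) _)
        (measurable_pastSigma le_rfl (measurableSet_singleton y))
    have h := integral_mul_step hX n j hg (C := 1) (fun ω => by
      by_cases h : X n ω = y <;> simp [Set.indicator, h])
    have h0 : ∀ ω, {ω | X n ω = y}.indicator (fun _ => (1 : ℝ)) ω
        * vrrwStep Δ (traj X ω) n j = 0 := by
      intro ω
      by_cases h : X n ω = y
      · rw [vrrwStep_eq, if_neg, if_neg, mul_zero] <;> simpa [traj, h]
      · simp [Set.indicator, h]
    simp only [h0, integral_zero] at h
    have e : (fun ω => {ω | X n ω = y}.indicator (fun _ => (1 : ℝ)) ω *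
        {ω | X (n + 1) ω = j}.indicator (fun _ => (1 : ℝ)) ω)
        = {ω | X n ω = y ∧ X (n + 1) ω = j}.indicator (fun _ => (1 : ℝ)) := by
      funext ω
      by_cases h : X n ω = y <;> by_cases h' : X (n + 1) ω = j <;> simp [Set.indicator, h, h']
    have hs : MeasurableSet {ω | X n ω = y ∧ X (n + 1) ω = j} :=
      (hX.measurable n (measurableSet_singleton y)).inter
        (hX.measurable (n + 1) (measurableSet_singleton j))
    rw [e, integral_indicator_const _ hs] at h
    have h3 : μ {ω | X n ω = y ∧ X (n + 1) ω = j} = 0 := by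
      simpa [Measure.real, ENNReal.toReal_eq_zero_iff] using h
    simpa [ae_iff] using h3
  have key2 : ∀ᵐ ω ∂μ, ∀ y j : ℤ, j ≠ y + 1 → j ≠ y - 1 → ¬ (X n ω = y ∧ X (n + 1) ω = j) := by
    rw [ae_all_iff]; intro y
    rw [ae_all_iff]; intro j
    by_cases h1 : j ≠ y + 1
    · by_cases h2 : j ≠ y - 1
      · filter_upwards [key y j h1 h2] with ω h _ _ using h
      · exact ae_of_all _ fun ω _ h => absurd h h2
    · exact ae_of_all _ fun ω h => absurd h h1
  filter_upwards [key2] with ω h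
  by_contra hc
  push Not at hc
  exact h _ _ hc.1 hc.2 ⟨rfl, rfl⟩

lemma integral_fiberwise {Y : Ω → ℤ} (hY : Measurable Y) {f : Ω → ℝ} (hf : Integrable f μ) :
    ∫ ω, f ω ∂μ = ∑' y : ℤ, ∫ ω in {ω | Y ω = y}, f ω ∂μ := by
  have h := integral_iUnion (μ := μ) (f := f) (s := fun y => {ω | Y ω = y})
    (fun y => hY (measurableSet_singleton y)) ?_ hf.integrableOn
  · rw [← h]
    have : (⋃ y, {ω | Y ω = y}) = Set.univ := by ext; simp
    rw [this, setIntegral_univ]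
  · intro a b hab
    exact Set.disjoint_left.2 fun ω h1 h2 => hab (h1.symm.trans h2)

/-- The conditional law is given for a fixed target `j`, whereas `X n + d` is random. Splitting over
the countably many values of `X n` makes the target fixed on each piece. -/
lemma integral_mul_indicator_shift (hX : IsVRRW Δ v₀ X μ) (n : ℕ) (d : ℤ)
    {g : Ω → ℝ} (hg : Measurable[pastSigma X n] g) {C : ℝ} (hC : ∀ ω, |g ω| ≤ C)
    (hint : Integrable (fun ω => g ω * vrrwStep Δ (traj X ω) n (X n ω + d)) μ) :
    ∫ ω, g ω * {ω | X (n + 1) ω = X n ω + d}.indicator (fun _ => (1 : ℝ)) ω ∂μ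
      = ∫ ω, g ω * vrrwStep Δ (traj X ω) n (X n ω + d) ∂μ := by
  have hgm := hg.mono (pastSigma_le hX.measurable n) le_rfl
  have hXn := hX.measurable n
  have hs : MeasurableSet {ω | X (n + 1) ω = X n ω + d} :=
    measurableSet_eq_fun (hX.measurable (n + 1)) (hXn.add_const d)
  have hi : Integrable (fun ω => g ω *
      {ω | X (n + 1) ω = X n ω + d}.indicator (fun _ => (1 : ℝ)) ω) μ := by
    refine Integrable.of_bound (hgm.mul (measurable_const.indicator hs)).aestronglyMeasurable C
      (ae_of_all _ fun ω => ?_)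
    have := hC ω
    have h0 := (abs_nonneg (g ω)).trans this
    by_cases h : X (n + 1) ω = X n ω + d <;> simp [Set.indicator, h, this, h0]
  rw [integral_fiberwise hXn hi, integral_fiberwise hXn hint]
  congr 1
  funext y
  have hy : MeasurableSet {ω | X n ω = y} := hXn (measurableSet_singleton y)
  have hgy : Measurable[pastSigma X n] ({ω | X n ω = y}.indicator g) :=
    Measurable.indicator hg (measurable_pastSigma le_rfl (measurableSet_singleton y))
  have h := integral_mul_step hX n (y + d) hgy (C := C) (fun ω => by
    have := hC ω
    have h0 := (abs_nonneg (g ω)).trans this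
    by_cases h : X n ω = y <;> simp [Set.indicator, h, this, h0])
  rw [← integral_indicator hy, ← integral_indicator hy]
  convert h using 2
  · funext ω
    by_cases h : X n ω = y <;> simp [Set.indicator, h]
  · funext ω
    by_cases h : X n ω = y <;> simp [Set.indicator, h]

lemma stepRight_mem (hΔ : -1 < Δ) (p : ℕ → ℤ) (n : ℕ) : |stepRight Δ p n| ≤ 1 := by
  have h1 := stepRight_pos hΔ p n
  have h2 := stepLeft_pos hΔ p n
  have h3 := stepLeft_add_stepRight hΔ p n
  rw [abs_of_pos h1]; linarith

lemma stepLeft_mem (hΔ : -1 < Δ) (p : ℕ → ℤ) (n : ℕ) : |stepLeft Δ p n| ≤ 1 := by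
  have h1 := stepRight_pos hΔ p n
  have h2 := stepLeft_pos hΔ p n
  have h3 := stepLeft_add_stepRight hΔ p n
  rw [abs_of_pos h2]; linarith

lemma integrable_of_pastSigma (hX : IsVRRW Δ v₀ X μ) {n : ℕ}
    {g : Ω → ℝ} (hg : Measurable[pastSigma X n] g) {C : ℝ} (hC : ∀ ω, |g ω| ≤ C) :
    Integrable g μ :=
  Integrable.of_bound (hg.mono (pastSigma_le hX.measurable n) le_rfl).aestronglyMeasurable C
    (ae_of_all _ hC)

lemma integrable_mul_step (hX : IsVRRW Δ v₀ X μ) {n : ℕ} {g : Ω → ℝ}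
    (hg : Measurable[pastSigma X n] g) {C : ℝ} (hC : ∀ ω, |g ω| ≤ C) {s : (ℕ → ℤ) → ℝ}
    (hs : ∀ p, |s p| ≤ 1) (hs' : ∀ p q : ℕ → ℤ, (∀ i ≤ n, p i = q i) → s p = s q) :
    Integrable (fun ω => g ω * s (traj X ω)) μ := by
  refine integrable_of_pastSigma hX (n := n) (C := C) ?_ fun ω => ?_
  · exact hg.mul (measurable_of_dependsOn hs')
  · rw [abs_mul]
    have h1 := hC ω
    have h2 := hs (traj X ω)
    nlinarith [abs_nonneg (g ω), abs_nonneg (s (traj X ω))]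

lemma integral_mul_indicator_right (hΔ : -1 < Δ) (hX : IsVRRW Δ v₀ X μ) (n : ℕ)
    {g : Ω → ℝ} (hg : Measurable[pastSigma X n] g) {C : ℝ} (hC : ∀ ω, |g ω| ≤ C) :
    ∫ ω, g ω * {ω | X (n + 1) ω = X n ω + 1}.indicator (fun _ => (1 : ℝ)) ω ∂μ
      = ∫ ω, g ω * stepRight Δ (traj X ω) n ∂μ := by
  have e : ∀ ω, vrrwStep Δ (traj X ω) n (X n ω + 1) = stepRight Δ (traj X ω) n := by
    intro ω; rw [vrrwStep_eq]; simp [traj]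
  have h := integral_mul_indicator_shift hX n 1 hg hC (by
    simp only [e]
    exact integrable_mul_step hX hg hC (fun p => stepRight_mem hΔ p n)
      fun p q h => stepRight_congr h)
  simpa only [e] using h

lemma integral_mul_indicator_left (hΔ : -1 < Δ) (hX : IsVRRW Δ v₀ X μ) (n : ℕ)
    {g : Ω → ℝ} (hg : Measurable[pastSigma X n] g) {C : ℝ} (hC : ∀ ω, |g ω| ≤ C) :
    ∫ ω, g ω * {ω | X (n + 1) ω = X n ω - 1}.indicator (fun _ => (1 : ℝ)) ω ∂μ
      = ∫ ω, g ω * stepLeft Δ (traj X ω) n ∂μ := by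
  have e : ∀ ω, vrrwStep Δ (traj X ω) n (X n ω + -1) = stepLeft Δ (traj X ω) n := by
    intro ω; rw [vrrwStep_eq, if_neg, if_pos] <;> simp only [traj] <;> omega
  have h := integral_mul_indicator_shift hX n (-1) hg hC (by
    simp only [e]
    exact integrable_mul_step hX hg hC (fun p => stepLeft_mem hΔ p n)
      fun p q h => stepLeft_congr h)
  simpa only [e, sub_eq_add_neg] using h

/-- The one-step formula: the expectation of a function of the first `n + 2` positions. -/
lemma integral_succ (hΔ : -1 < Δ) (hX : IsVRRW Δ v₀ X μ) (n : ℕ) {f : (ℕ → ℤ) → ℝ}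
    (hf : ∀ p q : ℕ → ℤ, (∀ i ≤ n + 1, p i = q i) → f p = f q) {C : ℝ} (hC : ∀ p, |f p| ≤ C) :
    ∫ ω, f (traj X ω) ∂μ = ∫ ω,
      (stepRight Δ (traj X ω) n * f (Function.update (traj X ω) (n + 1) (X n ω + 1)) +
       stepLeft Δ (traj X ω) n * f (Function.update (traj X ω) (n + 1) (X n ω - 1))) ∂μ := by
  have hdep : ∀ d : ℤ, ∀ p q : ℕ → ℤ, (∀ i ≤ n, p i = q i) →
      f (Function.update p (n + 1) (p n + d)) = f (Function.update q (n + 1) (q n + d)) := by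
    intro d p q h
    refine hf _ _ fun i hi => ?_
    by_cases hi' : i = n + 1
    · subst hi'; simp [h n le_rfl]
    · simp [hi', h i (by omega)]
  have hg : ∀ d : ℤ, Measurable[pastSigma X n]
      (fun ω => f (Function.update (traj X ω) (n + 1) (X n ω + d))) :=
    fun d => measurable_of_dependsOn
      (f := fun p => f (Function.update p (n + 1) (p n + d))) (hdep d)
  have hR := integral_mul_indicator_right hΔ hX n (hg 1) (fun ω => hC _)
  have hL := integral_mul_indicator_left hΔ hX n (hg (-1)) (fun ω => hC _)
  have iR := integrable_mul_step hX (hg 1) (fun ω => hC _) (fun p => stepRight_mem hΔ p n)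
    fun p q h => stepRight_congr h
  have iL := integrable_mul_step hX (hg (-1)) (fun ω => hC _) (fun p => stepLeft_mem hΔ p n)
    fun p q h => stepLeft_congr h
  have hi : ∀ d e : ℤ, Integrable (fun ω => f (Function.update (traj X ω) (n + 1) (X n ω + d)) *
      {ω | X (n + 1) ω = X n ω + e}.indicator (fun _ => (1 : ℝ)) ω) μ := by
    intro d e
    have hs : MeasurableSet {ω | X (n + 1) ω = X n ω + e} :=
      measurableSet_eq_fun (hX.measurable (n + 1)) ((hX.measurable n).add_const e)
    exact (integrable_of_pastSigma hX (hg d) fun ω => hC _).mul_bdd (c := 1)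
      (measurable_const.indicator hs).aestronglyMeasurable (ae_of_all _ fun ω => by
        by_cases h : X (n + 1) ω = X n ω + e <;> simp [Set.indicator, h])
  have hsplit : ∫ ω, f (traj X ω) ∂μ = ∫ ω,
      (f (Function.update (traj X ω) (n + 1) (X n ω + 1)) *
        {ω | X (n + 1) ω = X n ω + 1}.indicator (fun _ => (1 : ℝ)) ω +
       f (Function.update (traj X ω) (n + 1) (X n ω + -1)) *
        {ω | X (n + 1) ω = X n ω + -1}.indicator (fun _ => (1 : ℝ)) ω) ∂μ := by
    refine integral_congr_ae ?_
    filter_upwards [ae_step hX] with ω h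
    have hu : Function.update (traj X ω) (n + 1) (X (n + 1) ω) = traj X ω :=
      Function.update_eq_self (n + 1) (traj X ω)
    rcases h n with h | h
    · have hne : X (n + 1) ω ≠ X n ω + -1 := by omega
      simp only [Set.indicator, Set.mem_ofPred_eq, h, if_true]
      rw [if_neg (by omega), ← h, hu]; simp
    · have hne : X (n + 1) ω ≠ X n ω + 1 := by omega
      simp only [Set.indicator, Set.mem_ofPred_eq, h]
      rw [if_neg (by omega), if_pos (by omega), ← sub_eq_add_neg, ← h, hu]; simp
  rw [hsplit, integral_add (hi _ _) (hi _ _), hR]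
  simp only [← sub_eq_add_neg] at hL iL ⊢
  rw [hL, ← integral_add iR iL]
  refine integral_congr_ae (ae_of_all _ fun ω => ?_)
  simp only; ring

end Measure

/-! ### Killed submartingales and cylinders -/

section Measure

variable {Ω : Type*} [MeasurableSpace Ω] {μ : Measure Ω} [IsProbabilityMeasure μ]
  {Δ : ℝ} {v₀ : ℤ} {X : ℕ → Ω → ℤ}

/-- A lower bound for the probability of surviving forever, given a bounded function which is
a submartingale as long as the walk survives. -/
lemma survival (hΔ : -1 < Δ) (hX : IsVRRW Δ v₀ X μ) (n₀ : ℕ) (A : ℕ → Set (ℕ → ℤ))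
    (Ψ : ℕ → (ℕ → ℤ) → ℝ) {b C : ℝ} (hC : 0 ≤ C)
    (hA : ∀ n, n₀ ≤ n → ∀ p q : ℕ → ℤ, (∀ i ≤ n, p i = q i) → p ∈ A n → q ∈ A n)
    (hΨ : ∀ n, ∀ p q : ℕ → ℤ, (∀ i ≤ n, p i = q i) → Ψ n p = Ψ n q)
    (hmono : ∀ n, n₀ ≤ n → A (n + 1) ⊆ A n)
    (hbd : ∀ n, n₀ ≤ n → ∀ p ∈ A n, 0 ≤ Ψ n p ∧ Ψ n p ≤ C)
    (hstart : ∀ p ∈ A n₀, b ≤ Ψ n₀ p)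
    (hdrift : ∀ n, n₀ ≤ n → ∀ p ∈ A n, ∀ q r : ℕ → ℤ, (∀ i ≤ n, q i = p i) →
      q (n + 1) = p n + 1 → (∀ i ≤ n, r i = p i) → r (n + 1) = p n - 1 →
      Ψ n p ≤ stepRight Δ p n * (A (n + 1)).indicator (Ψ (n + 1)) q +
        stepLeft Δ p n * (A (n + 1)).indicator (Ψ (n + 1)) r) :
    b * μ.real {ω | traj X ω ∈ A n₀} ≤ C * μ.real {ω | ∀ n, n₀ ≤ n → traj X ω ∈ A n} := by
  classical
  have hAiff : ∀ n, n₀ ≤ n → ∀ p q : ℕ → ℤ, (∀ i ≤ n, p i = q i) → (p ∈ A n ↔ q ∈ A n) :=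
    fun n hn p q h => ⟨hA n hn p q h, hA n hn q p fun i hi => (h i hi).symm⟩
  have hmeas : ∀ n, n₀ ≤ n → MeasurableSet {ω | traj X ω ∈ A n} := by
    intro n hn
    have h := measurable_of_dependsOn (X := X) (n := n) (f := fun p => p ∈ A n)
      fun p q h => propext (hAiff n hn p q h)
    exact measurableSet_setOfPred.2 (h.mono (pastSigma_le hX.measurable n) le_rfl)
  -- Killing makes the local submartingale global: off the alive set `Φ` vanishes while its next
  -- value is nonnegative, and on it the drift hypothesis applies. So the expectation of `Φ` never
  -- decreases; it starts above `b` times a probability and stays below `C` times the probability of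
  -- being alive.
  set Φ : ℕ → (ℕ → ℤ) → ℝ := fun n => (A n).indicator (Ψ n) with hΦ
  have hΦdep : ∀ n, n₀ ≤ n → ∀ p q : ℕ → ℤ, (∀ i ≤ n, p i = q i) → Φ n p = Φ n q := by
    intro n hn p q h
    by_cases hp : p ∈ A n
    · have hq := hA n hn p q h hp
      simp only [hΦ, Set.indicator_of_mem hp, Set.indicator_of_mem hq, hΨ n p q h]
    · have hq : q ∉ A n := fun hq => hp ((hAiff n hn p q h).2 hq)
      simp only [hΦ, Set.indicator_of_notMem hp, Set.indicator_of_notMem hq]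
  have hΦ0 : ∀ n, n₀ ≤ n → ∀ p, 0 ≤ Φ n p := fun n hn p =>
    Set.indicator_nonneg (fun p hp => (hbd n hn p hp).1) p
  have hΦC : ∀ n, n₀ ≤ n → ∀ p, Φ n p ≤ C := by
    intro n hn p
    by_cases hp : p ∈ A n
    · simpa only [hΦ, Set.indicator_of_mem hp] using (hbd n hn p hp).2
    · simpa only [hΦ, Set.indicator_of_notMem hp] using hC
  have habs : ∀ n, n₀ ≤ n → ∀ p, |Φ n p| ≤ C := fun n hn p =>
    abs_le.2 ⟨by linarith [hΦ0 n hn p], hΦC n hn p⟩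
  have hint : ∀ n, n₀ ≤ n → Integrable (fun ω => Φ n (traj X ω)) μ := fun n hn =>
    integrable_of_pastSigma hX (measurable_of_dependsOn (hΦdep n hn)) fun ω => habs n hn _
  have hstep : ∀ n, n₀ ≤ n → ∫ ω, Φ n (traj X ω) ∂μ ≤ ∫ ω, Φ (n + 1) (traj X ω) ∂μ := by
    intro n hn
    rw [integral_succ hΔ hX n (hΦdep (n + 1) (by omega)) (habs (n + 1) (by omega))]
    have hu : ∀ d : ℤ, ∀ p q : ℕ → ℤ, (∀ i ≤ n, p i = q i) →
        Φ (n + 1) (Function.update p (n + 1) (p n + d))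
          = Φ (n + 1) (Function.update q (n + 1) (q n + d)) := by
      intro d p q h
      refine hΦdep _ (by omega) _ _ fun i hi => ?_
      by_cases hi' : i = n + 1
      · subst hi'; simp [h n le_rfl]
      · simp [hi', h i (by omega)]
    refine integral_mono (hint n hn) (integrable_of_pastSigma hX (n := n) (C := 2 * C) ?_ ?_) ?_
    · refine measurable_of_dependsOn (f := fun p => stepRight Δ p n *
        Φ (n + 1) (Function.update p (n + 1) (p n + 1)) + stepLeft Δ p n *
        Φ (n + 1) (Function.update p (n + 1) (p n - 1))) fun p q h => ?_
      have h1 := hu 1 p q h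
      have h2 := hu (-1) p q h
      simp only [← sub_eq_add_neg] at h2
      simp only [h1, h2, stepRight_congr h, stepLeft_congr h]
    · intro ω
      refine (abs_add_le _ _).trans ?_
      rw [abs_mul, abs_mul]
      have h1 := habs (n + 1) (by omega) (Function.update (traj X ω) (n + 1) (X n ω + 1))
      have h2 := habs (n + 1) (by omega) (Function.update (traj X ω) (n + 1) (X n ω - 1))
      have h3 := mul_le_mul (stepRight_mem hΔ (traj X ω) n) h1 (abs_nonneg _) zero_le_one
      have h4 := mul_le_mul (stepLeft_mem hΔ (traj X ω) n) h2 (abs_nonneg _) zero_le_one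
      linarith
    · intro ω
      have nonneg : 0 ≤ stepRight Δ (traj X ω) n *
          Φ (n + 1) (Function.update (traj X ω) (n + 1) (X n ω + 1)) +
          stepLeft Δ (traj X ω) n *
          Φ (n + 1) (Function.update (traj X ω) (n + 1) (X n ω - 1)) :=
        add_nonneg (mul_nonneg (stepRight_pos hΔ _ _).le (hΦ0 _ (by omega) _))
          (mul_nonneg (stepLeft_pos hΔ _ _).le (hΦ0 _ (by omega) _))
      by_cases hp : traj X ω ∈ A n
      · have h := hdrift n hn _ hp (Function.update (traj X ω) (n + 1) (X n ω + 1))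
          (Function.update (traj X ω) (n + 1) (X n ω - 1))
          (fun i hi => by simp [show i ≠ n + 1 by omega]) (by simp [traj])
          (fun i hi => by simp [show i ≠ n + 1 by omega]) (by simp [traj])
        simpa only [hΦ, Set.indicator_of_mem hp] using h
      · simpa only [hΦ, Set.indicator_of_notMem hp] using nonneg
  have hlow : b * μ.real {ω | traj X ω ∈ A n₀} ≤ ∫ ω, Φ n₀ (traj X ω) ∂μ := by
    have : ∫ ω, {ω | traj X ω ∈ A n₀}.indicator (fun _ => b) ω ∂μ
        = b * μ.real {ω | traj X ω ∈ A n₀} := by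
      rw [integral_indicator_const _ (hmeas n₀ le_rfl), smul_eq_mul, mul_comm]
    rw [← this]
    refine integral_mono ((integrable_const b).indicator (hmeas n₀ le_rfl)) (hint n₀ le_rfl) fun ω => ?_
    by_cases hp : traj X ω ∈ A n₀
    · simpa [hΦ, Set.indicator, hp] using hstart _ hp
    · simp [hΦ, Set.indicator, hp]
  have hup : ∀ n, n₀ ≤ n → ∫ ω, Φ n (traj X ω) ∂μ ≤ C * μ.real {ω | traj X ω ∈ A n} := by
    intro n hn
    have : ∫ ω, {ω | traj X ω ∈ A n}.indicator (fun _ => C) ω ∂μ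
        = C * μ.real {ω | traj X ω ∈ A n} := by
      rw [integral_indicator_const _ (hmeas n hn), smul_eq_mul, mul_comm]
    rw [← this]
    refine integral_mono (hint n hn) ((integrable_const C).indicator (hmeas n hn)) fun ω => ?_
    by_cases hp : traj X ω ∈ A n
    · simpa [hΦ, Set.indicator, hp] using (hbd n hn _ hp).2
    · simp [hΦ, Set.indicator, hp]
  have hall : ∀ k, b * μ.real {ω | traj X ω ∈ A n₀} ≤ ∫ ω, Φ (n₀ + k) (traj X ω) ∂μ := by
    intro k
    induction k with
    | zero => exact hlow
    | succ k ih => exact ih.trans (hstep (n₀ + k) (by omega))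
  have hanti : Antitone fun k => {ω | traj X ω ∈ A (n₀ + k)} :=
    antitone_nat_of_succ_le fun k ω h => hmono (n₀ + k) (by omega) h
  have hset : {ω | ∀ n, n₀ ≤ n → traj X ω ∈ A n} = ⋂ k, {ω | traj X ω ∈ A (n₀ + k)} := by
    ext ω
    simp only [Set.mem_iInter]
    constructor
    · intro h k; exact h _ (by omega)
    · intro h n hn
      have := h (n - n₀)
      rwa [Nat.add_sub_cancel' hn] at this
  have hlim : Tendsto (fun k => μ.real {ω | traj X ω ∈ A (n₀ + k)}) atTop
      (𝓝 (μ.real {ω | ∀ n, n₀ ≤ n → traj X ω ∈ A n})) := by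
    rw [hset]
    exact (ENNReal.tendsto_toReal (measure_ne_top _ _)).comp
      (tendsto_measure_iInter_atTop (fun k => (hmeas _ (by omega)).nullMeasurableSet) hanti
        ⟨0, measure_ne_top _ _⟩)
  exact ge_of_tendsto (hlim.const_mul C) (Eventually.of_forall fun k =>
    (hall k).trans (hup _ (by omega)))

/-- Positive probability of a cylinder is inherited by its extensions along edges. -/
lemma cylinder_succ_pos (hΔ : -1 < Δ) (hX : IsVRRW Δ v₀ X μ) {n : ℕ} {p q : ℕ → ℤ}
    (hp : 0 < μ {ω | ∀ i ≤ n, X i ω = p i}) (hq : ∀ i ≤ n, q i = p i)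
    (hstep : q (n + 1) = p n + 1 ∨ q (n + 1) = p n - 1) :
    0 < μ {ω | ∀ i ≤ n + 1, X i ω = q i} := by
  classical
  set s := {ω | ∀ i ≤ n, X i ω = p i} with hs
  have hg : Measurable[pastSigma X n] (s.indicator fun _ => (1 : ℝ)) := by
    have h := measurable_of_dependsOn (X := X) (n := n)
      (f := fun r : ℕ → ℤ => if ∀ i ≤ n, r i = p i then (1 : ℝ) else 0) (fun r r' h => by
        have : (∀ i ≤ n, r i = p i) ↔ ∀ i ≤ n, r' i = p i :=
          forall₂_congr fun i hi => by rw [h i hi]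
        simp only [this])
    convert h using 1
    funext ω
    simp only [Set.indicator, hs, Set.mem_ofPred_eq, traj]
    congr
  have hC : ∀ ω, |s.indicator (fun _ => (1 : ℝ)) ω| ≤ 1 := by
    intro ω
    by_cases h : ω ∈ s <;> simp [h]
  have hsm : MeasurableSet s := by
    have : s = ⋂ i, ⋂ (_ : i ≤ n), {ω | X i ω = p i} := by ext; simp [hs]
    rw [this]
    exact MeasurableSet.iInter fun i => MeasurableSet.iInter fun _ =>
      hX.measurable i (measurableSet_singleton _)
  have hpos : 0 < μ.real s := (ENNReal.toReal_pos hp.ne' (measure_ne_top _ _))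
  -- On the cylinder the step probability is the constant `t p`, so the integral is the product of
  -- two positive numbers. It would be 0 if the extended cylinder were null.
  have aux : ∀ (d : ℤ) (t : (ℕ → ℤ) → ℝ), q (n + 1) = p n + d → 0 < t p →
      (∀ r : ℕ → ℤ, (∀ i ≤ n, r i = p i) → t r = t p) →
      ∫ ω, s.indicator (fun _ => (1 : ℝ)) ω *
        {ω | X (n + 1) ω = X n ω + d}.indicator (fun _ => (1 : ℝ)) ω ∂μ
        = ∫ ω, s.indicator (fun _ => (1 : ℝ)) ω * t (traj X ω) ∂μ →
      0 < μ {ω | ∀ i ≤ n + 1, X i ω = q i} := by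
    intro d t hd ht htc h
    have e1 : (fun ω => s.indicator (fun _ => (1 : ℝ)) ω * t (traj X ω))
        = s.indicator fun _ => t p := by
      funext ω
      by_cases hω : ω ∈ s
      · simp only [Set.indicator_of_mem hω, one_mul]
        exact htc _ hω
      · simp [hω]
    rw [e1, integral_indicator_const _ hsm, smul_eq_mul] at h
    have hpos2 := mul_pos hpos ht
    rw [← h] at hpos2
    by_contra hcon
    have h0 : μ {ω | ∀ i ≤ n + 1, X i ω = q i} = 0 := by simpa using hcon
    refine hpos2.ne' (integral_eq_zero_of_ae ?_)
    have h1 : ∀ᵐ ω ∂μ, ¬ ∀ i ≤ n + 1, X i ω = q i := by simpa [ae_iff] using h0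
    filter_upwards [h1] with ω hω
    by_cases hs' : ω ∈ s
    · have : X (n + 1) ω ≠ X n ω + d := by
        intro h
        refine hω fun i hi => ?_
        rcases Nat.lt_or_ge n i with h' | h'
        · obtain rfl : i = n + 1 := by omega
          rw [h, hd, hs' n le_rfl]
        · rw [hs' i h', hq i h']
      simp [Set.indicator, this]
    · simp [hs']
  rcases hstep with h | h
  · exact aux 1 (fun r => stepRight Δ r n) h (stepRight_pos hΔ p n)
      (fun r hr => stepRight_congr hr) (integral_mul_indicator_right hΔ hX n hg hC)
  · have := integral_mul_indicator_left hΔ hX n hg hC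
    exact aux (-1) (fun r => stepLeft Δ r n) (by omega) (stepLeft_pos hΔ p n)
      (fun r hr => stepLeft_congr hr) (by simpa only [← sub_eq_add_neg] using this)

end Measure

/-! ### Step martingales and their energies -/

/-- The sum of the inverse weights at `b` over the steps of `p` from `a` to `b` in the time
interval `[n₀, n)`, counting only steps at which `a` has been visited often enough. -/
noncomputable def jumpSum (Δ : ℝ) (p : ℕ → ℤ) (n₀ : ℕ) (a b : ℤ) (L n : ℕ) : ℝ :=
  ∑ i ∈ Finset.Ico n₀ n, if p i = a ∧ p (i + 1) = b ∧ L ≤ visits p i a then 1 / wt Δ p i b else 0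

/-- The number of steps of `p` from `a` to `b` in the time interval `[n₀, n)`, counting only steps
at which `a` has been visited often enough. -/
def jumpCount (p : ℕ → ℤ) (n₀ : ℕ) (a b : ℤ) (L n : ℕ) : ℕ :=
  ∑ i ∈ Finset.Ico n₀ n, if p i = a ∧ p (i + 1) = b ∧ L ≤ visits p i a then 1 else 0

/-- The martingale of the steps from `v`. -/
noncomputable def stepMart (Δ : ℝ) (p : ℕ → ℤ) (n₀ : ℕ) (v : ℤ) (L n : ℕ) : ℝ :=
  jumpSum Δ p n₀ v (v + 1) L n - jumpSum Δ p n₀ v (v - 1) L n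

/-- The constant in the compensator of the squared martingales. -/
noncomputable def compConst (Δ : ℝ) : ℝ := (2 + Δ) / (1 + Δ)

/-- The square of the martingale of the steps from `v`, corrected to a supermartingale. -/
noncomputable def stepEnergy (Δ : ℝ) (p : ℕ → ℤ) (n₀ : ℕ) (v : ℤ) (L n : ℕ) : ℝ :=
  stepMart Δ p n₀ v L n ^ 2 + compConst Δ / wt Δ p n (v + 1) + compConst Δ / wt Δ p n (v - 1)

section Jumps

variable {Δ : ℝ} {p q : ℕ → ℤ} {n₀ n L : ℕ} {a b v : ℤ}

lemma jumpSum_self : jumpSum Δ p n₀ a b L n₀ = 0 := by simp [jumpSum]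

lemma jumpCount_self : jumpCount p n₀ a b L n₀ = 0 := by simp [jumpCount]

lemma jumpSum_succ (h : n₀ ≤ n) : jumpSum Δ p n₀ a b L (n + 1) = jumpSum Δ p n₀ a b L n +
    if p n = a ∧ p (n + 1) = b ∧ L ≤ visits p n a then 1 / wt Δ p n b else 0 := by
  unfold jumpSum; rw [Finset.sum_Ico_succ_top h]

lemma jumpCount_succ (h : n₀ ≤ n) : jumpCount p n₀ a b L (n + 1) = jumpCount p n₀ a b L n +
    if p n = a ∧ p (n + 1) = b ∧ L ≤ visits p n a then 1 else 0 := by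
  unfold jumpCount; rw [Finset.sum_Ico_succ_top h]

lemma jumpSum_congr (h : ∀ i ≤ n, p i = q i) :
    jumpSum Δ p n₀ a b L n = jumpSum Δ q n₀ a b L n := by
  unfold jumpSum
  refine Finset.sum_congr rfl fun i hi => ?_
  have hi' := (Finset.mem_Ico.1 hi).2
  have h' : ∀ j ≤ i, p j = q j := fun j hj => h j (by omega)
  rw [h i (by omega), h (i + 1) (by omega), visits_congr h', wt_congr h']

lemma stepMart_congr (h : ∀ i ≤ n, p i = q i) :
    stepMart Δ p n₀ v L n = stepMart Δ q n₀ v L n := by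
  unfold stepMart; rw [jumpSum_congr h, jumpSum_congr h]

lemma stepEnergy_congr (h : ∀ i ≤ n, p i = q i) :
    stepEnergy Δ p n₀ v L n = stepEnergy Δ q n₀ v L n := by
  unfold stepEnergy; rw [stepMart_congr h, wt_congr h, wt_congr h]

lemma jumpSum_mono (hΔ : -1 < Δ) : Monotone (jumpSum Δ p n₀ a b L) := by
  refine monotone_nat_of_le_succ fun n => ?_
  rcases Nat.lt_or_ge n n₀ with h | h
  · unfold jumpSum; rw [Finset.Ico_eq_empty_of_le h.le, Finset.Ico_eq_empty_of_le (by omega)]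
  · rw [jumpSum_succ h]
    have := (wt_pos hΔ p n b)
    split_ifs
    · have := (one_div_pos.2 this); linarith
    · simp

lemma jumpSum_nonneg (hΔ : -1 < Δ) : 0 ≤ jumpSum Δ p n₀ a b L n :=
  Finset.sum_nonneg fun i _ => by
    have := (wt_pos hΔ p i b)
    split_ifs <;> positivity

lemma jumpSum_le (hΔ : -1 < Δ) : jumpSum Δ p n₀ a b L n ≤ n * (1 / (1 + Δ)) := by
  have h1 : 0 < 1 + Δ := by linarith
  have h : jumpSum Δ p n₀ a b L n ≤ (Finset.Ico n₀ n).card • (1 / (1 + Δ)) := by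
    refine Finset.sum_le_card_nsmul _ _ _ fun i _ => ?_
    split_ifs
    · exact one_div_le_one_div_of_le h1 (one_add_le_wt _ _ _ _)
    · positivity
  refine h.trans ?_
  rw [nsmul_eq_mul, Nat.card_Ico]
  refine mul_le_mul_of_nonneg_right ?_ (by positivity)
  exact_mod_cast Nat.sub_le n n₀

lemma abs_stepMart_le (hΔ : -1 < Δ) : |stepMart Δ p n₀ v L n| ≤ n * (1 / (1 + Δ)) := by
  have h1 := jumpSum_le (p := p) (n₀ := n₀) (a := v) (b := v + 1) (L := L) (n := n) hΔ
  have h2 := jumpSum_le (p := p) (n₀ := n₀) (a := v) (b := v - 1) (L := L) (n := n) hΔ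
  have h3 := jumpSum_nonneg (p := p) (n₀ := n₀) (a := v) (b := v + 1) (L := L) (n := n) hΔ
  have h4 := jumpSum_nonneg (p := p) (n₀ := n₀) (a := v) (b := v - 1) (L := L) (n := n) hΔ
  unfold stepMart
  rw [abs_le]; constructor <;> linarith

lemma compConst_pos (hΔ : -1 < Δ) : 0 < compConst Δ := div_pos (by linarith) (by linarith)

/-- This is 1/z² ≤ c/(z(z+1)), that is z + 1 ≤ cz. The ratio (z+1)/z is largest at z = 1+Δ, where it
equals `compConst Δ`. The drop of the compensator at an arrival thus pays for the squared increment.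
-/
lemma sq_inv_wt_le (hΔ : -1 < Δ) {z : ℝ} (hz : 1 + Δ ≤ z) :
    (1 / z) ^ 2 + compConst Δ / (z + 1) ≤ compConst Δ / z := by
  have h1 : 0 < 1 + Δ := by linarith
  have hz0 : 0 < z := by linarith
  have hc : z + 1 ≤ compConst Δ * z := by
    unfold compConst
    rw [div_mul_eq_mul_div, le_div_iff₀ h1]; nlinarith
  have h2 : compConst Δ / z - compConst Δ / (z + 1) - (1 / z) ^ 2
      = (compConst Δ * z - (z + 1)) / (z ^ 2 * (z + 1)) := by
    field_simp; ring
  have h3 : 0 ≤ (compConst Δ * z - (z + 1)) / (z ^ 2 * (z + 1)) :=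
    div_nonneg (by linarith) (by positivity)
  linarith

lemma compConst_div_wt_anti (hΔ : -1 < Δ) (p : ℕ → ℤ) (v : ℤ) (n : ℕ) :
    compConst Δ / wt Δ p (n + 1) v ≤ compConst Δ / wt Δ p n v :=
  div_le_div_of_nonneg_left (compConst_pos hΔ).le (wt_pos hΔ _ _ _) (wt_mono Δ p v (Nat.le_succ n))

lemma stepEnergy_succ_of_ne (hΔ : -1 < Δ) (h : n₀ ≤ n) (hv : p n ≠ v ∨ visits p n v < L) :
    stepEnergy Δ p n₀ v L (n + 1) ≤ stepEnergy Δ p n₀ v L n := by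
  have e : stepMart Δ p n₀ v L (n + 1) = stepMart Δ p n₀ v L n := by
    unfold stepMart
    rw [jumpSum_succ h, jumpSum_succ h, if_neg, if_neg]
    · ring
    · rintro ⟨h1, _, h2⟩; rcases hv with hv | hv <;> [exact hv h1; omega]
    · rintro ⟨h1, _, h2⟩; rcases hv with hv | hv <;> [exact hv h1; omega]
  unfold stepEnergy
  rw [e]
  have h1 := compConst_div_wt_anti hΔ p (v + 1) n
  have h2 := compConst_div_wt_anti hΔ p (v - 1) n
  linarith

lemma stepEnergy_succ_right (hΔ : -1 < Δ) (h : n₀ ≤ n) (hL : L ≤ visits p n (p n))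
    (hs : p (n + 1) = p n + 1) : stepEnergy Δ p n₀ (p n) L (n + 1) ≤
      stepEnergy Δ p n₀ (p n) L n + 2 * stepMart Δ p n₀ (p n) L n / wt Δ p n (p n + 1) := by
  have e : stepMart Δ p n₀ (p n) L (n + 1)
      = stepMart Δ p n₀ (p n) L n + 1 / wt Δ p n (p n + 1) := by
    unfold stepMart
    rw [jumpSum_succ h, jumpSum_succ h, if_pos ⟨rfl, hs, hL⟩, if_neg]
    · ring
    · rintro ⟨_, h1, _⟩; omega
  unfold stepEnergy
  rw [e]
  have h1 := sq_inv_wt_le hΔ (one_add_le_wt Δ p n (p n + 1))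
  have h2 := compConst_div_wt_anti hΔ p (p n - 1) n
  have h3 : wt Δ p (n + 1) (p n + 1) = wt Δ p n (p n + 1) + 1 := by rw [wt_succ, if_pos hs]
  rw [h3]
  have : (stepMart Δ p n₀ (p n) L n + 1 / wt Δ p n (p n + 1)) ^ 2 =
    stepMart Δ p n₀ (p n) L n ^ 2 + 2 * stepMart Δ p n₀ (p n) L n / wt Δ p n (p n + 1)
      + (1 / wt Δ p n (p n + 1)) ^ 2 := by ring
  linarith

lemma stepEnergy_succ_left (hΔ : -1 < Δ) (h : n₀ ≤ n) (hL : L ≤ visits p n (p n))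
    (hs : p (n + 1) = p n - 1) : stepEnergy Δ p n₀ (p n) L (n + 1) ≤
      stepEnergy Δ p n₀ (p n) L n - 2 * stepMart Δ p n₀ (p n) L n / wt Δ p n (p n - 1) := by
  have e : stepMart Δ p n₀ (p n) L (n + 1)
      = stepMart Δ p n₀ (p n) L n - 1 / wt Δ p n (p n - 1) := by
    unfold stepMart
    rw [jumpSum_succ h, jumpSum_succ h, if_neg, if_pos ⟨rfl, hs, hL⟩]
    · ring
    · rintro ⟨_, h1, _⟩; omega
  unfold stepEnergy
  rw [e]
  have h1 := sq_inv_wt_le hΔ (one_add_le_wt Δ p n (p n - 1))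
  have h2 := compConst_div_wt_anti hΔ p (p n + 1) n
  have h3 : wt Δ p (n + 1) (p n - 1) = wt Δ p n (p n - 1) + 1 := by rw [wt_succ, if_pos hs]
  rw [h3]
  have : (stepMart Δ p n₀ (p n) L n - 1 / wt Δ p n (p n - 1)) ^ 2 =
    stepMart Δ p n₀ (p n) L n ^ 2 - 2 * stepMart Δ p n₀ (p n) L n / wt Δ p n (p n - 1)
      + (1 / wt Δ p n (p n - 1)) ^ 2 := by ring
  linarith

/-- The energy is a supermartingale. -/
lemma stepEnergy_avg_le (hΔ : -1 < Δ) (h : n₀ ≤ n) {r : ℕ → ℤ} (hq : ∀ i ≤ n, q i = p i)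
    (hqs : q (n + 1) = p n + 1) (hr : ∀ i ≤ n, r i = p i) (hrs : r (n + 1) = p n - 1) :
    stepRight Δ p n * stepEnergy Δ q n₀ v L (n + 1)
      + stepLeft Δ p n * stepEnergy Δ r n₀ v L (n + 1) ≤ stepEnergy Δ p n₀ v L n := by
  have hsum := stepLeft_add_stepRight hΔ p n
  have hR := stepRight_pos hΔ p n
  have hL := stepLeft_pos hΔ p n
  by_cases hv : p n ≠ v ∨ visits p n v < L
  · have h1 := stepEnergy_succ_of_ne (p := q) (v := v) (L := L) hΔ h
      (by rwa [hq n le_rfl, visits_congr hq])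
    have h2 := stepEnergy_succ_of_ne (p := r) (v := v) (L := L) hΔ h
      (by rwa [hr n le_rfl, visits_congr hr])
    rw [stepEnergy_congr hq] at h1
    rw [stepEnergy_congr hr] at h2
    refine (add_le_add (mul_le_mul_of_nonneg_left h1 hR.le)
      (mul_le_mul_of_nonneg_left h2 hL.le)).trans_eq ?_
    rw [← add_mul, add_comm, hsum, one_mul]
  · push Not at hv
    obtain ⟨rfl, hv⟩ := hv
    have hqn := hq n le_rfl
    have hrn := hr n le_rfl
    have h1 := stepEnergy_succ_right (p := q) (L := L) hΔ h
      (by rwa [hqn, visits_congr hq]) (by rw [hqs, hqn])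
    have h2 := stepEnergy_succ_left (p := r) (L := L) hΔ h
      (by rwa [hrn, visits_congr hr]) (by rw [hrs, hrn])
    rw [hqn, stepEnergy_congr hq, stepMart_congr hq, wt_congr hq] at h1
    rw [hrn, stepEnergy_congr hr, stepMart_congr hr, wt_congr hr] at h2
    have w1 := wt_pos hΔ p n (p n + 1)
    have w2 := wt_pos hΔ p n (p n - 1)
    -- The cross terms cancel on average: a step probability divided by the weight of its target is
    -- one over the total weight in both directions.
    have e : stepRight Δ p n * (2 * stepMart Δ p n₀ (p n) L n / wt Δ p n (p n + 1))
        = stepLeft Δ p n * (2 * stepMart Δ p n₀ (p n) L n / wt Δ p n (p n - 1)) := by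
      unfold stepRight stepLeft; field_simp
    have h3 := mul_le_mul_of_nonneg_left h1 hR.le
    have h4 := mul_le_mul_of_nonneg_left h2 hL.le
    have h5 : stepLeft Δ p n * stepEnergy Δ p n₀ (p n) L n +
      stepRight Δ p n * stepEnergy Δ p n₀ (p n) L n = stepEnergy Δ p n₀ (p n) L n := by
      rw [← add_mul, hsum, one_mul]
    rw [mul_add] at h3
    rw [mul_sub] at h4
    linarith

lemma stepEnergy_nonneg (hΔ : -1 < Δ) : 0 ≤ stepEnergy Δ p n₀ v L n := by
  have h1 := compConst_pos hΔ
  have h2 := wt_pos hΔ p n (v + 1)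
  have h3 := wt_pos hΔ p n (v - 1)
  unfold stepEnergy; positivity

lemma sq_stepMart_le (hΔ : -1 < Δ) : stepMart Δ p n₀ v L n ^ 2 ≤ stepEnergy Δ p n₀ v L n := by
  have h1 := compConst_pos hΔ
  have h2 := div_pos h1 (wt_pos hΔ p n (v + 1))
  have h3 := div_pos h1 (wt_pos hΔ p n (v - 1))
  unfold stepEnergy; linarith

lemma stepEnergy_le (hΔ : -1 < Δ) : stepEnergy Δ p n₀ v L n
    ≤ (n * (1 / (1 + Δ))) ^ 2 + 2 * (compConst Δ / (1 + Δ)) := by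
  have h1 := compConst_pos hΔ
  have h2 := div_le_div_of_nonneg_left h1.le (by linarith) (one_add_le_wt Δ p n (v + 1))
  have h3 := div_le_div_of_nonneg_left h1.le (by linarith) (one_add_le_wt Δ p n (v - 1))
  have h4 := sq_le_sq' (neg_le_of_abs_le (abs_stepMart_le (p := p) (n₀ := n₀) (v := v) (L := L)
    (n := n) hΔ)) (le_of_abs_le (abs_stepMart_le hΔ))
  unfold stepEnergy; linarith

end Jumps

/-! ### Almost sure convergence of the step martingales -/

section Measure

variable {Ω : Type*} [MeasurableSpace Ω] {μ : Measure Ω} [IsProbabilityMeasure μ]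
  {Δ : ℝ} {v₀ : ℤ} {X : ℕ → Ω → ℤ}

/-- The natural filtration of the walk. -/
def pastFiltration (hX : ∀ n, Measurable (X n)) :
    Filtration ℕ (inferInstance : MeasurableSpace Ω) where
  seq n := pastSigma X n
  mono' := fun _ _ h => iSup₂_le fun _ hk => measurable_iff_comap_le.1
    (measurable_pastSigma (hk.trans h))
  le' n := pastSigma_le hX n

lemma integral_stepEnergy_le (hΔ : -1 < Δ) (hX : IsVRRW Δ v₀ X μ) (v : ℤ) (n : ℕ) :
    ∫ ω, stepEnergy Δ (traj X ω) 0 v 0 n ∂μ ≤ 2 * (compConst Δ / (1 + Δ)) := by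
  have habs : ∀ n (p : ℕ → ℤ), |stepEnergy Δ p 0 v 0 n|
      ≤ (n * (1 / (1 + Δ))) ^ 2 + 2 * (compConst Δ / (1 + Δ)) := fun n p => by
    rw [abs_of_nonneg (stepEnergy_nonneg hΔ)]; exact stepEnergy_le hΔ
  have hdep : ∀ n (p q : ℕ → ℤ), (∀ i ≤ n, p i = q i) →
      stepEnergy Δ p 0 v 0 n = stepEnergy Δ q 0 v 0 n := fun n p q h => stepEnergy_congr h
  have hint : ∀ n, Integrable (fun ω => stepEnergy Δ (traj X ω) 0 v 0 n) μ := fun n =>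
    integrable_of_pastSigma hX (measurable_of_dependsOn (hdep n)) fun ω => habs n _
  induction n with
  | zero =>
    refine (integral_mono (hint 0) (integrable_const (2 * (compConst Δ / (1 + Δ))))
      fun ω => ?_).trans_eq (by simp)
    have := stepEnergy_le (p := traj X ω) (n₀ := 0) (v := v) (L := 0) (n := 0) hΔ
    simpa using this
  | succ n ih =>
    refine le_trans ?_ ih
    rw [integral_succ hΔ hX n (hdep (n + 1)) (habs (n + 1))]
    refine integral_mono_of_nonneg (ae_of_all _ fun ω => ?_) (hint n) (ae_of_all _ fun ω => ?_)
    · exact add_nonneg (mul_nonneg (stepRight_pos hΔ _ _).le (stepEnergy_nonneg hΔ))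
        (mul_nonneg (stepLeft_pos hΔ _ _).le (stepEnergy_nonneg hΔ))
    · exact stepEnergy_avg_le hΔ (Nat.zero_le n)
        (fun i hi => by simp [show i ≠ n + 1 by omega]) (by simp [traj])
        (fun i hi => by simp [show i ≠ n + 1 by omega]) (by simp [traj])

lemma martingale_stepMart (hΔ : -1 < Δ) (hX : IsVRRW Δ v₀ X μ) (v : ℤ) :
    Martingale (fun n ω => stepMart Δ (traj X ω) 0 v 0 n) (pastFiltration hX.measurable) μ := by
  classical
  have hm : ∀ n, Measurable[pastSigma X n] (fun ω => stepMart Δ (traj X ω) 0 v 0 n) := fun n =>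
    measurable_of_dependsOn fun p q h => stepMart_congr h
  have hint : ∀ n, Integrable (fun ω => stepMart Δ (traj X ω) 0 v 0 n) μ := fun n =>
    integrable_of_pastSigma hX (hm n) fun ω => abs_stepMart_le hΔ
  refine martingale_of_setIntegral_eq_succ (fun n => (hm n).stronglyMeasurable) hint
    fun n s hs => ?_
  have hs' : MeasurableSet s := pastSigma_le hX.measurable n s hs
  set g : ℤ → Ω → ℝ := fun d => s.indicator
    fun ω => if X n ω = v then 1 / wt Δ (traj X ω) n (v + d) else 0 with hg
  have hgm : ∀ d, Measurable[pastSigma X n] (g d) := by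
    intro d
    refine Measurable.indicator ?_ hs
    exact measurable_of_dependsOn (X := X) (n := n)
      (f := fun p => if p n = v then 1 / wt Δ p n (v + d) else 0) fun p q h => by
        rw [h n le_rfl, wt_congr h]
  have h1 : 0 < 1 + Δ := by linarith
  have hgC : ∀ d ω, |g d ω| ≤ 1 / (1 + Δ) := by
    intro d ω
    have h2 := wt_pos hΔ (traj X ω) n (v + d)
    have h3 := one_div_le_one_div_of_le h1 (one_add_le_wt Δ (traj X ω) n (v + d))
    have h4 : 0 < 1 / (1 + Δ) := by positivity
    by_cases hω : ω ∈ s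
    · by_cases hv : X n ω = v
      · simp only [hg, Set.indicator_of_mem hω, hv, if_true]
        rwa [abs_of_pos (by positivity)]
      · simp only [hg, Set.indicator_of_mem hω, hv, if_false, abs_zero]; exact h4.le
    · simp only [hg, Set.indicator_of_notMem hω, abs_zero]; exact h4.le
  have hR := integral_mul_indicator_right hΔ hX n (hgm 1) (hgC 1)
  have hL := integral_mul_indicator_left hΔ hX n (hgm (-1)) (hgC (-1))
  -- Both integrands equal one over the total weight of the two neighbours, on the event that the
  -- walk is at `v`.
  have heq : ∫ ω, g 1 ω * stepRight Δ (traj X ω) n ∂μ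
      = ∫ ω, g (-1) ω * stepLeft Δ (traj X ω) n ∂μ := by
    congr 1
    funext ω
    by_cases hω : ω ∈ s
    · by_cases hv : X n ω = v
      · have w1 := wt_pos hΔ (traj X ω) n (v + 1)
        have w2 := wt_pos hΔ (traj X ω) n (v - 1)
        have hv' : traj X ω n = v := hv
        simp only [hg, Set.indicator_of_mem hω, hv, if_true, stepRight, stepLeft, hv',
          ← sub_eq_add_neg]
        field_simp
      · simp [hg, Set.indicator, hv]
    · simp [hg, hω]
  have hms : ∀ d : ℤ, MeasurableSet {ω | X (n + 1) ω = X n ω + d} := fun d =>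
    measurableSet_eq_fun (hX.measurable (n + 1)) ((hX.measurable n).add_const d)
  have hi : ∀ d e : ℤ, Integrable (fun ω => g d ω *
      {ω | X (n + 1) ω = X n ω + e}.indicator (fun _ => (1 : ℝ)) ω) μ := fun d e =>
    (integrable_of_pastSigma hX (hgm d) (hgC d)).mul_bdd (c := 1)
      (measurable_const.indicator (hms e)).aestronglyMeasurable (ae_of_all _ fun ω => by
        by_cases h : X (n + 1) ω = X n ω + e <;> simp [Set.indicator, h])
  have hi2 := hi (-1) (-1)
  simp only [← sub_eq_add_neg] at hi2
  have hdiff : ∫ ω in s, (stepMart Δ (traj X ω) 0 v 0 (n + 1) - stepMart Δ (traj X ω) 0 v 0 n) ∂μ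
      = 0 := by
    have e : ∀ ω, s.indicator (fun ω => stepMart Δ (traj X ω) 0 v 0 (n + 1)
        - stepMart Δ (traj X ω) 0 v 0 n) ω
        = g 1 ω * {ω | X (n + 1) ω = X n ω + 1}.indicator (fun _ => (1 : ℝ)) ω
        - g (-1) ω * {ω | X (n + 1) ω = X n ω - 1}.indicator (fun _ => (1 : ℝ)) ω := by
      intro ω
      by_cases hω : ω ∈ s
      · simp only [hg, Set.indicator_of_mem hω, stepMart, jumpSum_succ (Nat.zero_le n), traj,
          Nat.zero_le, and_true, Set.indicator, Set.mem_ofPred_eq]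
        by_cases hv : X n ω = v
        · simp only [hv, true_and, if_true, ← sub_eq_add_neg]
          by_cases h1 : X (n + 1) ω = v + 1
          · simp [h1, hω, show v + 1 ≠ v - 1 by omega]
          · by_cases h2 : X (n + 1) ω = v - 1
            · simp [h2, hω, show v - 1 ≠ v + 1 by omega]
            · simp [h1, h2]
        · simp [hv]
      · simp [hg, hω]
    rw [← integral_indicator hs']
    simp only [e]
    rw [integral_sub (hi 1 1) hi2, hR, hL, heq, sub_self]
  rw [integral_sub (hint _).integrableOn (hint _).integrableOn] at hdiff
  linarith

/-- The energy dominates the square of the martingale and its mean never exceeds its initial bound.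
With |t| ≤ 1 + t² this bounds the martingale in L¹, and Doob's theorem applies. -/
lemma ae_tendsto_stepMart (hΔ : -1 < Δ) (hX : IsVRRW Δ v₀ X μ) (v : ℤ) :
    ∀ᵐ ω ∂μ, ∃ c, Tendsto (fun n => stepMart Δ (traj X ω) 0 v 0 n) atTop (𝓝 c) := by
  have hmart := martingale_stepMart hΔ hX v
  refine hmart.submartingale.exists_ae_tendsto_of_bdd
    (R := (1 + 2 * (compConst Δ / (1 + Δ))).toNNReal) fun n => ?_
  rw [eLpNorm_one_eq_lintegral_enorm, ← ofReal_integral_norm_eq_lintegral_enorm (hmart.integrable n)]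
  refine ENNReal.ofReal_le_ofReal ?_
  have hE : Integrable (fun ω => stepEnergy Δ (traj X ω) 0 v 0 n) μ :=
    integrable_of_pastSigma hX (measurable_of_dependsOn fun p q h => stepEnergy_congr h)
      (C := (n * (1 / (1 + Δ))) ^ 2 + 2 * (compConst Δ / (1 + Δ))) fun ω => by
        rw [abs_of_nonneg (stepEnergy_nonneg hΔ)]; exact stepEnergy_le hΔ
  have h1 : ∫ ω, ‖stepMart Δ (traj X ω) 0 v 0 n‖ ∂μ
      ≤ ∫ ω, (1 + stepEnergy Δ (traj X ω) 0 v 0 n) ∂μ := by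
    refine integral_mono (hmart.integrable n).norm ((integrable_const 1).add hE) fun ω => ?_
    have := sq_stepMart_le (p := traj X ω) (n₀ := 0) (v := v) (L := 0) (n := n) hΔ
    simp only [Real.norm_eq_abs]
    nlinarith [sq_abs (stepMart Δ (traj X ω) 0 v 0 n), sq_nonneg (|stepMart Δ (traj X ω) 0 v 0 n| - 1),
      abs_nonneg (stepMart Δ (traj X ω) 0 v 0 n)]
  refine h1.trans ?_
  rw [integral_add (integrable_const 1) hE]
  have := integral_stepEnergy_le hΔ hX v n
  simpa using this

end Measure

/-! ### Traps and their potential -/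

/-- The parameters of a trap around `x` which is entered at time `n₀`: the walk must step to the
left from `x` until `x` has been visited `L` times, and must never exceed `x + 2`, nor fall
below `x - 2` when `left` holds. -/
structure Trap where
  /-- The centre. -/
  x : ℤ
  /-- The starting time. -/
  n₀ : ℕ
  /-- The level below which steps from the centre are forced. -/
  L : ℕ
  /-- Whether there is a left barrier. -/
  left : Prop
  /-- The weight of the martingale at `x - 1`. -/
  wl : ℝ
  /-- The weight of the martingale at `x`. -/
  wc : ℝ
  /-- The weight of the martingale at `x + 1`. -/
  wr : ℝ
  /-- The weight of the vertex beyond the left barrier. -/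
  κl : ℝ
  /-- The weight of the vertex beyond the right barrier. -/
  κr : ℝ

namespace Trap

variable (Δ : ℝ) (T : Trap) (p : ℕ → ℤ) (n : ℕ)

/-- The control of the martingales. -/
noncomputable def slack : ℝ :=
  1 - (T.wl * stepEnergy Δ p T.n₀ (T.x - 1) 0 n + T.wc * stepEnergy Δ p T.n₀ T.x T.L n
    + T.wr * stepEnergy Δ p T.n₀ (T.x + 1) 0 n)

/-- The number of visits to the centre, truncated at the level, and counted at the departure. -/
def phase : ℕ := min (visits p n T.x + if p n = T.x then 0 else 1) T.L

/-- The factor compensating the forced steps and the barriers. -/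
noncomputable def factor : ℝ := 2 ^ T.phase p n *
  Real.exp (T.κr * jumpSum Δ p T.n₀ (T.x + 2) (T.x + 1) 0 n
    + T.κl * jumpSum Δ p T.n₀ (T.x - 2) (T.x - 1) 0 n)

/-- A submartingale as long as the walk stays in the trap. -/
noncomputable def potential : ℝ := T.factor Δ p n * T.slack Δ p n

/-- The paths that stay in the trap up to time `n`. -/
def alive (S : Set (ℕ → ℤ)) : Set (ℕ → ℤ) :=
  {p | p ∈ S ∧ (∀ i, T.n₀ ≤ i → i ≤ n → p i ≤ T.x + 2 ∧ (T.left → T.x - 2 ≤ p i) ∧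
      0 < T.slack Δ p i) ∧
    ∀ i, T.n₀ ≤ i → i < n → (p (i + 1) = p i + 1 ∨ p (i + 1) = p i - 1) ∧
      (p i = T.x → visits p i T.x < T.L → p (i + 1) = T.x - 1)}

variable {Δ T p n} {q r : ℕ → ℤ} {S : Set (ℕ → ℤ)}

lemma slack_congr (h : ∀ i ≤ n, p i = q i) : T.slack Δ p n = T.slack Δ q n := by
  unfold slack
  rw [stepEnergy_congr h, stepEnergy_congr h, stepEnergy_congr (v := T.x + 1) h]

lemma phase_congr (h : ∀ i ≤ n, p i = q i) : T.phase p n = T.phase q n := by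
  unfold phase
  rw [visits_congr h, h n le_rfl]

lemma factor_congr (h : ∀ i ≤ n, p i = q i) : T.factor Δ p n = T.factor Δ q n := by
  unfold factor
  rw [phase_congr h, jumpSum_congr h, jumpSum_congr (a := T.x - 2) h]

lemma potential_congr (h : ∀ i ≤ n, p i = q i) : T.potential Δ p n = T.potential Δ q n := by
  unfold potential; rw [factor_congr h, slack_congr h]

lemma factor_pos : 0 < T.factor Δ p n := by unfold factor; positivity

lemma alive_congr (hS : ∀ p q : ℕ → ℤ, (∀ i ≤ T.n₀, p i = q i) → p ∈ S → q ∈ S)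
    (hn : T.n₀ ≤ n) (h : ∀ i ≤ n, p i = q i) (hp : p ∈ T.alive Δ n S) : q ∈ T.alive Δ n S := by
  obtain ⟨h1, h2, h3⟩ := hp
  refine ⟨hS p q (fun i hi => h i (by omega)) h1, fun i hi hin => ?_, fun i hi hin => ?_⟩
  · have := h2 i hi hin
    rwa [slack_congr fun j hj => h j (by omega), h i hin] at this
  · have := h3 i hi hin
    rwa [visits_congr fun j hj => h j (by omega), h i hin.le, h (i + 1) (by omega)] at this

lemma alive_succ_subset : T.alive Δ (n + 1) S ⊆ T.alive Δ n S := fun _ hp =>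
  ⟨hp.1, fun i hi hin => hp.2.1 i hi (by omega), fun i hi hin => hp.2.2 i hi (by omega)⟩

lemma alive_anti {m : ℕ} (h : m ≤ n) : T.alive Δ n S ⊆ T.alive Δ m S := fun _ hp =>
  ⟨hp.1, fun i hi hin => hp.2.1 i hi (by omega), fun i hi hin => hp.2.2 i hi (by omega)⟩

/-- At such a site none of the three martingales moves and only the compensators decrease, so the
slack grows along every path, not merely on average. This is what permits discarding one of the two
possible steps at a barrier or at a forced departure. -/
lemma slack_le_succ (hΔ : -1 < Δ) (hwl : 0 ≤ T.wl) (hwc : 0 ≤ T.wc) (hwr : 0 ≤ T.wr)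
    (hn : T.n₀ ≤ n) (h1 : p n ≠ T.x - 1) (h2 : p n ≠ T.x ∨ visits p n T.x < T.L)
    (h3 : p n ≠ T.x + 1) : T.slack Δ p n ≤ T.slack Δ p (n + 1) := by
  have e1 := mul_le_mul_of_nonneg_left
    (stepEnergy_succ_of_ne (p := p) (v := T.x - 1) (L := 0) hΔ hn (Or.inl h1)) hwl
  have e2 := mul_le_mul_of_nonneg_left
    (stepEnergy_succ_of_ne (p := p) (v := T.x) (L := T.L) hΔ hn h2) hwc
  have e3 := mul_le_mul_of_nonneg_left
    (stepEnergy_succ_of_ne (p := p) (v := T.x + 1) (L := 0) hΔ hn (Or.inl h3)) hwr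
  unfold slack; linarith

lemma slack_le_avg (hΔ : -1 < Δ) (hwl : 0 ≤ T.wl) (hwc : 0 ≤ T.wc) (hwr : 0 ≤ T.wr)
    (hn : T.n₀ ≤ n) (hq : ∀ i ≤ n, q i = p i)
    (hqs : q (n + 1) = p n + 1) (hr : ∀ i ≤ n, r i = p i) (hrs : r (n + 1) = p n - 1) :
    T.slack Δ p n ≤ stepRight Δ p n * T.slack Δ q (n + 1)
      + stepLeft Δ p n * T.slack Δ r (n + 1) := by
  have e1 := mul_le_mul_of_nonneg_left
    (stepEnergy_avg_le (v := T.x - 1) (L := 0) hΔ hn hq hqs hr hrs) hwl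
  have e2 := mul_le_mul_of_nonneg_left
    (stepEnergy_avg_le (v := T.x) (L := T.L) hΔ hn hq hqs hr hrs) hwc
  have e3 := mul_le_mul_of_nonneg_left
    (stepEnergy_avg_le (v := T.x + 1) (L := 0) hΔ hn hq hqs hr hrs) hwr
  have hsum := stepLeft_add_stepRight hΔ p n
  unfold slack
  linear_combination e1 + e2 + e3 + (-1 : ℝ) * hsum

lemma phase_succ_of_ne (h : p n ≠ T.x) : T.phase p (n + 1) = T.phase p n := by
  unfold phase
  rw [visits_succ, if_neg h]
  split_ifs <;> rfl

lemma phase_succ_of_level (h : p n = T.x) (hL : T.L ≤ visits p n T.x) :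
    T.phase p (n + 1) = T.phase p n := by
  unfold phase
  rw [visits_succ, if_pos h, min_eq_right, min_eq_right] <;> omega

lemma phase_succ_of_lt (h : p n = T.x) (hL : visits p n T.x < T.L) (hs : p (n + 1) ≠ T.x) :
    T.phase p (n + 1) = T.phase p n + 1 := by
  unfold phase
  rw [visits_succ, if_pos h, if_neg hs, if_neg hs, min_eq_left, min_eq_left] <;> omega

lemma indicator_potential_nonneg (hn : T.n₀ ≤ n) :
    0 ≤ (T.alive Δ n S).indicator (fun p => T.potential Δ p n) p :=
  Set.indicator_nonneg (fun _ hp => mul_nonneg factor_pos.le (hp.2.1 n hn le_rfl).2.2.le) p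

/-- Being killed because the slack is no longer positive costs nothing: the unkilled product is then
nonpositive, while the killed potential is nonnegative. Only the geometric constraints have to be
checked. -/
lemma le_indicator_potential (hS : ∀ p q : ℕ → ℤ, (∀ i ≤ T.n₀, p i = q i) → p ∈ S → q ∈ S)
    (hn : T.n₀ ≤ n) (hp : p ∈ T.alive Δ n S) (hq : ∀ i ≤ n, q i = p i)
    (hs : q (n + 1) = p n + 1 ∨ q (n + 1) = p n - 1) (hr : q (n + 1) ≤ T.x + 2)
    (hl : T.left → T.x - 2 ≤ q (n + 1))
    (hph : p n = T.x → visits p n T.x < T.L → q (n + 1) = T.x - 1) :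
    T.factor Δ q (n + 1) * T.slack Δ q (n + 1)
      ≤ (T.alive Δ (n + 1) S).indicator (fun p => T.potential Δ p (n + 1)) q := by
  by_cases hpos : 0 < T.slack Δ q (n + 1)
  · have hqa := alive_congr hS hn (fun i hi => (hq i hi).symm) hp
    have hmem : q ∈ T.alive Δ (n + 1) S := by
      refine ⟨hqa.1, fun i hi hin => ?_, fun i hi hin => ?_⟩
      · rcases Nat.lt_or_ge n i with h | h
        · obtain rfl : i = n + 1 := by omega
          exact ⟨hr, hl, hpos⟩
        · exact hqa.2.1 i hi h
      · rcases Nat.lt_or_ge i n with h | h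
        · exact hqa.2.2 i hi h
        · obtain rfl : i = n := by omega
          rw [hq i le_rfl, visits_congr hq]
          exact ⟨hs, hph⟩
    rw [Set.indicator_of_mem hmem]
    exact le_rfl
  · exact (mul_nonpos_of_nonneg_of_nonpos factor_pos.le (not_lt.1 hpos)).trans
      (indicator_potential_nonneg (by omega))

/-- The potential is a submartingale as long as the walk stays in the trap. -/
lemma potential_le_avg (hΔ : -1 < Δ) (hwl : 0 ≤ T.wl) (hwc : 0 ≤ T.wc) (hwr : 0 ≤ T.wr)
    (hS : ∀ p q : ℕ → ℤ, (∀ i ≤ T.n₀, p i = q i) → p ∈ S → q ∈ S)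
    (hκ : ¬ T.left → T.κl = 0) (hn : T.n₀ ≤ n) (hp : p ∈ T.alive Δ n S)
    (hκr : p n = T.x + 2 → wt Δ p n (T.x + 3) = T.κr)
    (hκl : T.left → p n = T.x - 2 → wt Δ p n (T.x - 3) = T.κl)
    (hph : p n = T.x → visits p n T.x < T.L → wt Δ p n (T.x + 1) ≤ wt Δ p n (T.x - 1))
    (hq : ∀ i ≤ n, q i = p i) (hqs : q (n + 1) = p n + 1)
    (hr : ∀ i ≤ n, r i = p i) (hrs : r (n + 1) = p n - 1) :
    T.potential Δ p n ≤
      stepRight Δ p n * (T.alive Δ (n + 1) S).indicator (fun p => T.potential Δ p (n + 1)) q +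
      stepLeft Δ p n * (T.alive Δ (n + 1) S).indicator (fun p => T.potential Δ p (n + 1)) r := by
  have hR := stepRight_pos hΔ p n
  have hL := stepLeft_pos hΔ p n
  have hqn := hq n le_rfl
  have hrn := hr n le_rfl
  have iq := indicator_potential_nonneg (Δ := Δ) (T := T) (S := S) (p := q) (n := n + 1) (by omega)
  have ir := indicator_potential_nonneg (Δ := Δ) (T := T) (S := S) (p := r) (n := n + 1) (by omega)
  have lq := le_indicator_potential (q := q) hS hn hp hq (Or.inl hqs)
  have lr := le_indicator_potential (q := r) hS hn hp hr (Or.inr hrs)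
  obtain ⟨b1, b2, b3⟩ := hp.2.1 n hn le_rfl
  have hF : 0 < T.factor Δ p n := factor_pos
  by_cases c1 : p n = T.x ∧ visits p n T.x < T.L
  · -- forced step
    have hsl : T.slack Δ p n ≤ T.slack Δ r (n + 1) := by
      rw [← slack_congr hr]
      refine slack_le_succ hΔ hwl hwc hwr hn ?_ (Or.inr ?_) ?_
      · rw [hrn, c1.1]; omega
      · rw [visits_congr hr]; exact c1.2
      · rw [hrn, c1.1]; omega
    have hf : T.factor Δ r (n + 1) = 2 * T.factor Δ p n := by
      rw [← factor_congr hr]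
      unfold factor
      rw [phase_succ_of_lt (by rw [hrn, c1.1]) (by rw [visits_congr hr]; exact c1.2)
        (by rw [hrs, c1.1]; omega), jumpSum_succ hn, jumpSum_succ hn, if_neg, if_neg, pow_succ]
      · ring_nf
      · rintro ⟨h, -⟩; rw [hrn] at h; omega
      · rintro ⟨h, -⟩; rw [hrn] at h; omega
    -- The forced step has probability at least 1/2, which the doubling of the factor compensates.
    have hl2 : 1 / 2 ≤ stepLeft Δ p n := by
      have h := hph c1.1 c1.2
      have w1 := wt_pos hΔ p n (T.x + 1)
      have w2 := wt_pos hΔ p n (T.x - 1)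
      unfold stepLeft
      rw [c1.1, div_le_div_iff₀ (by norm_num) (by linarith)]
      linarith
    have h1 := lr (by rw [hrs, c1.1]; omega) (fun _ => by rw [hrs, c1.1]; omega)
      (fun _ _ => by rw [hrs, c1.1])
    rw [hf] at h1
    have h2 := mul_le_mul hl2 h1
      (mul_nonneg (by positivity) (b3.le.trans hsl)) hL.le
    have h3 := mul_le_mul_of_nonneg_left hsl hF.le
    have h4 := mul_nonneg hR.le iq
    unfold potential at h2 h4 ⊢
    linarith
  by_cases c2 : p n = T.x + 2
  · -- right barrier
    have hsl : T.slack Δ p n ≤ T.slack Δ r (n + 1) := by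
      rw [← slack_congr hr]
      exact slack_le_succ hΔ hwl hwc hwr hn (by omega) (Or.inl (by omega)) (by omega)
    have hf : T.factor Δ r (n + 1)
        = T.factor Δ p n * Real.exp (T.κr / wt Δ p n (T.x + 1)) := by
      rw [← factor_congr hr]
      unfold factor
      rw [phase_succ_of_ne (by omega), jumpSum_succ hn, jumpSum_succ hn, if_pos, if_neg,
        mul_assoc, ← Real.exp_add, wt_congr hr]
      · ring_nf
      · rintro ⟨h, -⟩; omega
      · exact ⟨by omega, by omega, Nat.zero_le _⟩
    have h1 := lr (by omega) (fun _ => by omega) (fun h => by omega)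
    have w1 := wt_pos hΔ p n (T.x + 1)
    have w3 : 0 < T.κr := by rw [← hκr c2]; exact wt_pos hΔ _ _ _
    have e : stepLeft Δ p n = 1 / (1 + T.κr / wt Δ p n (T.x + 1)) := by
      unfold stepLeft
      rw [c2, show T.x + 2 - 1 = T.x + 1 by ring, show T.x + 2 + 1 = T.x + 3 by ring, hκr c2]
      field_simp
    -- With t = κr / Z(x+1), the return has probability 1/(1+t), and 1 + t ≤ exp t; the new term in
    -- the exponent is exactly t.
    have h2 : 1 ≤ stepLeft Δ p n * Real.exp (T.κr / wt Δ p n (T.x + 1)) := by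
      rw [e, one_div, ← div_eq_inv_mul, one_le_div (by positivity)]
      linarith [Real.add_one_le_exp (T.κr / wt Δ p n (T.x + 1))]
    have h3 : T.factor Δ p n * T.slack Δ p n ≤
        stepLeft Δ p n * (T.factor Δ r (n + 1) * T.slack Δ r (n + 1)) := by
      rw [hf]
      calc T.factor Δ p n * T.slack Δ p n ≤ T.factor Δ p n * T.slack Δ r (n + 1) :=
            mul_le_mul_of_nonneg_left hsl hF.le
        _ ≤ (stepLeft Δ p n * Real.exp (T.κr / wt Δ p n (T.x + 1))) *
            (T.factor Δ p n * T.slack Δ r (n + 1)) :=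
            le_mul_of_one_le_left (mul_nonneg hF.le (b3.le.trans hsl)) h2
        _ = _ := by ring
    have h4 := mul_le_mul_of_nonneg_left h1 hL.le
    have h5 := mul_nonneg hR.le iq
    unfold potential at h3 h4 h5 ⊢
    linarith
  by_cases c3 : T.left ∧ p n = T.x - 2
  · -- left barrier
    obtain ⟨cl, c3⟩ := c3
    have hsl : T.slack Δ p n ≤ T.slack Δ q (n + 1) := by
      rw [← slack_congr hq]
      exact slack_le_succ hΔ hwl hwc hwr hn (by omega) (Or.inl (by omega)) (by omega)
    have hf : T.factor Δ q (n + 1)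
        = T.factor Δ p n * Real.exp (T.κl / wt Δ p n (T.x - 1)) := by
      rw [← factor_congr hq]
      unfold factor
      rw [phase_succ_of_ne (by omega), jumpSum_succ hn, jumpSum_succ hn, if_neg, if_pos,
        mul_assoc, ← Real.exp_add, wt_congr hq]
      · ring_nf
      · exact ⟨by omega, by omega, Nat.zero_le _⟩
      · rintro ⟨h, -⟩; omega
    have h1 := lq (by omega) (fun _ => by omega) (fun h => by omega)
    have w1 := wt_pos hΔ p n (T.x - 1)
    have w3 : 0 < T.κl := by rw [← hκl cl c3]; exact wt_pos hΔ _ _ _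
    have e : stepRight Δ p n = 1 / (1 + T.κl / wt Δ p n (T.x - 1)) := by
      unfold stepRight
      rw [c3, show T.x - 2 - 1 = T.x - 3 by ring, show T.x - 2 + 1 = T.x - 1 by ring, hκl cl c3]
      field_simp
      ring
    have h2 : 1 ≤ stepRight Δ p n * Real.exp (T.κl / wt Δ p n (T.x - 1)) := by
      rw [e, one_div, ← div_eq_inv_mul, one_le_div (by positivity)]
      linarith [Real.add_one_le_exp (T.κl / wt Δ p n (T.x - 1))]
    have h3 : T.factor Δ p n * T.slack Δ p n ≤
        stepRight Δ p n * (T.factor Δ q (n + 1) * T.slack Δ q (n + 1)) := by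
      rw [hf]
      calc T.factor Δ p n * T.slack Δ p n ≤ T.factor Δ p n * T.slack Δ q (n + 1) :=
            mul_le_mul_of_nonneg_left hsl hF.le
        _ ≤ (stepRight Δ p n * Real.exp (T.κl / wt Δ p n (T.x - 1))) *
            (T.factor Δ p n * T.slack Δ q (n + 1)) :=
            le_mul_of_one_le_left (mul_nonneg hF.le (b3.le.trans hsl)) h2
        _ = _ := by ring
    have h4 := mul_le_mul_of_nonneg_left h1 hR.le
    have h5 := mul_nonneg hL.le ir
    unfold potential at h3 h4 h5 ⊢
    linarith
  -- free step
  have hf : ∀ s : ℕ → ℤ, (∀ i ≤ n, s i = p i) → T.factor Δ s (n + 1) = T.factor Δ p n := by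
    intro s hs
    have hsn := hs n le_rfl
    have hphs : T.phase s (n + 1) = T.phase s n := by
      by_cases h : p n = T.x
      · exact phase_succ_of_level (by omega) (by
          rw [visits_congr hs]; by_contra h'; exact c1 ⟨h, by omega⟩)
      · exact phase_succ_of_ne (by omega)
    have hj : T.κl * jumpSum Δ s T.n₀ (T.x - 2) (T.x - 1) 0 (n + 1)
        = T.κl * jumpSum Δ s T.n₀ (T.x - 2) (T.x - 1) 0 n := by
      by_cases hl : T.left
      · rw [jumpSum_succ hn, if_neg, add_zero]
        rintro ⟨h, -⟩; exact c3 ⟨hl, by omega⟩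
      · rw [hκ hl]; ring
    have hj' : jumpSum Δ s T.n₀ (T.x + 2) (T.x + 1) 0 (n + 1)
        = jumpSum Δ s T.n₀ (T.x + 2) (T.x + 1) 0 n := by
      rw [jumpSum_succ hn, if_neg, add_zero]
      rintro ⟨h, -⟩; exact c2 (by omega)
    rw [← factor_congr hs]
    unfold factor
    rw [hphs, hj, hj']
  have hq1 := lq (by omega) (fun h => by have := b2 h; omega)
    (fun h h' => absurd ⟨h, h'⟩ c1)
  have hr1 := lr (by omega) (fun h => by
      have := b2 h
      have : p n ≠ T.x - 2 := fun h' => c3 ⟨h, h'⟩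
      omega)
    (fun h h' => absurd ⟨h, h'⟩ c1)
  rw [hf q hq] at hq1
  rw [hf r hr] at hr1
  have h3 := mul_le_mul_of_nonneg_left hq1 hR.le
  have h4 := mul_le_mul_of_nonneg_left hr1 hL.le
  have h5 := mul_le_mul_of_nonneg_left (slack_le_avg hΔ hwl hwc hwr hn hq hqs hr hrs) hF.le
  unfold potential at h3 h4 ⊢
  linarith

end Trap

/-! ### Deterministic estimate: few visits to `x + 2` -/

lemma log_add_one_le {z : ℝ} (hz : 0 < z) : Real.log (z + 1) ≤ Real.log z + 1 / z := by
  have h := Real.log_le_sub_one_of_pos (show 0 < (z + 1) / z by positivity)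
  rw [Real.log_div (by positivity) hz.ne'] at h
  have : (z + 1) / z - 1 = 1 / z := by field_simp; ring
  linarith

lemma one_div_add_one_le {z : ℝ} (hz : 0 < z) : 1 / (z + 1) ≤ Real.log (z + 1) - Real.log z := by
  have h := Real.log_le_sub_one_of_pos (show 0 < z / (z + 1) by positivity)
  rw [Real.log_div hz.ne' (by positivity)] at h
  have : z / (z + 1) - 1 = -(1 / (z + 1)) := by field_simp; ring
  linarith

lemma wt_add_jumpCount_le {Δ : ℝ} {p : ℕ → ℤ} {a b : ℤ} {n₀ L n : ℕ} (hn : n₀ ≤ n) :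
    wt Δ p n₀ b + jumpCount p n₀ a b L n ≤ wt Δ p n b := by
  induction n, hn using Nat.le_induction with
  | base => simp [jumpCount_self]
  | succ n hn ih =>
    rw [jumpCount_succ hn, wt_succ]
    by_cases h1 : p n = a ∧ p (n + 1) = b ∧ L ≤ visits p n a
    · rw [if_pos h1, if_pos h1.2.1]; push_cast; linarith
    · rw [if_neg h1]
      have : (0 : ℝ) ≤ if p (n + 1) = b then 1 else 0 := by split_ifs <;> norm_num
      push_cast; linarith

/-- Conditions under which a path that does not exceed `x + 2` makes few visits to `x + 2`. -/
structure RightTrapped (Δ : ℝ) (p : ℕ → ℤ) (x : ℤ) (n₀ L N : ℕ) (m K₁ K₂ : ℝ) : Prop where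
  start : p n₀ = x
  step : ∀ i, n₀ ≤ i → i < N → p (i + 1) = p i + 1 ∨ p (i + 1) = p i - 1
  le : ∀ i, n₀ ≤ i → i ≤ N → p i ≤ x + 2
  phase : ∀ i, n₀ ≤ i → i < N → p i = x → p (i + 1) = x + 1 → L ≤ visits p i x
  mart_center : ∀ i, n₀ ≤ i → i ≤ N → stepMart Δ p n₀ x L i ≤ K₁
  mart_right : ∀ i, n₀ ≤ i → i ≤ N → stepMart Δ p n₀ (x + 1) 0 i ≤ K₂
  left : ∀ i, n₀ ≤ i → i ≤ N → p i = x → L ≤ visits p i x →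
    m + 1 + jumpCount p n₀ x (x - 1) L i ≤ wt Δ p i (x - 1)

namespace RightTrapped

variable {Δ : ℝ} {p : ℕ → ℤ} {x : ℤ} {n₀ L N n : ℕ} {m K₁ K₂ : ℝ}

/-- Excursions to the right of `x` open with a step x → x+1 and close with x+1 → x; the last summand
is the excursion in progress. By the field `phase`, no opening step is lost to the level condition.
-/
lemma count_right (h : RightTrapped Δ p x n₀ L N m K₁ K₂) (hn : n₀ ≤ n) (hN : n ≤ N) :
    jumpCount p n₀ x (x + 1) L n
      = jumpCount p n₀ (x + 1) x 0 n + if x + 1 ≤ p n then 1 else 0 := by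
  induction n, hn using Nat.le_induction with
  | base => simp [jumpCount_self, h.start]
  | succ n hn ih =>
    have ih := ih (by omega)
    rw [jumpCount_succ hn, jumpCount_succ hn, ih]
    have hs := h.step n hn (by omega)
    have hph := h.phase n hn (by omega)
    by_cases h1 : p n = x
    · rcases hs with hs | hs
      · have := hph h1 (by omega)
        simp [h1, hs, this]
      · simp [h1, hs, show ¬ (x - 1 = x + 1) by omega]
    · by_cases h2 : p n = x + 1
      · rcases hs with hs | hs <;> simp [h2, hs, show ¬ (x + 1 + 1 = x) by omega]
      · have : (x + 1 ≤ p (n + 1)) ↔ x + 1 ≤ p n := by omega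
        simp [h1, h2, this]

/-- The first counted departure takes place when `visits` is already at least `L`, and a new visit
precedes each later one. Without a counted departure the level may not have been reached, hence the
hypothesis `hpos`. Away from `x` the last departure is not yet matched by a return, hence the `+ 1`.
-/
lemma visits_center_ge (h : RightTrapped Δ p x n₀ L N m K₁ K₂) (hn : n₀ ≤ n) (hN : n ≤ N)
    (hpos : 1 ≤ jumpCount p n₀ x (x + 1) L n + jumpCount p n₀ x (x - 1) L n) :
    L + jumpCount p n₀ x (x + 1) L n + jumpCount p n₀ x (x - 1) L n ≤ visits p n x + 1 ∧
    (p n = x → L + jumpCount p n₀ x (x + 1) L n + jumpCount p n₀ x (x - 1) L n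
      ≤ visits p n x) := by
  induction n, hn using Nat.le_induction with
  | base => simp [jumpCount_self] at hpos
  | succ n hn ih =>
    have ih := ih (by omega)
    rw [jumpCount_succ hn, jumpCount_succ hn] at hpos ⊢
    rw [visits_succ]
    have hs := h.step n hn (by omega)
    by_cases h1 : p n = x
    · have h3 : p (n + 1) ≠ x := by omega
      by_cases h2 : L ≤ visits p n x
      · have hone : (if p n = x ∧ p (n + 1) = x + 1 ∧ L ≤ visits p n x then 1 else 0)
            + (if p n = x ∧ p (n + 1) = x - 1 ∧ L ≤ visits p n x then 1 else 0) = 1 := by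
          rcases hs with hs | hs
          · rw [if_pos ⟨h1, by omega, h2⟩, if_neg (by rintro ⟨-, h, -⟩; omega)]
          · rw [if_neg (by rintro ⟨-, h, -⟩; omega), if_pos ⟨h1, by omega, h2⟩]
        rw [if_neg h3]
        refine ⟨?_, fun h => absurd h h3⟩
        by_cases h4 : 1 ≤ jumpCount p n₀ x (x + 1) L n + jumpCount p n₀ x (x - 1) L n
        · have := (ih h4).2 h1; omega
        · omega
      · simp only [h2, and_false, if_false] at hpos ⊢
        have := ih hpos
        exact ⟨by omega, fun h => absurd h h3⟩
    · simp only [h1, false_and, if_false, add_zero] at hpos ⊢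
      have := (ih hpos).1
      refine ⟨by omega, fun h => ?_⟩
      rw [if_pos h]; omega

/-- By the field `left`, the counted steps to `x - 1` contribute at most 1/(m+1), 1/(m+2), …, which
is compared with a logarithm. -/
lemma jumpSum_left_le (h : RightTrapped Δ p x n₀ L N m K₁ K₂) (hm : 0 < m) (hn : n₀ ≤ n)
    (hN : n ≤ N) : jumpSum Δ p n₀ x (x - 1) L n
      ≤ Real.log (m + jumpCount p n₀ x (x - 1) L n) - Real.log m := by
  induction n, hn using Nat.le_induction with
  | base => simp [jumpCount_self, jumpSum_self]
  | succ n hn ih =>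
    have ih := ih (by omega)
    rw [jumpCount_succ hn, jumpSum_succ hn]
    by_cases h1 : p n = x ∧ p (n + 1) = x - 1 ∧ L ≤ visits p n x
    · rw [if_pos h1, if_pos h1]
      have h2 := h.left n hn (by omega) h1.1 h1.2.2
      set V := jumpCount p n₀ x (x - 1) L n
      have h3 := one_div_add_one_le (show 0 < m + (V : ℝ) by positivity)
      have h4 := one_div_le_one_div_of_le (show 0 < m + 1 + (V : ℝ) by positivity) h2
      rw [show m + 1 + (V : ℝ) = m + V + 1 by ring] at h4
      rw [show m + ((V + 1 : ℕ) : ℝ) = m + V + 1 by push_cast; ring]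
      linarith
    · rw [if_neg h1, if_neg h1]; simpa using ih

lemma log_wt_right_le (h : RightTrapped Δ p x n₀ L N m K₁ K₂) (hΔ : -1 < Δ) (hn : n₀ ≤ n)
    (hN : n ≤ N) : Real.log (wt Δ p n (x + 1)) ≤ Real.log (wt Δ p n₀ (x + 1)) +
      jumpSum Δ p n₀ x (x + 1) L n + jumpSum Δ p n₀ (x + 2) (x + 1) 0 n := by
  induction n, hn using Nat.le_induction with
  | base => simp [jumpSum_self]
  | succ n hn ih =>
    have ih := ih (by omega)
    have w := wt_pos hΔ p n (x + 1)
    by_cases h1 : p (n + 1) = x + 1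
    · have h2 := log_add_one_le w
      rw [wt_succ, if_pos h1]
      rcases h.step n hn (by omega) with hs | hs
      · have h3 : p n = x := by omega
        rw [jumpSum_succ hn, jumpSum_succ hn, if_pos ⟨h3, h1, h.phase n hn (by omega) h3 h1⟩,
          if_neg (by rintro ⟨h, -⟩; omega)]
        linarith
      · have h3 : p n = x + 2 := by omega
        rw [jumpSum_succ hn, jumpSum_succ hn, if_neg (by rintro ⟨h, -⟩; omega),
          if_pos ⟨h3, h1, Nat.zero_le _⟩]
        linarith
    · rw [wt_succ, if_neg h1, add_zero]
      refine ih.trans ?_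
      have := jumpSum_mono (p := p) (n₀ := n₀) (a := x) (b := x + 1) (L := L) hΔ (Nat.le_succ n)
      have := jumpSum_mono (p := p) (n₀ := n₀) (a := x + 2) (b := x + 1) (L := 0) hΔ
        (Nat.le_succ n)
      simp only [Nat.succ_eq_add_one] at *
      linarith

lemma log_wt_far_le (h : RightTrapped Δ p x n₀ L N m K₁ K₂) (hΔ : -1 < Δ) (hn : n₀ ≤ n)
    (hN : n ≤ N) : Real.log (wt Δ p n (x + 2)) ≤ Real.log (wt Δ p n₀ (x + 2)) +
      jumpSum Δ p n₀ (x + 1) (x + 2) 0 n := by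
  induction n, hn using Nat.le_induction with
  | base => simp [jumpSum_self]
  | succ n hn ih =>
    have ih := ih (by omega)
    have w := wt_pos hΔ p n (x + 2)
    have hle := h.le n hn (by omega)
    rw [jumpSum_succ hn, wt_succ]
    by_cases h1 : p (n + 1) = x + 2
    · have h2 := log_add_one_le w
      have h3 : p n = x + 1 := by
        rcases h.step n hn (by omega) with hs | hs <;> omega
      rw [if_pos h1, if_pos ⟨h3, h1, Nat.zero_le _⟩]
      linarith
    · rw [if_neg h1, if_neg (by rintro ⟨-, h, -⟩; omega), add_zero, add_zero]
      exact ih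

/-- Every visit to `x + 2` is followed by a return to `x + 1`, since the path cannot go further; the
last summand is the visit in progress. -/
lemma wt_far_eq (h : RightTrapped Δ p x n₀ L N m K₁ K₂) (hn : n₀ ≤ n) (hN : n ≤ N) :
    wt Δ p n (x + 2) = wt Δ p n₀ (x + 2) + jumpCount p n₀ (x + 2) (x + 1) 0 n +
      if p n = x + 2 then 1 else 0 := by
  induction n, hn using Nat.le_induction with
  | base => simp [jumpCount_self, h.start]
  | succ n hn ih =>
    have ih := ih (by omega)
    rw [jumpCount_succ hn, wt_succ, ih]
    have h0 := h.le n hn (by omega)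
    have h0' := h.le (n + 1) (by omega) (by omega)
    have hs := h.step n hn (by omega)
    by_cases h1 : p n = x + 2
    · have h2 : p (n + 1) = x + 1 := by omega
      simp [h1, h2]; ring
    · simp [h1]

/-- Let U and V count the departures from `x` to the right and to the left, B = Z(x+1) at time `n₀`
and E = exp(K₁+D). The bound on M(x) gives B + U ≤ BE(m+V)/m, so m + V is at least m/(BE) times B +
U. The visits to `x` account for (B+U) + (m+V), which exceeds B + U by a fixed proportion. -/
lemma wt_center_ge (h : RightTrapped Δ p x n₀ L N m K₁ K₂) (hΔ : -1 < Δ) (hm : 0 < m)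
    (hn : n₀ ≤ n) (hN : n ≤ N) {D θ : ℝ}
    (hD : jumpSum Δ p n₀ (x + 2) (x + 1) 0 n ≤ D)
    (hL : m + wt Δ p n₀ (x + 1) ≤ L + Δ - 1)
    (hθ : θ ≤ 1 + m / (wt Δ p n₀ (x + 1) * Real.exp (K₁ + D)))
    (hp : p n = x + 1) :
    θ * (wt Δ p n₀ (x + 1) + jumpCount p n₀ x (x + 1) L n) ≤ wt Δ p n x := by
  have h1 := h.count_right hn hN
  rw [if_pos hp.ge] at h1
  have h2 := (h.visits_center_ge hn hN (by omega)).1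
  have h3 := wt_add_jumpCount_le (Δ := Δ) (p := p) (a := x) (b := x + 1) (L := L) hn
  have h4 := h.jumpSum_left_le hm hn hN
  have h5 := h.log_wt_right_le hΔ hn hN
  have h6 := h.mart_center n hn hN
  set B := wt Δ p n₀ (x + 1) with hB
  set U := jumpCount p n₀ x (x + 1) L n with hU
  set V := jumpCount p n₀ x (x - 1) L n with hV
  have hB0 : 0 < B := wt_pos hΔ _ _ _
  set E := Real.exp (K₁ + D) with hE
  have hE0 : 0 < E := Real.exp_pos _
  unfold stepMart at h6
  have h7 : Real.log (B + U) ≤ Real.log (B * E * ((m + V) / m)) := by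
    rw [Real.log_mul (by positivity) (by positivity), Real.log_mul (by positivity) (by positivity),
      Real.log_div (by positivity) hm.ne', hE, Real.log_exp]
    have := Real.log_le_log (by positivity) h3
    linarith
  have h8 : B + U ≤ B * E * ((m + V) / m) :=
    (Real.log_le_log_iff (by positivity) (by positivity)).1 h7
  have h9 : (B + U) * (m / (B * E)) ≤ m + V := by
    have := mul_le_mul_of_nonneg_right h8 (show 0 ≤ m / (B * E) by positivity)
    refine this.trans_eq ?_
    field_simp
  have h10 : (L : ℝ) + U + V ≤ visits p n x + 1 := by exact_mod_cast h2
  have h11 := mul_le_mul_of_nonneg_right hθ (show 0 ≤ B + (U : ℝ) by positivity)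
  unfold wt
  linarith

/-- Before the return numbered R+1 there have been R+1 openings, so Z(x) ≥ θ(B+R+1). The factor θ >
1 gained here is the exponent of the final series. -/
lemma jumpSum_return_le (h : RightTrapped Δ p x n₀ L N m K₁ K₂) (hΔ : -1 < Δ) (hm : 0 < m)
    (hn : n₀ ≤ n) (hN : n ≤ N) {D θ : ℝ} (hθ0 : 0 < θ)
    (hD : jumpSum Δ p n₀ (x + 2) (x + 1) 0 n ≤ D)
    (hL : m + wt Δ p n₀ (x + 1) ≤ L + Δ - 1)
    (hθ : θ ≤ 1 + m / (wt Δ p n₀ (x + 1) * Real.exp (K₁ + D))) :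
    θ * jumpSum Δ p n₀ (x + 1) x 0 n ≤
      Real.log (wt Δ p n₀ (x + 1) + jumpCount p n₀ (x + 1) x 0 n)
        - Real.log (wt Δ p n₀ (x + 1)) := by
  induction n, hn using Nat.le_induction with
  | base => simp [jumpCount_self, jumpSum_self]
  | succ n hn ih =>
    have hD' := (jumpSum_mono (p := p) (n₀ := n₀) (a := x + 2) (b := x + 1) (L := 0) hΔ
      (Nat.le_succ n)).trans hD
    have ih := ih (by omega) hD'
    rw [jumpCount_succ hn, jumpSum_succ hn]
    by_cases h1 : p n = x + 1 ∧ p (n + 1) = x ∧ 0 ≤ visits p n (x + 1)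
    · rw [if_pos h1, if_pos h1]
      have h2 := h.count_right hn (by omega)
      rw [if_pos h1.1.ge] at h2
      have h3 := h.wt_center_ge hΔ hm hn (by omega) hD' hL hθ h1.1
      rw [h2] at h3
      set B := wt Δ p n₀ (x + 1) with hB
      set R := jumpCount p n₀ (x + 1) x 0 n
      have hB0 : 0 < B := wt_pos hΔ _ _ _
      have h4 := one_div_add_one_le (show 0 < B + (R : ℝ) by positivity)
      have h5 := one_div_le_one_div_of_le (by positivity) h3
      have h6 := mul_le_mul_of_nonneg_left h5 hθ0.le
      have h7 : θ * (1 / (θ * (B + ((R + 1 : ℕ) : ℝ)))) = 1 / (B + R + 1) := by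
        push_cast; field_simp; ring
      rw [h7] at h6
      push_cast
      rw [← add_assoc, mul_add]
      linarith
    · rw [if_neg h1, if_neg h1]; simpa using ih

/-- The bound on M(x+1) transfers the previous estimate: log Z(x+2) is at most log Z(x+1)/θ plus a
constant. Exponentiating, Z(x+1) is at least a multiple of Z(x+2)^θ, and here Z(x+2) = c + 1 + J
after J completed returns. -/
lemma inv_wt_right_le (h : RightTrapped Δ p x n₀ L N m K₁ K₂) (hΔ : -1 < Δ) (hm : 0 < m)
    (hn : n₀ ≤ n) (hN : n ≤ N) {D θ : ℝ} (hθ0 : 0 < θ)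
    (hD : jumpSum Δ p n₀ (x + 2) (x + 1) 0 n ≤ D)
    (hL : m + wt Δ p n₀ (x + 1) ≤ L + Δ - 1)
    (hθ : θ ≤ 1 + m / (wt Δ p n₀ (x + 1) * Real.exp (K₁ + D))) (hp : p n = x + 2) :
    1 / wt Δ p n (x + 1) ≤ (wt Δ p n₀ (x + 2) * Real.exp K₂) ^ θ / wt Δ p n₀ (x + 1) *
      (1 / (wt Δ p n₀ (x + 2) + 1 + jumpCount p n₀ (x + 2) (x + 1) 0 n) ^ θ) := by
  have h1 := h.jumpSum_return_le hΔ hm hn hN hθ0 hD hL hθ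
  have h2 := h.count_right hn hN
  rw [if_pos (by omega)] at h2
  have h3 := wt_add_jumpCount_le (Δ := Δ) (p := p) (a := x) (b := x + 1) (L := L) hn
  have h4 := h.log_wt_far_le hΔ hn hN
  have h5 := h.mart_right n hn hN
  have h6 := h.wt_far_eq hn hN
  rw [if_pos hp] at h6
  unfold stepMart at h5
  rw [show x + 1 + 1 = x + 2 by ring, show x + 1 - 1 = x by ring] at h5
  set B := wt Δ p n₀ (x + 1) with hB
  set c := wt Δ p n₀ (x + 2) with hc
  set J := jumpCount p n₀ (x + 2) (x + 1) 0 n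
  set R := jumpCount p n₀ (x + 1) x 0 n
  have hB0 : 0 < B := wt_pos hΔ _ _ _
  have hc0 : 0 < c := wt_pos hΔ _ _ _
  have hz : wt Δ p n (x + 2) = c + 1 + J := by rw [h6]; ring
  rw [hz] at h4
  have hw : 0 < wt Δ p n (x + 1) := wt_pos hΔ _ _ _
  have hJ : 0 < c + 1 + (J : ℝ) := by positivity
  have h7 : θ * Real.log (c + 1 + J) ≤
      θ * Real.log (c * Real.exp K₂) + Real.log (wt Δ p n (x + 1)) - Real.log B := by
    have h8 := mul_le_mul_of_nonneg_left h4 hθ0.le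
    have h9 := mul_le_mul_of_nonneg_left h5 hθ0.le
    have h10 : Real.log (B + R) ≤ Real.log (wt Δ p n (x + 1)) := by
      refine Real.log_le_log (by positivity) (le_trans ?_ h3)
      rw [h2]; push_cast; linarith
    rw [Real.log_mul hc0.ne' (Real.exp_pos _).ne', Real.log_exp, mul_add]
    rw [mul_add] at h8
    rw [mul_sub] at h9
    linarith
  have h8 : (c + 1 + (J : ℝ)) ^ θ ≤ (c * Real.exp K₂) ^ θ * wt Δ p n (x + 1) / B := by
    rw [← Real.log_le_log_iff (by positivity) (by positivity), Real.log_div (by positivity)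
      hB0.ne', Real.log_mul (by positivity) hw.ne', Real.log_rpow hJ,
      Real.log_rpow (by positivity)]
    linarith
  have hJθ : 0 < (c + 1 + (J : ℝ)) ^ θ := by positivity
  rw [le_div_iff₀ hB0] at h8
  rw [div_mul_div_comm, mul_one, div_le_div_iff₀ hw (by positivity)]
  linarith

/-- The main estimate on the number of visits to `x + 2`. -/
lemma jumpSum_far_le (h : RightTrapped Δ p x n₀ L N m K₁ K₂) (hΔ : -1 < Δ) (hm : 0 < m)
    (hn : n₀ ≤ n) (hN : n ≤ N) {D θ : ℝ} (hθ1 : 1 < θ)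
    (hL : m + wt Δ p n₀ (x + 1) ≤ L + Δ - 1)
    (hθ : θ ≤ 1 + m / (wt Δ p n₀ (x + 1) * Real.exp (K₁ + D)))
    (hD : (wt Δ p n₀ (x + 2) * Real.exp K₂) ^ θ / wt Δ p n₀ (x + 1) *
      ∑' j : ℕ, 1 / (wt Δ p n₀ (x + 2) + 1 + j) ^ θ ≤ D) :
    jumpSum Δ p n₀ (x + 2) (x + 1) 0 n ≤ D := by
  set c := wt Δ p n₀ (x + 2) with hc
  set B := wt Δ p n₀ (x + 1) with hB
  have hB0 : 0 < B := wt_pos hΔ _ _ _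
  have hc0 : 0 < c := wt_pos hΔ _ _ _
  have hsum : Summable fun j : ℕ => 1 / (c + 1 + (j : ℝ)) ^ θ := by
    have := (Real.summable_one_div_nat_add_rpow (c + 1) θ).2 hθ1
    refine this.congr fun j => ?_
    rw [abs_of_pos (by positivity), add_comm]
  have key : ∀ J : ℕ, (c * Real.exp K₂) ^ θ / B *
      ∑ j ∈ Finset.range J, 1 / (c + 1 + (j : ℝ)) ^ θ ≤ D := fun J =>
    (mul_le_mul_of_nonneg_left (hsum.sum_le_tsum _ fun j _ => by positivity)
      (by positivity)).trans hD
  -- This is a bootstrap. The value of θ presupposes the bound `D` up to time `n`; the induction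
  -- hypothesis and `key` provide it, and so the next term is controlled by the next term of the
  -- series.
  suffices hs : jumpSum Δ p n₀ (x + 2) (x + 1) 0 n ≤ (c * Real.exp K₂) ^ θ / B *
      ∑ j ∈ Finset.range (jumpCount p n₀ (x + 2) (x + 1) 0 n), 1 / (c + 1 + (j : ℝ)) ^ θ from
    hs.trans (key _)
  induction n, hn using Nat.le_induction with
  | base => simp [jumpSum_self, jumpCount_self]
  | succ n hn ih =>
    have ih := ih (by omega)
    rw [jumpCount_succ hn, jumpSum_succ hn]
    by_cases h1 : p n = x + 2 ∧ p (n + 1) = x + 1 ∧ 0 ≤ visits p n (x + 2)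
    · rw [if_pos h1, if_pos h1, Finset.sum_range_succ, mul_add]
      have := h.inv_wt_right_le hΔ hm hn (by omega) (by linarith) (ih.trans (key _)) hL hθ h1.1
      linarith
    · rw [if_neg h1, if_neg h1]; simpa using ih

end RightTrapped

/-! ### Uniform confinement at a fresh site and boundedness above -/

lemma visits_eq_one {V : Type*} [DecidableEq V] {p : ℕ → V} {n : ℕ} {v : V}
    (h : ∀ i ≤ n, p i ≠ v) : visits p n v = 1 := by
  unfold visits
  rw [Finset.sum_eq_zero]
  intro i hi
  rw [if_neg (h i (by have := Finset.mem_range.1 hi; omega))]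

lemma stepEnergy_self {Δ : ℝ} {p : ℕ → ℤ} {n₀ : ℕ} {v : ℤ} {L : ℕ} :
    stepEnergy Δ p n₀ v L n₀
      = compConst Δ / wt Δ p n₀ (v + 1) + compConst Δ / wt Δ p n₀ (v - 1) := by
  simp [stepEnergy, stepMart, jumpSum_self]

lemma stepEnergy_self_le {Δ : ℝ} (hΔ : -1 < Δ) {p : ℕ → ℤ} {n₀ : ℕ} {v : ℤ} {L : ℕ} :
    stepEnergy Δ p n₀ v L n₀ ≤ 2 * (compConst Δ / (1 + Δ)) := by
  rw [stepEnergy_self]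
  have h1 := compConst_pos hΔ
  have h2 := div_le_div_of_nonneg_left h1.le (by linarith) (one_add_le_wt Δ p n₀ (v + 1))
  have h3 := div_le_div_of_nonneg_left h1.le (by linarith) (one_add_le_wt Δ p n₀ (v - 1))
  linarith

namespace Trap

variable {Δ : ℝ} {T : Trap} {p : ℕ → ℤ} {n : ℕ} {S : Set (ℕ → ℤ)}

lemma mart_sq_le (hΔ : -1 < Δ) (hwl : 0 ≤ T.wl) (hwc : 0 ≤ T.wc) (hwr : 0 ≤ T.wr)
    (h : 0 < T.slack Δ p n) :
    T.wl * stepMart Δ p T.n₀ (T.x - 1) 0 n ^ 2 ≤ 1 ∧ T.wc * stepMart Δ p T.n₀ T.x T.L n ^ 2 ≤ 1 ∧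
    T.wr * stepMart Δ p T.n₀ (T.x + 1) 0 n ^ 2 ≤ 1 := by
  unfold slack at h
  have e1 := mul_le_mul_of_nonneg_left
    (sq_stepMart_le (p := p) (n₀ := T.n₀) (v := T.x - 1) (L := 0) (n := n) hΔ) hwl
  have e2 := mul_le_mul_of_nonneg_left
    (sq_stepMart_le (p := p) (n₀ := T.n₀) (v := T.x) (L := T.L) (n := n) hΔ) hwc
  have e3 := mul_le_mul_of_nonneg_left
    (sq_stepMart_le (p := p) (n₀ := T.n₀) (v := T.x + 1) (L := 0) (n := n) hΔ) hwr
  have p1 := mul_nonneg hwl (sq_nonneg (stepMart Δ p T.n₀ (T.x - 1) 0 n))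
  have p2 := mul_nonneg hwc (sq_nonneg (stepMart Δ p T.n₀ T.x T.L n))
  have p3 := mul_nonneg hwr (sq_nonneg (stepMart Δ p T.n₀ (T.x + 1) 0 n))
  exact ⟨by linarith, by linarith, by linarith⟩

lemma slack_le_one (hΔ : -1 < Δ) (hwl : 0 ≤ T.wl) (hwc : 0 ≤ T.wc) (hwr : 0 ≤ T.wr) :
    T.slack Δ p n ≤ 1 := by
  have p1 := mul_nonneg hwl (stepEnergy_nonneg (p := p) (n₀ := T.n₀) (v := T.x - 1) (L := 0)
    (n := n) hΔ)
  have p2 := mul_nonneg hwc (stepEnergy_nonneg (p := p) (n₀ := T.n₀) (v := T.x) (L := T.L)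
    (n := n) hΔ)
  have p3 := mul_nonneg hwr (stepEnergy_nonneg (p := p) (n₀ := T.n₀) (v := T.x + 1) (L := 0)
    (n := n) hΔ)
  unfold slack; linarith

lemma potential_le (hΔ : -1 < Δ) (hwl : 0 ≤ T.wl) (hwc : 0 ≤ T.wc) (hwr : 0 ≤ T.wr) {D : ℝ}
    (hD : T.κr * jumpSum Δ p T.n₀ (T.x + 2) (T.x + 1) 0 n
      + T.κl * jumpSum Δ p T.n₀ (T.x - 2) (T.x - 1) 0 n ≤ D) :
    T.potential Δ p n ≤ 2 ^ T.L * Real.exp D := by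
  have h1 : T.factor Δ p n ≤ 2 ^ T.L * Real.exp D :=
    mul_le_mul (pow_le_pow_right₀ (by norm_num) (min_le_right _ _)) (Real.exp_le_exp.2 hD)
      (Real.exp_pos _).le (by positivity)
  calc T.potential Δ p n ≤ T.factor Δ p n * 1 :=
        mul_le_mul_of_nonneg_left (slack_le_one hΔ hwl hwc hwr) factor_pos.le
    _ ≤ _ := by rw [mul_one]; exact h1

lemma le_potential_start {b : ℝ} (hb : 0 ≤ b) (h : b ≤ T.slack Δ p T.n₀) :
    b ≤ T.potential Δ p T.n₀ := by
  have h1 : 1 ≤ T.factor Δ p T.n₀ := by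
    unfold factor
    rw [jumpSum_self, jumpSum_self, mul_zero, mul_zero, add_zero, Real.exp_zero, mul_one]
    exact one_le_pow₀ (by norm_num)
  exact h.trans (le_mul_of_one_le_left (hb.trans h) h1)

/-- Before the level is reached, the walk stays to the left of the centre. -/
lemma le_center_of_visits_lt (hS : ∀ p ∈ S, p T.n₀ = T.x) (hp : p ∈ T.alive Δ n S)
    (hv : visits p n T.x < T.L) {i : ℕ} (hi : T.n₀ ≤ i) (hin : i ≤ n) : p i ≤ T.x := by
  induction i, hi using Nat.le_induction with
  | base => exact (hS p hp.1).le
  | succ i hi ih =>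
    have ih := ih (by omega)
    obtain ⟨h1, h2⟩ := hp.2.2 i hi (by omega)
    by_cases hx : p i = T.x
    · have := h2 hx ((visits_mono p T.x (show i ≤ n by omega)).trans_lt hv)
      omega
    · omega

/-- A departure to the left is recorded either by the phase, while steps are forced, or by the
counter, once the level is reached. Each is followed at once by a visit to `x - 1`. At time `n₀` the
phase is 2 and `visits` at `x - 1` is at least 1, hence the `+ 1`. -/
lemma phase_add_jumpCount_le (hL : 2 ≤ T.L) (hS : ∀ p ∈ S, p T.n₀ = T.x ∧ visits p T.n₀ T.x = 2)
    (hp : p ∈ T.alive Δ n S) (hn : T.n₀ ≤ n) :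
    T.phase p n + jumpCount p T.n₀ T.x (T.x - 1) T.L n ≤ visits p n (T.x - 1) + 1 := by
  induction n, hn using Nat.le_induction with
  | base =>
    obtain ⟨h1, h2⟩ := hS p hp.1
    have := one_le_visits p T.n₀ (T.x - 1)
    unfold phase
    rw [jumpCount_self, h1, h2, if_pos rfl]
    omega
  | succ n hn ih =>
    have ih := ih (alive_succ_subset hp)
    obtain ⟨h1, h2⟩ := hp.2.2 n hn (by omega)
    rw [jumpCount_succ hn, visits_succ]
    by_cases hx : p n = T.x
    · rcases Nat.lt_or_ge (visits p n T.x) T.L with hv | hv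
      · have h3 := h2 hx hv
        rw [phase_succ_of_lt hx hv (by omega), if_pos h3, if_neg (by rintro ⟨-, -, h⟩; omega)]
        omega
      · rw [phase_succ_of_level hx hv]
        split_ifs with h3 h4 h4
        · omega
        · exact absurd h3.2.1 h4
        · omega
        · omega
    · rw [phase_succ_of_ne hx, if_neg (fun h => hx h.1)]
      omega

end Trap

/-- The paths whose first hitting time of `x` is `n₀`, when they start on the left of `x`. -/
def firstHit (x : ℤ) (n₀ : ℕ) : Set (ℕ → ℤ) := {p | p n₀ = x ∧ ∀ i < n₀, p i < x}

lemma firstHit_congr {x : ℤ} {n₀ : ℕ} {p q : ℕ → ℤ} (h : ∀ i ≤ n₀, p i = q i)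
    (hp : p ∈ firstHit x n₀) : q ∈ firstHit x n₀ :=
  ⟨by rw [← h n₀ le_rfl]; exact hp.1, fun i hi => by rw [← h i hi.le]; exact hp.2 i hi⟩

lemma visits_firstHit {x : ℤ} {n₀ : ℕ} {p : ℕ → ℤ} (hp : p ∈ firstHit x n₀) :
    visits p n₀ x = 2 := by
  unfold visits
  rw [Finset.sum_range_succ, Finset.sum_eq_zero, hp.1, if_pos rfl]
  intro i hi
  rw [if_neg]
  have := hp.2 i (Finset.mem_range.1 hi)
  omega

lemma visits_firstHit_of_lt {x v : ℤ} {n₀ : ℕ} {p : ℕ → ℤ} (hp : p ∈ firstHit x n₀)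
    (hv : x < v) : visits p n₀ v = 1 := by
  refine visits_eq_one fun i hi => ?_
  rcases Nat.lt_or_ge i n₀ with h | h
  · have := hp.2 i h; omega
  · obtain rfl : i = n₀ := by omega
    rw [hp.1]; omega

section Measure

variable {Ω : Type*} [MeasurableSpace Ω] {μ : Measure Ω} [IsProbabilityMeasure μ]
  {Δ : ℝ} {v₀ : ℤ} {X : ℕ → Ω → ℤ}

/-- After a new site is reached, the walk is confined with a probability bounded from below. -/
lemma exists_confine_prob (hΔ : -1 < Δ) (hX : IsVRRW Δ v₀ X μ) :
    ∃ c₀ : ℝ, 0 < c₀ ∧ ∀ (x : ℤ) (n₀ : ℕ), c₀ * μ.real {ω | traj X ω ∈ firstHit x n₀} ≤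
      μ.real {ω | traj X ω ∈ firstHit x n₀ ∧ ∀ n, X n ω ≤ x + 2} := by
  have hB : 0 < 1 + Δ := by linarith
  have hc := compConst_pos hΔ
  -- An initial energy is at most 2 · `compConst Δ`/(1+Δ), and `w` times this is 1/4. Two energies
  -- are controlled, so the initial slack is at least 1/2; while it is positive the martingales are
  -- bounded by `K`.
  set w : ℝ := (1 + Δ) / (8 * compConst Δ) with hw
  have hw0 : 0 < w := by positivity
  set K : ℝ := Real.sqrt (1 / w) with hK
  -- The bound of the deterministic estimate with θ = 2, both `x + 1` and `x + 2` having the fresh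
  -- weight 1+Δ. Then `m` is chosen so that 1 + m/((1+Δ) exp(K+D)) is exactly 2, and `L` so that
  -- forcing up to this level builds the margin `m`. None of them depends on `x` or `n₀`.
  set D : ℝ := ((1 + Δ) * Real.exp K) ^ (2 : ℝ) / (1 + Δ) *
    ∑' j : ℕ, 1 / ((1 + Δ) + 1 + (j : ℝ)) ^ (2 : ℝ) with hD
  set m : ℝ := (1 + Δ) * Real.exp (K + D) with hm
  have hm0 : 0 < m := by positivity
  obtain ⟨L, hL⟩ := exists_nat_ge (m + 2 + |Δ|)
  have hL1 : m + 2 ≤ L := by linarith [abs_nonneg Δ]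
  have hL2 : m + 2 - Δ ≤ L := by linarith [neg_abs_le Δ]
  have hL3 : 2 ≤ L := by exact_mod_cast (show (2 : ℝ) ≤ L by linarith)
  have hmart : ∀ t : ℝ, w * t ^ 2 ≤ 1 → t ≤ K := fun t ht => by
    refine Real.le_sqrt_of_sq_le ?_
    rw [le_div_iff₀ hw0]; linarith
  set C : ℝ := 2 ^ L * Real.exp ((1 + Δ) * D) with hC
  have hC0 : 0 < C := by positivity
  refine ⟨(1 / 2) / C, by positivity, fun x n₀ => ?_⟩
  -- There is no left barrier and M(x-1) is not controlled, hence the zero weights; 1+Δ is the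
  -- weight of the site `x + 3`, which stays unvisited while the walk is alive.
  set T : Trap := ⟨x, n₀, L, False, 0, w, w, 0, 1 + Δ⟩ with hT
  set S := firstHit x n₀ with hSdef
  have hS : ∀ p q : ℕ → ℤ, (∀ i ≤ T.n₀, p i = q i) → p ∈ S → q ∈ S :=
    fun p q h hp => firstHit_congr h hp
  have hfar : ∀ n p, n₀ ≤ n → p ∈ T.alive Δ n S → ∀ i ≤ n, p i ≤ x + 2 := by
    intro n p hn hp i hi
    rcases Nat.lt_or_ge i n₀ with h | h
    · have := hp.1.2 i h; omega
    · exact (hp.2.1 i h hi).1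
  have htrap : ∀ n p, n₀ ≤ n → p ∈ T.alive Δ n S →
      RightTrapped Δ p x n₀ L n m K K := by
    intro n p hn hp
    refine ⟨hp.1.1, fun i hi hin => (hp.2.2 i hi hin).1, fun i hi hin => (hp.2.1 i hi hin).1,
      fun i hi hin h1 h2 => ?_, fun i hi hin => hmart _ ?_, fun i hi hin => hmart _ ?_,
      fun i hi hin h1 h2 => ?_⟩
    · by_contra h
      have := (hp.2.2 i hi hin).2 h1 (not_le.1 h)
      simp only [hT] at this; omega
    · exact (Trap.mart_sq_le (T := T) hΔ le_rfl hw0.le hw0.le (hp.2.1 i hi hin).2.2).2.1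
    · exact (Trap.mart_sq_le (T := T) hΔ le_rfl hw0.le hw0.le (hp.2.1 i hi hin).2.2).2.2
    · have h3 := Trap.phase_add_jumpCount_le (T := T) hL3
        (fun p hp => ⟨hp.1, visits_firstHit hp⟩) (Trap.alive_anti hin hp) hi
      have h4 : T.phase p i = L := by
        unfold Trap.phase; exact min_eq_right (by simp only [hT]; omega)
      rw [h4] at h3
      have h5 : (L : ℝ) + jumpCount p n₀ x (x - 1) L i ≤ visits p i (x - 1) + 1 := by
        exact_mod_cast h3
      unfold wt
      linarith
  have hbound : ∀ n p, n₀ ≤ n → p ∈ T.alive Δ n S →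
      jumpSum Δ p n₀ (x + 2) (x + 1) 0 n ≤ D := by
    intro n p hn hp
    have e1 : wt Δ p n₀ (x + 1) = 1 + Δ := by
      simp [wt, visits_firstHit_of_lt hp.1 (show x < x + 1 by omega)]
    have e2 : wt Δ p n₀ (x + 2) = 1 + Δ := by
      simp [wt, visits_firstHit_of_lt hp.1 (show x < x + 2 by omega)]
    refine (htrap n p hn hp).jumpSum_far_le hΔ hm0 hn le_rfl (θ := 2) (by norm_num) ?_ ?_ ?_
    · rw [e1]; linarith
    · rw [e1, ← hm, div_self hm0.ne']; norm_num
    · rw [e1, e2]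
  have hslack : ∀ p ∈ S, 1 / 2 ≤ T.slack Δ p n₀ := by
    intro p hp
    have e1 := stepEnergy_self_le (p := p) (n₀ := n₀) (v := x) (L := L) hΔ
    have e2 := stepEnergy_self_le (p := p) (n₀ := n₀) (v := x + 1) (L := 0) hΔ
    have e3 : w * (2 * (compConst Δ / (1 + Δ))) = 1 / 4 := by
      rw [hw]; field_simp; norm_num
    have e4 := mul_le_mul_of_nonneg_left e1 hw0.le
    have e5 := mul_le_mul_of_nonneg_left e2 hw0.le
    simp only [Trap.slack, hT, zero_mul, zero_add]
    linarith
  have hsurv := survival hΔ hX n₀ (fun n => T.alive Δ n S) (fun n p => T.potential Δ p n)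
    (b := 1 / 2) (C := C) hC0.le (fun n hn p q h => Trap.alive_congr hS hn h)
    (fun n p q h => Trap.potential_congr h)
    (fun n _ => Trap.alive_succ_subset) ?_ ?_ ?_
  · have hmono : μ.real {ω | traj X ω ∈ S} ≤ μ.real {ω | traj X ω ∈ T.alive Δ n₀ S} := by
      refine measureReal_mono fun ω hω => ⟨hω, fun i hi hin => ?_, fun i hi hin => ?_⟩
      · obtain rfl : i = n₀ := le_antisymm hin hi
        refine ⟨by rw [hω.1]; simp only [hT]; omega, fun h => h.elim, ?_⟩
        exact lt_of_lt_of_le (by norm_num) (hslack _ hω)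
      · simp only [hT] at hi; omega
    have hmono2 : μ.real {ω | ∀ n, n₀ ≤ n → traj X ω ∈ T.alive Δ n S} ≤
        μ.real {ω | traj X ω ∈ S ∧ ∀ n, X n ω ≤ x + 2} := by
      refine measureReal_mono fun ω hω => ⟨(hω n₀ le_rfl).1, fun n => ?_⟩
      exact hfar (max n n₀) _ (le_max_right _ _) (hω _ (le_max_right _ _)) n (le_max_left _ _)
    rw [div_mul_eq_mul_div, div_le_iff₀ hC0]
    have := mul_le_mul_of_nonneg_left hmono (show (0 : ℝ) ≤ 1 / 2 by norm_num)
    have := mul_le_mul_of_nonneg_left hmono2 hC0.le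
    linarith
  · intro n hn p hp
    refine ⟨mul_nonneg Trap.factor_pos.le (hp.2.1 n hn le_rfl).2.2.le, ?_⟩
    refine Trap.potential_le (T := T) hΔ le_rfl hw0.le hw0.le ?_
    simp only [hT, zero_mul, add_zero]
    exact mul_le_mul_of_nonneg_left (hbound n p hn hp) hB.le
  · intro p hp
    exact Trap.le_potential_start (T := T) (by norm_num) (hslack p hp.1)
  · intro n hn p hp q r hq hqs hr hrs
    refine Trap.potential_le_avg (T := T) hΔ le_rfl hw0.le hw0.le hS (fun _ => rfl) hn hp
      (fun _ => ?_) (fun h => h.elim) (fun h1 h2 => ?_) hq hqs hr hrs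
    · have : visits p n (x + 3) = 1 := visits_eq_one fun i hi => by
        have := hfar n p hn hp i hi; omega
      simp [wt, hT, this]
    -- While steps are forced, `x + 1` is still fresh and so cannot outweigh `x - 1`.
    · have : visits p n (x + 1) = 1 := visits_eq_one fun i hi => by
        rcases Nat.lt_or_ge i n₀ with h | h
        · have := hp.1.2 i h; omega
        · have := Trap.le_center_of_visits_lt (T := T) (fun p hp => hp.1) hp h2 h hi
          simp only [hT] at this; omega
      have h3 := one_add_le_wt Δ p n (x - 1)
      have h4 : wt Δ p n (x + 1) = 1 + Δ := by simp [wt, this]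
      simp only [hT]
      linarith

/-- The probability of reaching far to the right decays. -/
lemma measure_reach_succ_le (hX : IsVRRW Δ v₀ X μ) {c₀ : ℝ}
    (h : ∀ (x : ℤ) (n₀ : ℕ), c₀ * μ.real {ω | traj X ω ∈ firstHit x n₀} ≤
      μ.real {ω | traj X ω ∈ firstHit x n₀ ∧ ∀ n, X n ω ≤ x + 2}) {x : ℤ} (hx : v₀ ≤ x) :
    μ {ω | ∃ n, x + 3 ≤ X n ω} ≤ ENNReal.ofReal (1 - c₀) * μ {ω | ∃ n, x ≤ X n ω} := by
  have hXm := hX.measurable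
  have hm1 : ∀ n₀, MeasurableSet {ω | traj X ω ∈ firstHit x n₀} := by
    intro n₀
    have : {ω | traj X ω ∈ firstHit x n₀}
        = {ω | X n₀ ω = x} ∩ ⋂ i, ⋂ (_ : i < n₀), {ω | X i ω < x} := by
      ext ω; simp [firstHit, traj]
    rw [this]
    exact (hXm n₀ (measurableSet_singleton x)).inter (MeasurableSet.iInter fun i =>
      MeasurableSet.iInter fun _ => measurableSet_lt (hXm i) measurable_const)
  have hm2 : MeasurableSet {ω | ∀ n, X n ω ≤ x + 2} := by
    have : {ω | ∀ n, X n ω ≤ x + 2} = ⋂ n, {ω | X n ω ≤ x + 2} := by ext; simp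
    rw [this]
    exact MeasurableSet.iInter fun i => measurableSet_le (hXm i) measurable_const
  have hdisj : Pairwise (Function.onFun Disjoint fun n₀ => {ω | traj X ω ∈ firstHit x n₀}) := by
    intro a b hab
    refine Set.disjoint_left.2 fun ω h1 h2 => ?_
    rcases lt_or_gt_of_ne hab with hlt | hlt
    · exact (h2.2 a hlt).ne h1.1
    · exact (h1.2 b hlt).ne h2.1
  -- A nearest-neighbour path from `v₀ ≤ x` hits `x` exactly at the first time it is at least `x`,
  -- so the events `firstHit x n₀` partition the passage through `x`.
  have hsub : {ω | ∃ n, x + 3 ≤ X n ω} ≤ᵐ[μ]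
      ⋃ n₀, ({ω | traj X ω ∈ firstHit x n₀} \ {ω | ∀ n, X n ω ≤ x + 2} : Set Ω) := by
    filter_upwards [hX.start, ae_step hX] with ω h0 hs hω
    obtain ⟨n, hn⟩ : ∃ n, x + 3 ≤ X n ω := hω
    have hex : ∃ n, x ≤ X n ω := ⟨n, by omega⟩
    classical
    refine Set.mem_iUnion.2 ⟨Nat.find hex, ⟨?_, fun i hi => ?_⟩, fun hall => ?_⟩
    · have h1 := Nat.find_spec hex
      have h2 : ∀ i < Nat.find hex, X i ω < x := fun i hi => not_le.1 (Nat.find_min hex hi)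
      rcases Nat.eq_zero_or_pos (Nat.find hex) with hz | hz
      · show X _ ω = x
        rw [hz] at h1 ⊢; omega
      · obtain ⟨k, hk⟩ := Nat.exists_eq_succ_of_ne_zero hz.ne'
        have h3 := h2 k (by omega)
        have h4 := hs k
        show X _ ω = x
        rw [hk] at h1 ⊢
        simp only [Nat.succ_eq_add_one] at *
        omega
    · exact not_le.1 (Nat.find_min hex hi)
    · have := hall n; omega
  have hone : ∀ n₀, μ ({ω | traj X ω ∈ firstHit x n₀} \ {ω | ∀ n, X n ω ≤ x + 2})
      ≤ ENNReal.ofReal (1 - c₀) * μ {ω | traj X ω ∈ firstHit x n₀} := by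
    intro n₀
    have h1 := measureReal_sdiff_add_inter (μ := μ) (s := {ω | traj X ω ∈ firstHit x n₀}) hm2
    have h2 := h x n₀
    have h3 : μ.real ({ω | traj X ω ∈ firstHit x n₀} \ {ω | ∀ n, X n ω ≤ x + 2})
        ≤ (1 - c₀) * μ.real {ω | traj X ω ∈ firstHit x n₀} := by
      have h4 : ({ω | traj X ω ∈ firstHit x n₀} ∩ {ω | ∀ n, X n ω ≤ x + 2} : Set Ω) =
        {ω | traj X ω ∈ firstHit x n₀ ∧ ∀ n, X n ω ≤ x + 2} := rfl
      rw [h4] at h1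
      linarith
    rw [← ofReal_measureReal, ← ofReal_measureReal (s := {ω | traj X ω ∈ firstHit x n₀}),
      ← ENNReal.ofReal_mul' measureReal_nonneg]
    exact ENNReal.ofReal_le_ofReal h3
  calc μ {ω | ∃ n, x + 3 ≤ X n ω}
      ≤ μ (⋃ n₀, ({ω | traj X ω ∈ firstHit x n₀} \ {ω | ∀ n, X n ω ≤ x + 2} : Set Ω)) :=
        measure_mono_ae hsub
    _ ≤ ∑' n₀, μ ({ω | traj X ω ∈ firstHit x n₀} \ {ω | ∀ n, X n ω ≤ x + 2}) :=
        measure_iUnion_le _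
    _ ≤ ∑' n₀, ENNReal.ofReal (1 - c₀) * μ {ω | traj X ω ∈ firstHit x n₀} :=
        ENNReal.tsum_le_tsum hone
    _ = ENNReal.ofReal (1 - c₀) * μ (⋃ n₀, {ω | traj X ω ∈ firstHit x n₀}) := by
        rw [ENNReal.tsum_mul_left, measure_iUnion hdisj hm1]
    _ ≤ _ := by
        gcongr
        refine Set.iUnion_subset fun n₀ ω hω => ⟨n₀, hω.1.ge⟩

lemma ae_bddAbove (hΔ : -1 < Δ) (hX : IsVRRW Δ v₀ X μ) : ∀ᵐ ω ∂μ, ∃ M : ℤ, ∀ n, X n ω ≤ M := by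
  obtain ⟨c₀, hc₀, h⟩ := exists_confine_prob hΔ hX
  have hgeom : ∀ k : ℕ, μ {ω | ∃ n, v₀ + 3 * k ≤ X n ω} ≤ ENNReal.ofReal (1 - c₀) ^ k := by
    intro k
    induction k with
    | zero => simpa using prob_le_one
    | succ k ih =>
      have h1 := measure_reach_succ_le hX h (x := v₀ + 3 * k) (by omega)
      rw [show v₀ + 3 * ((k + 1 : ℕ) : ℤ) = v₀ + 3 * k + 3 by push_cast; ring, pow_succ']
      exact h1.trans (by gcongr)
  have hlt : ENNReal.ofReal (1 - c₀) < 1 := by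
    rw [← ENNReal.ofReal_one]
    exact (ENNReal.ofReal_lt_ofReal_iff one_pos).2 (by linarith)
  have h0 : μ {ω | ∀ k : ℕ, ∃ n, v₀ + 3 * k ≤ X n ω} = 0 := by
    refine le_antisymm ?_ bot_le
    refine ge_of_tendsto (ENNReal.tendsto_pow_atTop_nhds_zero_of_lt_one hlt)
      (Eventually.of_forall fun k => ?_)
    exact (measure_mono fun ω (hω : ∀ k : ℕ, ∃ n, v₀ + 3 * k ≤ X n ω) => hω k).trans (hgeom k)
  have h1 : ∀ᵐ ω ∂μ, ¬ ∀ k : ℕ, ∃ n, v₀ + 3 * k ≤ X n ω := by simpa [ae_iff] using h0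
  filter_upwards [h1] with ω hω
  push Not at hω
  obtain ⟨k, hk⟩ := hω
  exact ⟨v₀ + 3 * k, fun n => (hk n).le⟩

end Measure

/-! ### Reflection and finiteness of the range -/

lemma visits_neg (p : ℕ → ℤ) (n : ℕ) (v : ℤ) :
    visits (fun k => -p k) n v = visits p n (-v) := by
  unfold visits
  congr 1
  refine Finset.sum_congr rfl fun i _ => ?_
  have : (-p i = v) ↔ p i = -v := by omega
  simp only [this]

lemma wt_neg (Δ : ℝ) (p : ℕ → ℤ) (n : ℕ) (v : ℤ) :
    wt Δ (fun k => -p k) n v = wt Δ p n (-v) := by unfold wt; rw [visits_neg]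

lemma vrrwStep_neg (Δ : ℝ) (p : ℕ → ℤ) (n : ℕ) (j : ℤ) :
    vrrwStep Δ (fun k => -p k) n j = vrrwStep Δ p n (-j) := by
  have e1 : -(-p n - 1) = p n + 1 := by ring
  have e2 : -(-p n + 1) = p n - 1 := by ring
  have h1 : stepRight Δ (fun k => -p k) n = stepLeft Δ p n := by
    unfold stepRight stepLeft
    simp only [wt_neg, e1, e2, add_comm]
  have h2 : stepLeft Δ (fun k => -p k) n = stepRight Δ p n := by
    unfold stepRight stepLeft
    simp only [wt_neg, e1, e2, add_comm]
  rw [vrrwStep_eq, vrrwStep_eq, h1, h2]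
  split_ifs <;> first | rfl | omega

lemma IsVRRW.neg {Ω : Type*} [MeasurableSpace Ω] {μ : Measure Ω} {Δ : ℝ} {v₀ : ℤ}
    {X : ℕ → Ω → ℤ} (hX : IsVRRW Δ v₀ X μ) : IsVRRW Δ (-v₀) (fun n ω => -X n ω) μ := by
  have hpast : ∀ n, pastSigma (fun n ω => -X n ω) n = pastSigma X n := by
    intro n
    refine iSup_congr fun k => iSup_congr fun _ => le_antisymm ?_ ?_
    · refine measurable_iff_comap_le.1 ?_
      exact (Measurable.of_discrete (f := fun z : ℤ => -z)).comp (comap_measurable (X k))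
    · refine measurable_iff_comap_le.1 ?_
      have := (Measurable.of_discrete (f := fun z : ℤ => -z)).comp
        (comap_measurable (fun ω => -X k ω))
      simpa [Function.comp_def] using this
  refine ⟨fun n => (hX.measurable n).neg, ?_, fun n j => ?_⟩
  · filter_upwards [hX.start] with ω h
    rw [h]
  · rw [hpast]
    have e : {ω | -X (n + 1) ω = j} = {ω | X (n + 1) ω = -j} := by
      ext ω; show -X (n + 1) ω = j ↔ X (n + 1) ω = -j; omega
    rw [e]
    filter_upwards [hX.step n (-j)] with ω h
    rw [h]
    exact (vrrwStep_neg Δ (fun k => X k ω) n j).symm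

lemma ae_finite_visitedRange {Ω : Type*} [MeasurableSpace Ω] {μ : Measure Ω}
    [IsProbabilityMeasure μ] {Δ : ℝ} (hΔ : -1 < Δ) {v₀ : ℤ} {X : ℕ → Ω → ℤ}
    (hX : IsVRRW Δ v₀ X μ) : ∀ᵐ ω ∂μ, (visitedRange (fun k => X k ω)).Finite := by
  filter_upwards [ae_bddAbove hΔ hX, ae_bddAbove hΔ hX.neg] with ω ⟨M, hM⟩ ⟨M', hM'⟩
  refine (Set.finite_Icc (-M') M).subset fun v hv => ?_
  have hne : {k : ℕ | X k ω = v}.encard ≠ 0 := fun h => hv (by simp only [totalVisits, h, zero_add])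
  obtain ⟨k, rfl⟩ := Set.encard_ne_zero.1 hne
  exact ⟨by have := hM' k; omega, hM k⟩

lemma jumpSum_neg (Δ : ℝ) (p : ℕ → ℤ) (n₀ : ℕ) (a b : ℤ) (L n : ℕ) :
    jumpSum Δ (fun k => -p k) n₀ (-a) (-b) L n = jumpSum Δ p n₀ a b L n := by
  unfold jumpSum
  refine Finset.sum_congr rfl fun i _ => ?_
  simp only [visits_neg, wt_neg, neg_neg, neg_inj]

lemma jumpCount_neg (p : ℕ → ℤ) (n₀ : ℕ) (a b : ℤ) (L n : ℕ) :
    jumpCount (fun k => -p k) n₀ (-a) (-b) L n = jumpCount p n₀ a b L n := by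
  unfold jumpCount
  refine Finset.sum_congr rfl fun i _ => ?_
  simp only [visits_neg, neg_neg, neg_inj]

lemma stepMart_neg (Δ : ℝ) (p : ℕ → ℤ) (n₀ : ℕ) (v : ℤ) (L n : ℕ) :
    stepMart Δ (fun k => -p k) n₀ (-v) L n = -stepMart Δ p n₀ v L n := by
  unfold stepMart
  rw [show -v + 1 = -(v - 1) by ring, show -v - 1 = -(v + 1) by ring, jumpSum_neg, jumpSum_neg]
  ring

/-! ### Asymptotics of confined paths -/

/-- A path that stays within distance two of `x` after time `n₀`, with controlled martingales and
few visits to the end points. -/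
structure Confined (Δ : ℝ) (p : ℕ → ℤ) (x : ℤ) (n₀ : ℕ) (K₁ K₂ D : ℝ) : Prop where
  start : p n₀ = x
  step : ∀ i, n₀ ≤ i → p (i + 1) = p i + 1 ∨ p (i + 1) = p i - 1
  le : ∀ i, n₀ ≤ i → p i ≤ x + 2
  ge : ∀ i, n₀ ≤ i → x - 2 ≤ p i
  center : ∀ i, n₀ ≤ i → |stepMart Δ p n₀ x 0 i| ≤ K₁
  right : ∀ i, n₀ ≤ i → |stepMart Δ p n₀ (x + 1) 0 i| ≤ K₂
  left : ∀ i, n₀ ≤ i → |stepMart Δ p n₀ (x - 1) 0 i| ≤ K₂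
  far_right : ∀ i, n₀ ≤ i → jumpSum Δ p n₀ (x + 2) (x + 1) 0 i ≤ D
  far_left : ∀ i, n₀ ≤ i → jumpSum Δ p n₀ (x - 2) (x - 1) 0 i ≤ D

namespace Confined

variable {Δ : ℝ} {p : ℕ → ℤ} {x : ℤ} {n₀ n : ℕ} {K₁ K₂ D : ℝ}

lemma neg (h : Confined Δ p x n₀ K₁ K₂ D) : Confined Δ (fun k => -p k) (-x) n₀ K₁ K₂ D where
  start := by have := h.start; omega
  step i hi := by have := h.step i hi; omega
  le i hi := by have := h.ge i hi; omega
  ge i hi := by have := h.le i hi; omega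
  center i hi := by rw [stepMart_neg, abs_neg]; exact h.center i hi
  right i hi := by
    rw [show -x + 1 = -(x - 1) by ring, stepMart_neg, abs_neg]; exact h.left i hi
  left i hi := by
    rw [show -x - 1 = -(x + 1) by ring, stepMart_neg, abs_neg]; exact h.right i hi
  far_right i hi := by
    rw [show -x + 1 = -(x - 1) by ring, show -x + 2 = -(x - 2) by ring, jumpSum_neg]
    exact h.far_left i hi
  far_left i hi := by
    rw [show -x - 1 = -(x + 1) by ring, show -x - 2 = -(x + 2) by ring, jumpSum_neg]
    exact h.far_right i hi

/-- The arrivals at `x + 1` compared with the logarithm of its weight. -/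
lemma log_wt_succ (h : Confined Δ p x n₀ K₁ K₂ D) (hΔ : -1 < Δ) (hn : n₀ ≤ n) :
    Real.log (wt Δ p (n + 1) (x + 1)) - Real.log (wt Δ p n (x + 1)) ≤
      (jumpSum Δ p n₀ x (x + 1) 0 (n + 1) + jumpSum Δ p n₀ (x + 2) (x + 1) 0 (n + 1))
        - (jumpSum Δ p n₀ x (x + 1) 0 n + jumpSum Δ p n₀ (x + 2) (x + 1) 0 n) ∧
    (jumpSum Δ p n₀ x (x + 1) 0 (n + 1) + jumpSum Δ p n₀ (x + 2) (x + 1) 0 (n + 1))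
        - (jumpSum Δ p n₀ x (x + 1) 0 n + jumpSum Δ p n₀ (x + 2) (x + 1) 0 n) ≤
      (Real.log (wt Δ p (n + 1) (x + 1)) - 1 / wt Δ p (n + 1) (x + 1))
        - (Real.log (wt Δ p n (x + 1)) - 1 / wt Δ p n (x + 1)) := by
  have w := wt_pos hΔ p n (x + 1)
  rw [jumpSum_succ hn, jumpSum_succ hn, wt_succ]
  by_cases h1 : p (n + 1) = x + 1
  · have h2 := log_add_one_le w
    have h3 := one_div_add_one_le w
    rw [if_pos h1]
    rcases h.step n hn with hs | hs
    · rw [if_pos ⟨by omega, h1, Nat.zero_le _⟩, if_neg (by rintro ⟨h, -⟩; omega)]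
      exact ⟨by linarith, by linarith⟩
    · rw [if_neg (by rintro ⟨h, -⟩; omega), if_pos ⟨by omega, h1, Nat.zero_le _⟩]
      exact ⟨by linarith, by linarith⟩
  · rw [if_neg h1, if_neg (by rintro ⟨-, h, -⟩; omega), if_neg (by rintro ⟨-, h, -⟩; omega)]
    simp

/-- The one-step comparisons telescope. The correction -1/z turns the lower bound 1/(z+1) for an
increment of the logarithm into an upper bound for 1/z, so the total error stays bounded. -/
lemma log_wt_bounds (h : Confined Δ p x n₀ K₁ K₂ D) (hΔ : -1 < Δ) (hn : n₀ ≤ n) :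
    Real.log (wt Δ p n (x + 1)) - Real.log (wt Δ p n₀ (x + 1)) ≤
      jumpSum Δ p n₀ x (x + 1) 0 n + jumpSum Δ p n₀ (x + 2) (x + 1) 0 n ∧
    jumpSum Δ p n₀ x (x + 1) 0 n + jumpSum Δ p n₀ (x + 2) (x + 1) 0 n ≤
      (Real.log (wt Δ p n (x + 1)) - 1 / wt Δ p n (x + 1))
        - (Real.log (wt Δ p n₀ (x + 1)) - 1 / wt Δ p n₀ (x + 1)) := by
  induction n, hn using Nat.le_induction with
  | base => simp [jumpSum_self]
  | succ n hn ih =>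
    obtain ⟨h1, h2⟩ := h.log_wt_succ hΔ hn
    exact ⟨by linarith [ih.1], by linarith [ih.2]⟩

lemma abs_jumpSum_sub_log_le (h : Confined Δ p x n₀ K₁ K₂ D) (hΔ : -1 < Δ) (hn : n₀ ≤ n) :
    |jumpSum Δ p n₀ x (x + 1) 0 n -
      (Real.log (wt Δ p n (x + 1)) - Real.log (wt Δ p n₀ (x + 1)))|
      ≤ D + 1 / wt Δ p n₀ (x + 1) := by
  obtain ⟨h1, h2⟩ := h.log_wt_bounds hΔ hn
  have h3 := h.far_right n hn
  have h4 := jumpSum_nonneg (p := p) (n₀ := n₀) (a := x + 2) (b := x + 1) (L := 0) (n := n) hΔ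
  have h5 := one_div_pos.2 (wt_pos hΔ p n (x + 1))
  have h6 := one_div_pos.2 (wt_pos hΔ p n₀ (x + 1))
  rw [abs_le]; constructor <;> linarith

lemma tendsto_of_mono_bdd {f : ℕ → ℝ} {n₀ : ℕ} {B : ℝ} (hf : ∀ n, n₀ ≤ n → f n ≤ f (n + 1))
    (hB : ∀ n, n₀ ≤ n → f n ≤ B) : ∃ l, Tendsto f atTop (𝓝 l) := by
  have hmono : Monotone fun k => f (k + n₀) := monotone_nat_of_le_succ fun k => by
    have := hf (k + n₀) (by omega)
    rwa [show k + 1 + n₀ = k + n₀ + 1 by ring]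
  have hbdd : BddAbove (Set.range fun k => f (k + n₀)) :=
    ⟨B, by rintro _ ⟨k, rfl⟩; exact hB _ (by omega)⟩
  exact ⟨_, (tendsto_add_atTop_iff_nat n₀).1 (tendsto_atTop_ciSup hmono hbdd)⟩

/-- Adding the arrivals from `x + 2` makes the difference nondecreasing and bounded above from time
`n₀` on. Those arrivals alone form a nondecreasing sum bounded by `D`, so they may be subtracted
again. -/
lemma tendsto_jumpSum_sub_log (h : Confined Δ p x n₀ K₁ K₂ D) (hΔ : -1 < Δ) :
    ∃ l, Tendsto (fun n => jumpSum Δ p n₀ x (x + 1) 0 n - Real.log (wt Δ p n (x + 1)))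
      atTop (𝓝 l) := by
  obtain ⟨l₁, h₁⟩ := tendsto_of_mono_bdd (n₀ := n₀)
    (f := fun n => jumpSum Δ p n₀ x (x + 1) 0 n + jumpSum Δ p n₀ (x + 2) (x + 1) 0 n
      - Real.log (wt Δ p n (x + 1)))
    (B := 1 / wt Δ p n₀ (x + 1) - Real.log (wt Δ p n₀ (x + 1)))
    (fun n hn => by have := (h.log_wt_succ hΔ hn).1; linarith)
    (fun n hn => by
      have := (h.log_wt_bounds hΔ hn).2
      have h5 := one_div_pos.2 (wt_pos hΔ p n (x + 1))
      linarith)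
  obtain ⟨l₂, h₂⟩ := tendsto_of_mono_bdd (n₀ := n₀)
    (f := fun n => jumpSum Δ p n₀ (x + 2) (x + 1) 0 n) (B := D)
    (fun n _ => jumpSum_mono hΔ (Nat.le_succ n)) h.far_right
  refine ⟨l₁ - l₂, (h₁.sub h₂).congr fun n => ?_⟩
  ring

/-- The logarithm of the ratio of the weights of the neighbours of the centre. -/
lemma abs_log_ratio_sub_le (h : Confined Δ p x n₀ K₁ K₂ D) (hΔ : -1 < Δ) (hn : n₀ ≤ n) :
    |(Real.log (wt Δ p n (x + 1)) - Real.log (wt Δ p n (x - 1))) -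
      (Real.log (wt Δ p n₀ (x + 1)) - Real.log (wt Δ p n₀ (x - 1)))| ≤
      K₁ + 2 * D + 1 / wt Δ p n₀ (x + 1) + 1 / wt Δ p n₀ (x - 1) := by
  have h1 := h.abs_jumpSum_sub_log_le hΔ hn
  have h2 := h.neg.abs_jumpSum_sub_log_le hΔ hn
  have h3 := h.center n hn
  rw [show -x + 1 = -(x - 1) by ring, jumpSum_neg] at h2
  simp only [wt_neg, neg_neg] at h2
  unfold stepMart at h3
  rw [abs_le] at h1 h2 h3 ⊢
  constructor <;> linarith

lemma tendsto_log_ratio (h : Confined Δ p x n₀ K₁ K₂ D) (hΔ : -1 < Δ)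
    (hM : ∃ c, Tendsto (fun n => stepMart Δ p n₀ x 0 n) atTop (𝓝 c)) :
    ∃ l, Tendsto (fun n => Real.log (wt Δ p n (x + 1)) - Real.log (wt Δ p n (x - 1)))
      atTop (𝓝 l) := by
  obtain ⟨l₁, h1⟩ := h.tendsto_jumpSum_sub_log hΔ
  obtain ⟨l₂, h2⟩ := h.neg.tendsto_jumpSum_sub_log hΔ
  obtain ⟨c, hc⟩ := hM
  rw [show -x + 1 = -(x - 1) by ring] at h2
  simp only [jumpSum_neg, wt_neg, neg_neg] at h2
  refine ⟨c - l₁ + l₂, ((hc.sub h1).add h2).congr fun n => ?_⟩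
  unfold stepMart; ring

/-- Among any two consecutive positions of the confined path one is `x - 1` or `x + 1`, by parity.
-/
lemma wt_sum_ge (h : Confined Δ p x n₀ K₁ K₂ D) (k : ℕ) :
    wt Δ p n₀ (x + 1) + wt Δ p n₀ (x - 1) + k ≤
      wt Δ p (n₀ + 2 * k) (x + 1) + wt Δ p (n₀ + 2 * k) (x - 1) := by
  induction k with
  | zero => simp
  | succ k ih =>
    set n := n₀ + 2 * k with hn
    rw [show n₀ + 2 * (k + 1) = n + 1 + 1 by omega, wt_succ, wt_succ, wt_succ _ _ _ (x - 1),
      wt_succ _ _ _ (x - 1)]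
    have s1 := h.step n (by omega)
    have s2 := h.step (n + 1) (by omega)
    have a1 := h.le (n + 1) (by omega)
    have a2 := h.le (n + 1 + 1) (by omega)
    have b1 := h.ge (n + 1) (by omega)
    have b2 := h.ge (n + 1 + 1) (by omega)
    have key : p (n + 1) = x + 1 ∨ p (n + 1) = x - 1 ∨ p (n + 1 + 1) = x + 1 ∨
        p (n + 1 + 1) = x - 1 := by omega
    have i1 : (0 : ℝ) ≤ if p (n + 1) = x + 1 then 1 else 0 := by split_ifs <;> norm_num
    have i2 : (0 : ℝ) ≤ if p (n + 1) = x - 1 then 1 else 0 := by split_ifs <;> norm_num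
    have i3 : (0 : ℝ) ≤ if p (n + 1 + 1) = x + 1 then 1 else 0 := by split_ifs <;> norm_num
    have i4 : (0 : ℝ) ≤ if p (n + 1 + 1) = x - 1 then 1 else 0 := by split_ifs <;> norm_num
    push_cast
    rcases key with hk | hk | hk | hk
    · rw [if_pos hk] at i1 ⊢; linarith
    · rw [if_pos hk] at i2 ⊢; linarith
    · rw [if_pos hk] at i3 ⊢; linarith
    · rw [if_pos hk] at i4 ⊢; linarith

/-- The weights of the neighbours of the centre are comparable. -/
lemma exists_wt_ratio_le (h : Confined Δ p x n₀ K₁ K₂ D) (hΔ : -1 < Δ) :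
    ∃ C : ℝ, 0 < C ∧ ∀ n, n₀ ≤ n → wt Δ p n (x - 1) ≤ C * wt Δ p n (x + 1) := by
  set B := (Real.log (wt Δ p n₀ (x + 1)) - Real.log (wt Δ p n₀ (x - 1))) -
    (K₁ + 2 * D + 1 / wt Δ p n₀ (x + 1) + 1 / wt Δ p n₀ (x - 1)) with hB
  refine ⟨Real.exp (-B), Real.exp_pos _, fun n hn => ?_⟩
  have h1 := (abs_le.1 (h.abs_log_ratio_sub_le hΔ hn)).1
  have w1 := wt_pos hΔ p n (x + 1)
  have w2 := wt_pos hΔ p n (x - 1)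
  rw [← Real.log_le_log_iff w2 (by positivity), Real.log_mul (Real.exp_pos _).ne' w1.ne',
    Real.log_exp]
  linarith

/-- The sum of the two neighbouring weights diverges and their ratio is bounded, so neither can stay
bounded. -/
lemma tendsto_wt_right (h : Confined Δ p x n₀ K₁ K₂ D) (hΔ : -1 < Δ) :
    Tendsto (fun n => wt Δ p n (x + 1)) atTop atTop := by
  obtain ⟨C, hC, hle⟩ := h.exists_wt_ratio_le hΔ
  refine tendsto_atTop_atTop_of_monotone (wt_mono Δ p (x + 1)) fun b => ?_
  obtain ⟨k, hk⟩ := exists_nat_ge ((1 + C) * b)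
  refine ⟨n₀ + 2 * k, ?_⟩
  have h1 := h.wt_sum_ge k
  have h2 := hle (n₀ + 2 * k) (by omega)
  have w1 := wt_pos hΔ p n₀ (x + 1)
  have w2 := wt_pos hΔ p n₀ (x - 1)
  have h3 : (1 + C) * b ≤ (1 + C) * wt Δ p (n₀ + 2 * k) (x + 1) := by linarith
  exact le_of_mul_le_mul_left h3 (by linarith)

lemma tendsto_wt_left (h : Confined Δ p x n₀ K₁ K₂ D) (hΔ : -1 < Δ) :
    Tendsto (fun n => wt Δ p n (x - 1)) atTop atTop := by
  have := h.neg.tendsto_wt_right hΔ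
  simpa only [wt_neg, neg_add, neg_neg, ← sub_eq_add_neg] using this

lemma frequently_of_tendsto_wt {v : ℤ} (h : Tendsto (fun n => wt Δ p n v) atTop atTop) (N : ℕ) :
    ∃ i, N ≤ i ∧ p i = v := by
  by_contra hc
  push Not at hc
  have hconst : ∀ n, N ≤ n → wt Δ p n v = wt Δ p N v := by
    intro n hn
    induction n, hn using Nat.le_induction with
    | base => rfl
    | succ n hn ih => rw [wt_succ, if_neg (hc _ (by omega)), ih, add_zero]
  obtain ⟨n, hn⟩ := (h.eventually_gt_atTop (wt Δ p N v)).and (eventually_ge_atTop N) |>.exists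
  exact hn.1.ne' (hconst n hn.2)

lemma frequently_center (h : Confined Δ p x n₀ K₁ K₂ D) (hΔ : -1 < Δ) (N : ℕ) :
    ∃ i, N ≤ i ∧ p i = x := by
  by_contra hc
  push Not at hc
  obtain ⟨i, hi, hpi⟩ := frequently_of_tendsto_wt (h.tendsto_wt_right hΔ) (max N n₀)
  have hgt : ∀ j, i ≤ j → x < p j := by
    intro j hj
    induction j, hj using Nat.le_induction with
    | base => omega
    | succ j hj ih =>
      have h1 := h.step j (by have := le_max_right N n₀; omega)
      have h2 := hc (j + 1) (by have := le_max_left N n₀; omega)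
      omega
  obtain ⟨j, hj, hpj⟩ := frequently_of_tendsto_wt (h.tendsto_wt_left hΔ) i
  have := hgt j hj
  omega

/-- After `n₀` each visit to `x` is preceded by one to a neighbour. The extra 1 is the neighbour
visit in progress, which may still lead to `x`; it keeps the induction going. -/
lemma wt_center_le (h : Confined Δ p x n₀ K₁ K₂ D) (hn : n₀ ≤ n) :
    wt Δ p n x + (if p n = x + 1 ∨ p n = x - 1 then 1 else 0) ≤ wt Δ p n₀ x +
      (wt Δ p n (x + 1) + wt Δ p n (x - 1)) - (wt Δ p n₀ (x + 1) + wt Δ p n₀ (x - 1)) := by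
  induction n, hn using Nat.le_induction with
  | base =>
    rw [if_neg (by have := h.start; omega)]
    linarith
  | succ n hn ih =>
    rw [wt_succ, wt_succ, wt_succ _ _ _ (x - 1)]
    have s := h.step n hn
    have a := h.le (n + 1) (by omega)
    have b := h.ge (n + 1) (by omega)
    by_cases h1 : p n = x + 1 ∨ p n = x - 1
    · rw [if_pos h1] at ih
      rw [if_neg (show ¬ (p (n + 1) = x + 1 ∨ p (n + 1) = x - 1) by omega),
        if_neg (show p (n + 1) ≠ x + 1 by omega), if_neg (show p (n + 1) ≠ x - 1 by omega)]
      split_ifs <;> linarith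
    · rw [if_neg h1] at ih
      rw [if_neg (show p (n + 1) ≠ x by omega)]
      by_cases h2 : p (n + 1) = x + 1
      · rw [if_pos (Or.inl h2), if_pos h2, if_neg (by omega)]; linarith
      · by_cases h3 : p (n + 1) = x - 1
        · rw [if_pos (Or.inr h3), if_neg h2, if_pos h3]; linarith
        · rw [if_neg (by tauto), if_neg h2, if_neg h3]; linarith

/-- The right end point is visited infinitely often. -/
lemma frequently_far (h : Confined Δ p x n₀ K₁ K₂ D) (hΔ : -1 < Δ) (N : ℕ) :
    ∃ i, N ≤ i ∧ p i = x + 2 := by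
  by_contra hc
  push Not at hc
  obtain ⟨C, hC, hle⟩ := h.exists_wt_ratio_le hΔ
  set M := max N n₀ with hM
  have hMn : n₀ ≤ M := le_max_right _ _
  have hMN : N ≤ M := le_max_left _ _
  have hB : 0 < 1 + Δ := by linarith
  have hw0 := wt_pos hΔ p n₀ x
  set C' := wt Δ p n₀ x / (1 + Δ) + 1 + C with hC'
  have hC'0 : 0 < C' := by positivity
  have hcenter : ∀ n, n₀ ≤ n → wt Δ p n x ≤ C' * wt Δ p n (x + 1) := by
    intro n hn
    have h1 := h.wt_center_le (Δ := Δ) hn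
    have h2 := hle n hn
    have h3 := one_add_le_wt Δ p n (x + 1)
    have h4 : wt Δ p n₀ x ≤ wt Δ p n₀ x / (1 + Δ) * wt Δ p n (x + 1) := by
      rw [div_mul_eq_mul_div, le_div_iff₀ hB]
      exact mul_le_mul_of_nonneg_left h3 hw0.le
    have h5 : (0 : ℝ) ≤ if p n = x + 1 ∨ p n = x - 1 then 1 else 0 := by split_ifs <;> norm_num
    have w1 := wt_pos hΔ p n₀ (x + 1)
    have w2 := wt_pos hΔ p n₀ (x - 1)
    have e : C' * wt Δ p n (x + 1) = wt Δ p n₀ x / (1 + Δ) * wt Δ p n (x + 1)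
      + wt Δ p n (x + 1) + C * wt Δ p n (x + 1) := by rw [hC']; ring
    linarith
  -- Once `x + 2` is abandoned, every visit to `x + 1` ends with a step to `x`, worth 1/Z(x) ≥ 1/(C'
  -- Z(x+1)). The added 0 or 1 shifts the growth of the weight from the arrival at `x + 1` to the
  -- departure.
  have hgrow : ∀ n, M ≤ n → Real.log (wt Δ p n (x + 1) + if p n = x + 1 then 0 else 1) ≤
      Real.log (wt Δ p M (x + 1) + 1) + C' * jumpSum Δ p n₀ (x + 1) x 0 n := by
    intro n hn
    induction n, hn using Nat.le_induction with
    | base =>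
      have h1 := jumpSum_nonneg (p := p) (n₀ := n₀) (a := x + 1) (b := x) (L := 0) (n := M) hΔ
      have h2 : Real.log (wt Δ p M (x + 1) + if p M = x + 1 then 0 else 1) ≤
          Real.log (wt Δ p M (x + 1) + 1) := by
        have := wt_pos hΔ p M (x + 1)
        refine Real.log_le_log ?_ ?_ <;> split_ifs <;> linarith
      have := mul_nonneg hC'0.le h1
      linarith
    | succ n hn ih =>
      rw [jumpSum_succ (by omega)]
      have w := wt_pos hΔ p n (x + 1)
      have wx := wt_pos hΔ p n x
      have hs := h.step n (by omega)
      have hne := hc (n + 1) (by omega)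
      by_cases h1 : p n = x + 1
      · rw [if_pos h1, add_zero] at ih
        have h2 : p (n + 1) = x := by omega
        simp only [wt_succ, h1, h2, true_and, Nat.zero_le, if_true]
        have h3 := log_add_one_le w
        have h4 := one_div_le_one_div_of_le wx (hcenter n (by omega))
        have h5 := mul_le_mul_of_nonneg_left h4 hC'0.le
        have h6 : C' * (1 / (C' * wt Δ p n (x + 1))) = 1 / wt Δ p n (x + 1) := by field_simp
        simp only [if_neg (show ¬ x = x + 1 by omega), mul_add, add_zero]
        linarith
      · rw [if_neg h1] at ih
        by_cases h2 : p (n + 1) = x + 1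
        · simpa only [wt_succ, h1, h2, if_true, add_zero, false_and, if_false] using ih
        · simpa only [wt_succ, h1, h2, add_zero, false_and, if_false] using ih
  have hconst : ∀ n, M ≤ n → jumpSum Δ p n₀ (x + 1) (x + 2) 0 n
      = jumpSum Δ p n₀ (x + 1) (x + 2) 0 M := by
    intro n hn
    induction n, hn using Nat.le_induction with
    | base => rfl
    | succ n hn ih =>
      rw [jumpSum_succ (by omega), if_neg, ih, add_zero]
      rintro ⟨-, h, -⟩
      exact hc _ (by omega) h
  -- The steps to `x + 2` no longer contribute, so M(x+1) ≥ -K₂ bounds the sum over the steps to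
  -- `x`, and hence log Z(x+1) by `A`. This contradicts the divergence of Z(x+1).
  set A := Real.log (wt Δ p M (x + 1) + 1) + C' * (jumpSum Δ p n₀ (x + 1) (x + 2) 0 M + K₂)
  obtain ⟨n, hn1, hn2⟩ := ((h.tendsto_wt_right hΔ).eventually_gt_atTop (Real.exp A)).and
    (eventually_ge_atTop M) |>.exists
  have h1 := hgrow n hn2
  have h2 := (abs_le.1 (h.right n (by omega))).1
  unfold stepMart at h2
  rw [show x + 1 + 1 = x + 2 by ring, show x + 1 - 1 = x by ring, hconst n hn2] at h2
  have h3 : jumpSum Δ p n₀ (x + 1) x 0 n ≤ jumpSum Δ p n₀ (x + 1) (x + 2) 0 M + K₂ := by linarith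
  have h4 := mul_le_mul_of_nonneg_left h3 hC'0.le
  have w := wt_pos hΔ p n (x + 1)
  have h5 : Real.log (wt Δ p n (x + 1)) ≤
      Real.log (wt Δ p n (x + 1) + if p n = x + 1 then 0 else 1) := by
    refine Real.log_le_log w ?_
    split_ifs <;> linarith
  have h6 := (Real.lt_log_iff_exp_lt w).2 hn1
  linarith

lemma mem_asymptoticRange_iff {v : ℤ} :
    v ∈ asymptoticRange p ↔ ∀ N, ∃ i, N ≤ i ∧ p i = v := by
  have h1 : v ∈ asymptoticRange p ↔ {k : ℕ | p k = v}.Infinite := by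
    rw [← Set.encard_eq_top_iff]
    show {k : ℕ | p k = v}.encard + 1 = ⊤ ↔ _
    constructor
    · intro h
      exact (ENat.add_eq_top.1 h).resolve_right ENat.one_ne_top
    · intro h; rw [h]; rfl
  rw [h1, ← Nat.frequently_atTop_iff_infinite, frequently_atTop]

lemma asymptoticRange_eq (h : Confined Δ p x n₀ K₁ K₂ D) (hΔ : -1 < Δ) :
    asymptoticRange p = {x - 2, x - 1, x, x + 1, x + 2} := by
  ext v
  rw [mem_asymptoticRange_iff]
  constructor
  · intro hv
    obtain ⟨i, hi, hpi⟩ := hv n₀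
    have a := h.le i hi
    have b := h.ge i hi
    simp only [Set.mem_insert_iff, Set.mem_singleton_iff]
    omega
  · simp only [Set.mem_insert_iff, Set.mem_singleton_iff]
    rintro (rfl | rfl | rfl | rfl | rfl) N
    · obtain ⟨i, hi, hpi⟩ := h.neg.frequently_far hΔ N
      exact ⟨i, hi, by omega⟩
    · exact frequently_of_tendsto_wt (h.tendsto_wt_left hΔ) N
    · exact h.frequently_center hΔ N
    · exact frequently_of_tendsto_wt (h.tendsto_wt_right hΔ) N
    · exact h.frequently_far hΔ N

/-- The limiting proportion in terms of the limiting ratio of the weights. -/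
lemma tendsto_alphaMinus (h : Confined Δ p x n₀ K₁ K₂ D) (hΔ : -1 < Δ) {l : ℝ}
    (hl : Tendsto (fun n => Real.log (wt Δ p n (x + 1)) - Real.log (wt Δ p n (x - 1)))
      atTop (𝓝 l)) :
    Tendsto (fun n => alphaMinus p x n) atTop (𝓝 (1 / (1 + Real.exp l))) := by
  have h1 := (Real.continuous_exp.tendsto l).comp hl
  have h2 : Tendsto (fun n => Δ / wt Δ p n (x - 1)) atTop (𝓝 0) :=
    (h.tendsto_wt_left hΔ).const_div_atTop Δ
  have h3 := (h2.const_sub 1).div ((h1.const_add 1).sub (h2.const_mul 2))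
    (by have := Real.exp_pos l; rw [mul_zero, sub_zero]; positivity)
  rw [sub_zero, mul_zero, sub_zero] at h3
  refine h3.congr fun n => ?_
  have w1 := wt_pos hΔ p n (x + 1)
  have w2 := wt_pos hΔ p n (x - 1)
  have e1 : (visits p n (x - 1) : ℝ) = wt Δ p n (x - 1) - Δ := by unfold wt; ring
  have e2 : (visits p n (x + 1) : ℝ) = wt Δ p n (x + 1) - Δ := by unfold wt; ring
  have hv1 : (1 : ℝ) ≤ visits p n (x - 1) := by exact_mod_cast one_le_visits p n (x - 1)
  have hv2 : (1 : ℝ) ≤ visits p n (x + 1) := by exact_mod_cast one_le_visits p n (x + 1)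
  rw [e1] at hv1
  rw [e2] at hv2
  have e3 : (1 - Δ / wt Δ p n (x - 1)) = (wt Δ p n (x - 1) - Δ) / wt Δ p n (x - 1) := by
    field_simp
  have e4 : 1 + wt Δ p n (x + 1) / wt Δ p n (x - 1) - 2 * (Δ / wt Δ p n (x - 1)) =
      (wt Δ p n (x - 1) - Δ + (wt Δ p n (x + 1) - Δ)) / wt Δ p n (x - 1) := by
    field_simp; ring
  unfold alphaMinus
  simp only [Pi.div_apply, Function.comp_apply]
  rw [Real.exp_sub, Real.exp_log w1, Real.exp_log w2, e1, e2, e3, e4]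
  rw [div_div_div_cancel_right₀ w2.ne']

end Confined

/-! ### Confinement from a prepared configuration -/

/-- The position `x` and the local times `Z` can be reached with positive probability. -/
def Reachable {Ω : Type*} [MeasurableSpace Ω] (μ : Measure Ω) (X : ℕ → Ω → ℤ) (x : ℤ)
    (Z : ℤ → ℕ) : Prop :=
  ∃ (n : ℕ) (p : ℕ → ℤ), 0 < μ {ω | ∀ i ≤ n, X i ω = p i} ∧ p n = x ∧ ∀ v, visits p n v = Z v

lemma jumpSum_of_level {Δ : ℝ} {p : ℕ → ℤ} {n₀ n L : ℕ} {a b : ℤ} (hL : L ≤ visits p n₀ a) :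
    jumpSum Δ p n₀ a b L n = jumpSum Δ p n₀ a b 0 n := by
  unfold jumpSum
  refine Finset.sum_congr rfl fun i hi => ?_
  have := hL.trans (visits_mono p a (Finset.mem_Ico.1 hi).1)
  simp only at this
  simp [this]

lemma stepMart_of_level {Δ : ℝ} {p : ℕ → ℤ} {n₀ n L : ℕ} {v : ℤ} (hL : L ≤ visits p n₀ v) :
    stepMart Δ p n₀ v L n = stepMart Δ p n₀ v 0 n := by
  unfold stepMart; rw [jumpSum_of_level hL, jumpSum_of_level hL]

lemma jumpSum_eq_sub {Δ : ℝ} {p : ℕ → ℤ} {n₀ n L : ℕ} {a b : ℤ} (hn : n₀ ≤ n) :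
    jumpSum Δ p n₀ a b L n = jumpSum Δ p 0 a b L n - jumpSum Δ p 0 a b L n₀ := by
  unfold jumpSum
  rw [eq_sub_iff_add_eq, add_comm, Finset.sum_Ico_consecutive _ (Nat.zero_le _) hn]

lemma wt_eq_of_not_visited {Δ : ℝ} {p : ℕ → ℤ} {n₀ n : ℕ} {v : ℤ} (hn : n₀ ≤ n)
    (h : ∀ i, n₀ ≤ i → i ≤ n → p i ≠ v) : wt Δ p n v = wt Δ p n₀ v := by
  induction n, hn using Nat.le_induction with
  | base => rfl
  | succ n hn ih =>
    rw [wt_succ, if_neg (h (n + 1) (by omega) le_rfl), add_zero,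
      ih fun i hi hin => h i hi (by omega)]

section Measure

variable {Ω : Type*} [MeasurableSpace Ω] {μ : Measure Ω} [IsProbabilityMeasure μ]
  {Δ : ℝ} {v₀ : ℤ} {X : ℕ → Ω → ℤ}

lemma Reachable.step (hΔ : -1 < Δ) (hX : IsVRRW Δ v₀ X μ) {x y : ℤ} {Z : ℤ → ℕ}
    (h : Reachable μ X x Z) (hy : y = x + 1 ∨ y = x - 1) :
    Reachable μ X y fun v => Z v + if y = v then 1 else 0 := by
  obtain ⟨n, p, hp, hx, hZ⟩ := h
  have hq : ∀ i ≤ n, Function.update p (n + 1) y i = p i := fun i hi => by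
    simp [show i ≠ n + 1 by omega]
  refine ⟨n + 1, Function.update p (n + 1) y, cylinder_succ_pos hΔ hX hp hq ?_, by simp, fun v => ?_⟩
  · simpa [hx] using hy
  · rw [visits_succ, visits_congr hq, hZ]; simp

lemma exists_reachable (hΔ : -1 < Δ) (hX : IsVRRW Δ v₀ X μ) (x : ℤ) :
    ∃ Z, Reachable μ X x Z := by
  induction x using Int.inductionOn' (b := v₀) with
  | zero =>
    refine ⟨_, 0, fun _ => v₀, ?_, rfl, fun v => rfl⟩
    have : ∀ᵐ ω ∂μ, ∀ i ≤ 0, X i ω = v₀ := by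
      filter_upwards [hX.start] with ω h i hi
      obtain rfl : i = 0 := by omega
      exact h
    refine (zero_lt_one.trans_eq (measure_univ (μ := μ)).symm).trans_le (measure_mono_ae ?_)
    filter_upwards [this] with ω h _ using h
  | succ k hk ih =>
    obtain ⟨Z, hZ⟩ := ih
    exact ⟨_, hZ.step hΔ hX (Or.inl rfl)⟩
  | pred k hk ih =>
    obtain ⟨Z, hZ⟩ := ih
    exact ⟨_, hZ.step hΔ hX (Or.inr rfl)⟩

/-- Excursions of length two from `x` adjust its neighbours independently. That `x - 2` and `x + 2`
keep their local times is essential: their weights stay fixed when the number of bounces grows. -/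
lemma Reachable.bounce (hΔ : -1 < Δ) (hX : IsVRRW Δ v₀ X μ) {x : ℤ} {Z : ℤ → ℕ}
    (h : Reachable μ X x Z) (a b : ℕ) : ∃ Z', Reachable μ X x Z' ∧ Z' x = Z x + a + b ∧
      Z' (x - 1) = Z (x - 1) + a ∧ Z' (x + 1) = Z (x + 1) + b ∧
      Z' (x - 2) = Z (x - 2) ∧ Z' (x + 2) = Z (x + 2) := by
  induction a with
  | zero =>
    induction b with
    | zero => exact ⟨Z, h, by simp⟩
    | succ b ih =>
      obtain ⟨Z', h', e1, e2, e3, e4, e5⟩ := ih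
      refine ⟨_, (h'.step hΔ hX (y := x + 1) (Or.inl rfl)).step hΔ hX (y := x)
        (Or.inr (by ring)), ?_⟩
      simp only [e1, e2, e3, e4, e5]
      refine ⟨?_, ?_, ?_, ?_, ?_⟩ <;> split_ifs <;> omega
  | succ a ih =>
    obtain ⟨Z', h', e1, e2, e3, e4, e5⟩ := ih
    refine ⟨_, (h'.step hΔ hX (y := x - 1) (Or.inr rfl)).step hΔ hX (y := x)
      (Or.inl (by ring)), ?_⟩
    simp only [e1, e2, e3, e4, e5]
    refine ⟨?_, ?_, ?_, ?_, ?_⟩ <;> split_ifs <;> omega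

/-- The walk is confined with positive probability after a good initial path. -/
lemma confined_pos (hΔ : -1 < Δ) (hX : IsVRRW Δ v₀ X μ) {x : ℤ} {n₀ : ℕ} {p₀ : ℕ → ℤ}
    (hcyl : 0 < μ {ω | ∀ i ≤ n₀, X i ω = p₀ i}) (hp₀ : p₀ n₀ = x) {m K₁ K₂ D θ : ℝ}
    (hm : 0 < m) (hK₁ : 0 < K₁) (hK₂ : 0 < K₂) (hθ : 1 < θ)
    (hLr : m + wt Δ p₀ n₀ (x + 1) ≤ visits p₀ n₀ x + Δ - 1)
    (hLl : m + wt Δ p₀ n₀ (x - 1) ≤ visits p₀ n₀ x + Δ - 1)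
    (hmr : m + 1 ≤ wt Δ p₀ n₀ (x + 1)) (hml : m + 1 ≤ wt Δ p₀ n₀ (x - 1))
    (hθr : θ ≤ 1 + m / (wt Δ p₀ n₀ (x + 1) * Real.exp (K₁ + D)))
    (hθl : θ ≤ 1 + m / (wt Δ p₀ n₀ (x - 1) * Real.exp (K₁ + D)))
    (hDr : (wt Δ p₀ n₀ (x + 2) * Real.exp K₂) ^ θ / wt Δ p₀ n₀ (x + 1) *
      ∑' j : ℕ, 1 / (wt Δ p₀ n₀ (x + 2) + 1 + j) ^ θ ≤ D)
    (hDl : (wt Δ p₀ n₀ (x - 2) * Real.exp K₂) ^ θ / wt Δ p₀ n₀ (x - 1) *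
      ∑' j : ℕ, 1 / (wt Δ p₀ n₀ (x - 2) + 1 + j) ^ θ ≤ D)
    (hE₁ : compConst Δ / wt Δ p₀ n₀ (x + 1) + compConst Δ / wt Δ p₀ n₀ (x - 1) ≤ K₁ ^ 2 / 4)
    (hE₂ : 2 * (compConst Δ / (1 + Δ)) ≤ K₂ ^ 2 / 8) :
    0 < μ {ω | (∀ i ≤ n₀, X i ω = p₀ i) ∧ Confined Δ (traj X ω) x n₀ K₁ K₂ D} := by
  have hc := compConst_pos hΔ
  set L := visits p₀ n₀ x with hL
  set κl := wt Δ p₀ n₀ (x - 3)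
  set κr := wt Δ p₀ n₀ (x + 3)
  have hκl : 0 < κl := wt_pos hΔ _ _ _
  have hκr : 0 < κr := wt_pos hΔ _ _ _
  have hw1 : 0 < 1 / K₁ ^ 2 := by positivity
  have hw2 : 0 < 1 / K₂ ^ 2 := by positivity
  -- The level is already attained at `n₀`, so no step is forced. With weights 1/K², positive slack
  -- means exactly that the martingales are bounded by `K₁` and `K₂`. The weights `κl` and `κr` are
  -- frozen, since the sites `x - 3` and `x + 3` are not visited after `n₀` by an alive path.
  set T : Trap := ⟨x, n₀, L, True, 1 / K₂ ^ 2, 1 / K₁ ^ 2, 1 / K₂ ^ 2, κl, κr⟩ with hT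
  set S : Set (ℕ → ℤ) := {p | ∀ i ≤ n₀, p i = p₀ i} with hSdef
  have hS : ∀ p q : ℕ → ℤ, (∀ i ≤ T.n₀, p i = q i) → p ∈ S → q ∈ S :=
    fun p q h hp i hi => (h i hi).symm.trans (hp i hi)
  have hwt : ∀ p ∈ S, ∀ v, wt Δ p n₀ v = wt Δ p₀ n₀ v := fun p hp v => wt_congr hp v
  have hstart : ∀ p ∈ S, p n₀ = x := fun p hp => (hp n₀ le_rfl).trans hp₀
  have hvis : ∀ p ∈ S, ∀ i, n₀ ≤ i → L ≤ visits p i x := fun p hp i hi => by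
    rw [hL, ← visits_congr hp]; exact visits_mono p x hi
  have hmart : ∀ {K t : ℝ}, 0 < K → 1 / K ^ 2 * t ^ 2 ≤ 1 → |t| ≤ K := fun {K t} hK ht => by
    rw [one_div, ← div_eq_inv_mul, div_le_one (by positivity)] at ht
    exact abs_le_of_sq_le_sq ht hK.le
  have hmarts : ∀ n p, p ∈ T.alive Δ n S → ∀ i, n₀ ≤ i → i ≤ n →
      |stepMart Δ p n₀ (x - 1) 0 i| ≤ K₂ ∧ |stepMart Δ p n₀ x L i| ≤ K₁ ∧
      |stepMart Δ p n₀ (x + 1) 0 i| ≤ K₂ := by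
    intro n p hp i hi hin
    obtain ⟨h1, h2, h3⟩ := Trap.mart_sq_le (T := T) hΔ hw2.le hw1.le hw2.le (hp.2.1 i hi hin).2.2
    exact ⟨hmart hK₂ h1, hmart hK₁ h2, hmart hK₂ h3⟩
  have htrap : ∀ n p, n₀ ≤ n → p ∈ T.alive Δ n S → RightTrapped Δ p x n₀ L n m K₁ K₂ := by
    intro n p hn hp
    refine ⟨hstart p hp.1, fun i hi hin => (hp.2.2 i hi hin).1,
      fun i hi hin => (hp.2.1 i hi hin).1, fun i hi hin h1 h2 => hvis p hp.1 i hi,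
      fun i hi hin => (abs_le.1 (hmarts n p hp i hi hin).2.1).2,
      fun i hi hin => (abs_le.1 (hmarts n p hp i hi hin).2.2).2, fun i hi hin h1 h2 => ?_⟩
    have := wt_add_jumpCount_le (Δ := Δ) (p := p) (a := x) (b := x - 1) (L := L) hi
    rw [hwt p hp.1] at this
    linarith
  have htrap' : ∀ n p, n₀ ≤ n → p ∈ T.alive Δ n S →
      RightTrapped Δ (fun k => -p k) (-x) n₀ L n m K₁ K₂ := by
    intro n p hn hp
    refine ⟨by have := hstart p hp.1; omega,
      fun i hi hin => by have := (hp.2.2 i hi hin).1; omega,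
      fun i hi hin => by have := (hp.2.1 i hi hin).2.1 trivial; simp only [hT] at this; omega,
      fun i hi hin h1 h2 => by rw [visits_neg, neg_neg]; exact hvis p hp.1 i hi,
      fun i hi hin => ?_, fun i hi hin => ?_, fun i hi hin h1 h2 => ?_⟩
    · rw [stepMart_neg]
      linarith [(abs_le.1 (hmarts n p hp i hi hin).2.1).1]
    · rw [show -x + 1 = -(x - 1) by ring, stepMart_neg]
      linarith [(abs_le.1 (hmarts n p hp i hi hin).1).1]
    · have := wt_add_jumpCount_le (Δ := Δ) (p := p) (a := x) (b := x + 1) (L := L) hi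
      rw [hwt p hp.1] at this
      rw [show -x - 1 = -(x + 1) by ring, jumpCount_neg, wt_neg, neg_neg]
      linarith
  have hfar : ∀ n p, n₀ ≤ n → p ∈ T.alive Δ n S →
      jumpSum Δ p n₀ (x + 2) (x + 1) 0 n ≤ D := by
    intro n p hn hp
    refine (htrap n p hn hp).jumpSum_far_le hΔ hm hn le_rfl hθ ?_ ?_ ?_ <;>
      simp only [hwt p hp.1] <;> assumption
  have hfar' : ∀ n p, n₀ ≤ n → p ∈ T.alive Δ n S →
      jumpSum Δ p n₀ (x - 2) (x - 1) 0 n ≤ D := by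
    intro n p hn hp
    have e1 : -x + 1 = -(x - 1) := by ring
    have e2 : -x + 2 = -(x - 2) := by ring
    have := (htrap' n p hn hp).jumpSum_far_le hΔ hm hn le_rfl (D := D) hθ
    rw [e1, e2, jumpSum_neg] at this
    simp only [wt_neg, neg_neg, hwt p hp.1] at this
    exact this hLl hθl hDl
  set C : ℝ := 2 ^ L * Real.exp (κr * D + κl * D) with hC
  have hC0 : 0 < C := by positivity
  -- The three energies use up at most 1/8 + 1/4 + 1/8 = 1/2.
  have hslack : ∀ p ∈ S, 1 / 2 ≤ T.slack Δ p n₀ := by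
    intro p hp
    have e1 := stepEnergy_self_le (p := p) (n₀ := n₀) (v := x - 1) (L := 0) hΔ
    have e2 := stepEnergy_self_le (p := p) (n₀ := n₀) (v := x + 1) (L := 0) hΔ
    have e3 : stepEnergy Δ p n₀ x L n₀ ≤ K₁ ^ 2 / 4 := by
      rw [stepEnergy_self, hwt p hp, hwt p hp]; exact hE₁
    have e4 := mul_le_mul_of_nonneg_left (e1.trans hE₂) hw2.le
    have e5 := mul_le_mul_of_nonneg_left (e2.trans hE₂) hw2.le
    have e6 := mul_le_mul_of_nonneg_left e3 hw1.le
    have e7 : 1 / K₂ ^ 2 * (K₂ ^ 2 / 8) = 1 / 8 := by field_simp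
    have e8 : 1 / K₁ ^ 2 * (K₁ ^ 2 / 4) = 1 / 4 := by field_simp
    rw [e7] at e4 e5
    rw [e8] at e6
    simp only [Trap.slack, hT]
    linarith
  have hsurv := survival hΔ hX n₀ (fun n => T.alive Δ n S) (fun n p => T.potential Δ p n)
    (b := 1 / 2) (C := C) hC0.le (fun n hn p q h => Trap.alive_congr hS hn h)
    (fun n p q h => Trap.potential_congr h)
    (fun n _ => Trap.alive_succ_subset) ?_ ?_ ?_
  · have hpos : 0 < μ.real {ω | traj X ω ∈ S} := ENNReal.toReal_pos hcyl.ne' (measure_ne_top _ _)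
    have hmono : μ.real {ω | traj X ω ∈ S} ≤ μ.real {ω | traj X ω ∈ T.alive Δ n₀ S} := by
      refine measureReal_mono fun ω hω => ⟨hω, fun i hi hin => ?_, fun i hi hin => ?_⟩
      · obtain rfl : i = n₀ := le_antisymm hin hi
        have := hstart _ hω
        refine ⟨by rw [this]; simp only [hT]; omega, fun _ => by rw [this]; simp only [hT]; omega, ?_⟩
        exact lt_of_lt_of_le (by norm_num) (hslack _ hω)
      · simp only [hT] at hi; omega
    have h1 : 0 < μ.real {ω | ∀ n, n₀ ≤ n → traj X ω ∈ T.alive Δ n S} := by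
      by_contra h
      have := mul_nonpos_of_nonneg_of_nonpos hC0.le (not_lt.1 h)
      linarith
    refine (ENNReal.toReal_pos_iff.1 h1).1.trans_le (measure_mono fun ω hω => ?_)
    have hω : ∀ n, n₀ ≤ n → traj X ω ∈ T.alive Δ n S := hω
    have hS0 := (hω n₀ le_rfl).1
    refine ⟨hS0, ⟨hstart _ hS0, fun i hi => ((hω (i + 1) (by omega)).2.2 i hi (by omega)).1,
      fun i hi => ((hω i hi).2.1 i hi le_rfl).1,
      fun i hi => ((hω i hi).2.1 i hi le_rfl).2.1 trivial, fun i hi => ?_,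
      fun i hi => (hmarts i _ (hω i hi) i hi le_rfl).2.2,
      fun i hi => (hmarts i _ (hω i hi) i hi le_rfl).1,
      fun i hi => hfar i _ hi (hω i hi), fun i hi => hfar' i _ hi (hω i hi)⟩⟩
    rw [← stepMart_of_level (hvis _ hS0 n₀ le_rfl)]
    exact (hmarts i _ (hω i hi) i hi le_rfl).2.1
  · intro n hn p hp
    refine ⟨mul_nonneg Trap.factor_pos.le (hp.2.1 n hn le_rfl).2.2.le, ?_⟩
    refine Trap.potential_le (T := T) hΔ hw2.le hw1.le hw2.le ?_
    exact add_le_add (mul_le_mul_of_nonneg_left (hfar n p hn hp) hκr.le)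
      (mul_le_mul_of_nonneg_left (hfar' n p hn hp) hκl.le)
  · intro p hp
    exact Trap.le_potential_start (T := T) (by norm_num) (hslack p hp.1)
  · intro n hn p hp q r hq hqs hr hrs
    refine Trap.potential_le_avg (T := T) hΔ hw2.le hw1.le hw2.le hS (fun h => absurd trivial h)
      hn hp (fun _ => ?_) (fun _ _ => ?_) (fun _ h => ?_) hq hqs hr hrs
    · rw [wt_eq_of_not_visited hn fun i hi hin => ?_]
      · exact hwt p hp.1 _
      · have := (hp.2.1 i hi hin).1
        simp only [hT] at this ⊢; omega
    · rw [wt_eq_of_not_visited hn fun i hi hin => ?_]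
      · exact hwt p hp.1 _
      · have := (hp.2.1 i hi hin).2.1 trivial
        simp only [hT] at this ⊢; omega
    · exact absurd (hvis p hp.1 n hn) (not_le.2 h)

end Measure

/-! ### Choice of the configuration and localization -/

lemma tendsto_add_floor_div (w : ℝ) {a : ℝ} (ha : 0 ≤ a) :
    Tendsto (fun N : ℕ => (w + (⌊a * N⌋₊ : ℝ)) / N) atTop (𝓝 a) := by
  have h1 := (tendsto_nat_floor_mul_div_atTop (R := ℝ) ha).comp tendsto_natCast_atTop_atTop
  have h2 : Tendsto (fun N : ℕ => w / (N : ℝ)) atTop (𝓝 0) :=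
    tendsto_const_div_atTop_nhds_zero_nat w
  have h3 := h2.add h1
  rw [zero_add] at h3
  refine h3.congr fun N => ?_
  simp only [Function.comp_apply]
  rw [add_div]

lemma tendsto_add_floor_atTop (w : ℝ) {a : ℝ} (ha : 0 < a) :
    Tendsto (fun N : ℕ => w + (⌊a * N⌋₊ : ℝ)) atTop atTop := by
  refine tendsto_atTop_add_const_left _ _ ?_
  exact tendsto_natCast_atTop_atTop.comp (tendsto_nat_floor_atTop.comp
    (tendsto_natCast_atTop_atTop.const_mul_atTop ha))

lemma eventually_pos_of_tendsto_div {u : ℕ → ℝ} {c : ℝ}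
    (h : Tendsto (fun N : ℕ => u N / N) atTop (𝓝 c)) (hc : 0 < c) : ∀ᶠ N in atTop, 0 < u N := by
  filter_upwards [h.eventually_const_lt hc, eventually_gt_atTop 0] with N h1 h2
  have : (0 : ℝ) < N := by exact_mod_cast h2
  exact (div_pos_iff_of_pos_right this).1 h1

section Measure

variable {Ω : Type*} [MeasurableSpace Ω] {μ : Measure Ω} [IsProbabilityMeasure μ]
  {Δ : ℝ} {v₀ : ℤ} {X : ℕ → Ω → ℤ}

/-- The walk is confined with positive probability, with a prescribed ratio of the weights of the
neighbours of the centre. -/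
lemma exists_confined_pos (hΔ : -1 < Δ) (hX : IsVRRW Δ v₀ X μ) (x : ℤ) {α δ : ℝ} (hα : 0 < α)
    (hα1 : α < 1) (hδ : 0 < δ) : ∃ (n₀ : ℕ) (K₂ : ℝ) (A B : ℝ),
      |(Real.log B - Real.log A) - Real.log ((1 - α) / α)| ≤ δ / 4 ∧ 1 / B + 1 / A ≤ δ / 4 ∧
      0 < μ {ω | (wt Δ (traj X ω) n₀ (x - 1) = A ∧ wt Δ (traj X ω) n₀ (x + 1) = B) ∧
        Confined Δ (traj X ω) x n₀ (δ / 8) K₂ (δ / 8)} := by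
  have hc := compConst_pos hΔ
  have hΔ1 : 0 < 1 + Δ := by linarith
  have hβ : 0 < 1 - α := by linarith
  obtain ⟨Z, hZ⟩ := exists_reachable hΔ hX x
  -- The margin will be m = ηN. It lies strictly below both neighbouring weights, of order αN and
  -- (1-α)N, and below the surplus of Z(x) over either of them. Those weights are eventually less
  -- than 2N, which explains the 2 in `θ`.
  set η := min α (1 - α) / 2 with hη
  have hη0 : 0 < η := by have := lt_min hα hβ; positivity
  have hηα : η < α := by have := min_le_left α (1 - α); have := lt_min hα hβ; linarith
  have hηβ : η < 1 - α := by have := min_le_right α (1 - α); have := lt_min hα hβ; linarith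
  set θ := 1 + η / (2 * Real.exp (δ / 8 + δ / 8)) with hθ
  have hθ1 : 1 < θ := by have : 0 < η / (2 * Real.exp (δ / 8 + δ / 8)) := by positivity
                         linarith
  -- The outer martingales start with energies that need not be small, so `K₂` is merely a constant
  -- independent of N, with K₂² ≥ 16 · `compConst Δ`/(1+Δ).
  set K₂ := 1 + 16 * (compConst Δ / (1 + Δ)) with hK₂
  have hK₂1 : 1 ≤ K₂ := by have : 0 < compConst Δ / (1 + Δ) := by positivity
                           linarith
  have hE₂ : 2 * (compConst Δ / (1 + Δ)) ≤ K₂ ^ 2 / 8 := by nlinarith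
  set A : ℕ → ℝ := fun N => ((Z (x - 1) : ℝ) + Δ) + (⌊α * N⌋₊ : ℝ) with hA
  set B : ℕ → ℝ := fun N => ((Z (x + 1) : ℝ) + Δ) + (⌊(1 - α) * N⌋₊ : ℝ) with hB
  have hAN : Tendsto (fun N : ℕ => A N / N) atTop (𝓝 α) := tendsto_add_floor_div _ hα.le
  have hBN : Tendsto (fun N : ℕ => B N / N) atTop (𝓝 (1 - α)) := tendsto_add_floor_div _ hβ.le
  have hA' : Tendsto A atTop atTop := tendsto_add_floor_atTop _ hα
  have hB' : Tendsto B atTop atTop := tendsto_add_floor_atTop _ hβ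
  have hconst : ∀ c : ℝ, Tendsto (fun N : ℕ => c / (N : ℝ)) atTop (𝓝 0) := fun c =>
    tendsto_const_div_atTop_nhds_zero_nat c
  have hηN : Tendsto (fun N : ℕ => η * (N : ℝ) / N) atTop (𝓝 η) := by
    refine (tendsto_const_nhds (x := η)).congr' ?_
    filter_upwards [eventually_gt_atTop 0] with N hN
    have : (N : ℝ) ≠ 0 := by positivity
    field_simp
  have ev1 : ∀ᶠ N : ℕ in atTop, 0 < A N - η * N - 1 := by
    refine eventually_pos_of_tendsto_div (c := α - η - 0) ?_ (by linarith)
    refine ((hAN.sub hηN).sub (hconst 1)).congr fun N => ?_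
    ring
  have ev2 : ∀ᶠ N : ℕ in atTop, 0 < B N - η * N - 1 := by
    refine eventually_pos_of_tendsto_div (c := (1 - α) - η - 0) ?_ (by linarith)
    refine ((hBN.sub hηN).sub (hconst 1)).congr fun N => ?_
    ring
  have ev3 : ∀ c : ℝ, ∀ᶠ N : ℕ in atTop, 0 < A N - η * N + c := by
    intro c
    refine eventually_pos_of_tendsto_div (c := α - η + 0) ?_ (by linarith)
    refine ((hAN.sub hηN).add (hconst c)).congr fun N => ?_
    ring
  have ev4 : ∀ c : ℝ, ∀ᶠ N : ℕ in atTop, 0 < B N - η * N + c := by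
    intro c
    refine eventually_pos_of_tendsto_div (c := (1 - α) - η + 0) ?_ (by linarith)
    refine ((hBN.sub hηN).add (hconst c)).congr fun N => ?_
    ring
  have ev5 : ∀ᶠ N : ℕ in atTop, A N / N < 2 := hAN.eventually_lt_const (by linarith)
  have ev6 : ∀ᶠ N : ℕ in atTop, B N / N < 2 := hBN.eventually_lt_const (by linarith)
  have ev7 : ∀ c : ℝ, ∀ᶠ N : ℕ in atTop, c / A N < δ / 8 := fun c =>
    (hA'.const_div_atTop c).eventually_lt_const (by positivity)
  have ev8 : ∀ c : ℝ, ∀ᶠ N : ℕ in atTop, c / B N < δ / 8 := fun c =>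
    (hB'.const_div_atTop c).eventually_lt_const (by positivity)
  have ev9 : ∀ᶠ N : ℕ in atTop,
      |(Real.log (B N) - Real.log (A N)) - Real.log ((1 - α) / α)| < δ / 4 := by
    have h1 := (hBN.log hβ.ne').sub (hAN.log hα.ne')
    rw [← Real.log_div hβ.ne' hα.ne'] at h1
    have h2 : Tendsto (fun N => Real.log (B N) - Real.log (A N)) atTop
        (𝓝 (Real.log ((1 - α) / α))) := by
      refine h1.congr' ?_
      filter_upwards [eventually_gt_atTop 0, hA'.eventually_gt_atTop 0,
        hB'.eventually_gt_atTop 0] with N h1 h2 h3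
      have : (N : ℝ) ≠ 0 := by positivity
      rw [Real.log_div h3.ne' this, Real.log_div h2.ne' this]
      ring
    have h3 := (h2.sub_const (Real.log ((1 - α) / α))).abs
    rw [sub_self, abs_zero] at h3
    exact h3.eventually_lt_const (by positivity)
  have ev10 : ∀ᶠ N : ℕ in atTop,
      compConst Δ / B N + compConst Δ / A N < (δ / 8) ^ 2 / 4 := by
    have := (hB'.const_div_atTop (compConst Δ)).add (hA'.const_div_atTop (compConst Δ))
    rw [add_zero] at this
    exact this.eventually_lt_const (by positivity)
  set cr := (Z (x + 2) : ℝ) + Δ with hcr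
  set cl := (Z (x - 2) : ℝ) + Δ with hcl
  -- Since `θ`, `K₂`, `cl` and `cr` do not depend on N, the bounds on the end points are constants
  -- divided by `A N` or `B N` and fall below δ/8.
  have hall := (eventually_gt_atTop 0).and (ev1.and (ev2.and
    ((ev3 (Z x + Δ - 1 - (Z (x - 1) + Δ) - (Z (x + 1) + Δ))).and
    ((ev4 (Z x + Δ - 1 - (Z (x - 1) + Δ) - (Z (x + 1) + Δ))).and (ev5.and (ev6.and
    (((ev7 1).and (ev8 1)).and
    ((ev7 ((cl * Real.exp K₂) ^ θ * ∑' j : ℕ, 1 / (cl + 1 + j) ^ θ)).and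
    ((ev8 ((cr * Real.exp K₂) ^ θ * ∑' j : ℕ, 1 / (cr + 1 + j) ^ θ)).and (ev9.and ev10))))))))))
  obtain ⟨N, hN, h1, h2, h3, h4, h5, h6, ⟨h7, h8⟩, h9, h10, h11, h12⟩ := hall.exists
  have hN0 : (0 : ℝ) < N := by exact_mod_cast hN
  obtain ⟨Z', ⟨n₀, p₀, hcyl, hp₀, hvis⟩, e1, e2, e3, e4, e5⟩ :=
    hZ.bounce hΔ hX ⌊α * N⌋₊ ⌊(1 - α) * N⌋₊
  have wA : wt Δ p₀ n₀ (x - 1) = A N := by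
    simp only [wt, hvis, e2, hA]; push_cast; ring
  have wB : wt Δ p₀ n₀ (x + 1) = B N := by
    simp only [wt, hvis, e3, hB]; push_cast; ring
  have wcl : wt Δ p₀ n₀ (x - 2) = cl := by simp only [wt, hvis, e4, hcl]
  have wcr : wt Δ p₀ n₀ (x + 2) = cr := by simp only [wt, hvis, e5, hcr]
  have wL : (visits p₀ n₀ x : ℝ) = Z x + (A N - (Z (x - 1) + Δ)) + (B N - (Z (x + 1) + Δ)) := by
    simp only [hvis, e1, hA, hB]; push_cast; ring
  have hηN0 : 0 < η * N := by positivity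
  have hA0 : 0 < A N := by linarith only [h1, hηN0]
  have hB0 : 0 < B N := by linarith only [h2, hηN0]
  have hratio : ∀ W : ℝ, 0 < W → W / N < 2 →
      θ ≤ 1 + η * N / (W * Real.exp (δ / 8 + δ / 8)) := by
    intro W hW hW2
    rw [div_lt_iff₀ hN0] at hW2
    rw [hθ]
    refine add_le_add le_rfl ?_
    rw [div_le_div_iff₀ (by positivity) (by positivity)]
    have hE := Real.exp_pos (δ / 8 + δ / 8)
    have := mul_le_mul_of_nonneg_right hW2.le (mul_pos hη0 hE).le
    linarith
  have hpos := confined_pos (x := x) (K₁ := δ / 8) (K₂ := K₂) (D := δ / 8) (θ := θ) (m := η * N)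
    hΔ hX hcyl hp₀
    hηN0 (by positivity) (by linarith only [hK₂1]) hθ1
    (by rw [wB, wL]; linarith only [h3]) (by rw [wA, wL]; linarith only [h4])
    (by rw [wB]; linarith only [h2]) (by rw [wA]; linarith only [h1])
    (by rw [wB]; exact hratio _ hB0 h6) (by rw [wA]; exact hratio _ hA0 h5)
    (by rw [wB, wcr, div_mul_eq_mul_div]; exact h10.le)
    (by rw [wA, wcl, div_mul_eq_mul_div]; exact h9.le)
    (by rw [wA, wB]; exact h12.le) hE₂
  refine ⟨n₀, K₂, A N, B N, h11.le, by linarith only [h7, h8], hpos.trans_le (measure_mono fun ω hω => ?_)⟩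
  have hω1 : ∀ i ≤ n₀, traj X ω i = p₀ i := hω.1
  exact ⟨⟨by rw [wt_congr hω1, wA], by rw [wt_congr hω1, wB]⟩, hω.2⟩

/-- Localization on five sites with positive probability. -/
lemma localization_pos (hΔ : -1 < Δ) (hX : IsVRRW Δ v₀ X μ) (x : ℤ) {α ε : ℝ} (hα : 0 < α)
    (hα1 : α < 1) (hε : 0 < ε) :
    0 < μ {ω | asymptoticRange (fun k => X k ω) = {x - 2, x - 1, x, x + 1, x + 2} ∧
      ∃ l ∈ Set.Ioo (α - ε) (α + ε),
        Tendsto (fun n => alphaMinus (fun k => X k ω) x n) atTop (𝓝 l)} := by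
  set t₀ := Real.log ((1 - α) / α) with ht₀
  have hcont : ContinuousAt (fun t : ℝ => 1 / (1 + Real.exp t)) t₀ := by
    refine ContinuousAt.div continuousAt_const (by fun_prop) ?_
    have := Real.exp_pos t₀
    positivity
  have hval : 1 / (1 + Real.exp t₀) = α := by
    have hβ : 0 < 1 - α := by linarith
    rw [ht₀, Real.exp_log (by positivity)]
    field_simp
    ring
  obtain ⟨δ, hδ, hball⟩ := Metric.continuousAt_iff.1 hcont ε hε
  obtain ⟨n₀, K₂, A, B, h1, h2, hpos⟩ := exists_confined_pos hΔ hX x hα hα1 hδ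
  refine hpos.trans_le (measure_mono_ae ?_)
  filter_upwards [ae_tendsto_stepMart hΔ hX x] with ω hω hC
  obtain ⟨⟨hA, hB⟩, hC⟩ : (wt Δ (traj X ω) n₀ (x - 1) = A ∧ wt Δ (traj X ω) n₀ (x + 1) = B) ∧
        Confined Δ (traj X ω) x n₀ (δ / 8) K₂ (δ / 8) := hC
  obtain ⟨c, hc⟩ := hω
  have hM : ∃ c, Tendsto (fun n => stepMart Δ (traj X ω) n₀ x 0 n) atTop (𝓝 c) := by
    refine ⟨_, (hc.sub_const (stepMart Δ (traj X ω) 0 x 0 n₀)).congr' ?_⟩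
    filter_upwards [eventually_ge_atTop n₀] with n hn
    unfold stepMart
    rw [jumpSum_eq_sub hn, jumpSum_eq_sub (b := x - 1) hn]
    ring
  obtain ⟨l, hl⟩ := hC.tendsto_log_ratio hΔ hM
  refine ⟨hC.asymptoticRange_eq hΔ, 1 / (1 + Real.exp l), ?_, hC.tendsto_alphaMinus hΔ hl⟩
  -- The drift of the logarithmic ratio after `n₀` is at most K₁ + 2D + 1/B + 1/A ≤ 5δ/8. With the
  -- initial error δ/4 this makes 7δ/8 < δ.
  have hle : |l - (Real.log B - Real.log A)| ≤ δ / 8 + 2 * (δ / 8) + δ / 4 := by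
    refine le_of_tendsto (hl.sub_const (Real.log B - Real.log A)).abs ?_
    filter_upwards [eventually_ge_atTop n₀] with n hn
    have := hC.abs_log_ratio_sub_le hΔ hn
    rw [hA, hB] at this
    linarith
  have hdist : dist l t₀ < δ := by
    rw [Real.dist_eq, abs_lt]
    rw [abs_le] at hle h1
    constructor <;> linarith
  have := hball hdist
  rw [hval, Real.dist_eq, abs_lt] at this
  exact ⟨by linarith, by linarith⟩

end Measure
theorem mainTheorem2 {Ω : Type*} [MeasurableSpace Ω] (μ : Measure Ω) [IsProbabilityMeasure μ]
    (Δ : ℝ) (hΔ : -1 < Δ) (v₀ : ℤ) (X : ℕ → Ω → ℤ) (hX : IsVRRW Δ v₀ X μ) :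
    (∀ (x : ℤ) (α ε : ℝ), 0 < α → α < 1 → 0 < ε →
      0 < μ {ω | asymptoticRange (fun k => X k ω) = {x - 2, x - 1, x, x + 1, x + 2} ∧
        ∃ l ∈ Set.Ioo (α - ε) (α + ε),
          Tendsto (fun n => alphaMinus (fun k => X k ω) x n) atTop (𝓝 l)}) ∧
    (∀ᵐ ω ∂μ, (visitedRange (fun k => X k ω)).Finite) ∧
    (∀ᵐ ω ∂μ, (asymptoticRange (fun k => X k ω)).Finite) := by
  refine ⟨fun x _ _ h0 h1 hε => localization_pos hΔ hX x h0 h1 hε, ae_finite_visitedRange hΔ hX, ?_⟩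
  filter_upwards [ae_finite_visitedRange hΔ hX] with ω h
  refine h.subset fun v hv hv' => ?_
  rw [asymptoticRange, Set.mem_ofPred_eq, hv'] at hv
  exact absurd hv (by simp)
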